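/- Let $I$ be a finite set and let $\mathcal V=(V,\eta,\xi)$ be a polarized arrangement indexed by $I$: $V\subset\mathbb R^I$ is a linear subspace, $\eta\in\mathbb R^I/V$, $\xi\in V^*$, every lift of $\eta$ to $\mathbb R^I$ has at least $|I|-\dim V$ non-zero entries, and every lift of $\xi$ to $(\mathbb R^I)^*$ has at least $\dim V$ non-zero entries. Put $V_\eta=\{x\in\mathbb R^I: x+V=\eta\}$ and $H_S=\{x\in V_\eta: x_i=0 \text{ for all } i\in S\}$ for $S\subset I$. For $\alpha\in\{\pm1\}^I$ put $\Delta_\alpha=\{x\in V_\eta:\alpha(i)x_i\ge 0\ \forall i\}$ and $\Sigma_\alpha=\{x\in V:\alpha(i)x_i\ge 0\ \forall i\}$. Let $\mathcal F$ be the set of $\alpha$ with $\Delta_\alpha\ne\emptyset$ (feasible) and $\mathcal P\subset\mathcal F$ the set of those $\alpha \in \mathcal F$ for which moreover $\xi(\Sigma_\alpha)$ is bounded above (bounded feasible). A basis is a subset $b\subset I$ with $|b|=\dim V$ and $H_b\neq\emptyset$; then $H_b$ is a point. Let $\mu$ be the bijection from bases to $\mathcal P$ that sends $b$ to the unique sign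 vector $\alpha$ such that $\xi$ attains its maximum on $\Delta_\alpha$ at $H_b$. Let $\le$ be the partial order on $\mathcal P$ that is the reflexive and transitive closure of the relation $\mu(b_1)\prec\mu(b_2)$ whenever $|b_1\cap b_2|=\dim V-1$ and $\xi(H_{b_1})<\xi(H_{b_2})$. Write $\alpha\leftrightarrow\beta$ if $\alpha,\beta$ differ in exactly one entry, and $\alpha^i$ for the sign vector that differs from $\alpha$ exactly in the $i$-th entry. Let $Q$ be the quiver with vertex set $\mathcal F$ and one arrow from $\alpha$ to $\beta$ whenever $\alpha\leftrightarrow\beta$; let $P(Q)$ be its real path algebra, with idempotents $e_\alpha$ and arrows $p(\alpha,\beta)\in e_\alpha P(Q) e_\beta$, and let $t_i\in V^*$ be the restriction to $V$ of the $i$-th coordinate. Let $A=A(\mathcal V)$ be the quotient of $P(Q)\otimes_{\mathbb R}\operatorname{Sym}V^*$ by the two-sided ideal generated by: (A1) $e_\alpha=0$ for $\alpha\in\mathcal F\smallsetminus\mathcal P$; (A2) $p(\alpha,\beta)p(\beta,\gamma)=p(\alpha,\delta)p(\delta,\gamma)$ for distinct $\alpha,\beta,\gamma,\delta\in\mathcal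 F$ with $\alpha\leftrightarrow\beta\leftrightarrow\gamma\leftrightarrow\delta\leftrightarrow\alpha$; (A3) $p(\alpha,\alpha^i)p(\alpha^i,\alpha)=t_ie_\alpha$ for $\alpha,\alpha^i\in\mathcal F$. Grade $A$ by $\deg e_\alpha=0$, $\deg p(\alpha,\beta)=1$, $\deg t_i=2$. For $\alpha\in\mathcal P$ consider the right $A$-modules $$L_\alpha=A/\langle e_\beta\mid\beta\in\mathcal P,\ \beta\ne\alpha\rangle,\qquad P_\alpha=e_\alpha A,\qquad V_\alpha=P_\alpha/K_{>\alpha},\qquad K_{>\alpha}=\sum_{i\in\mu^{-1}(\alpha)}p(\alpha,\alpha^i)\cdot A\subset P_\alpha,$$ with the natural projections $\Pi_\alpha:P_\alpha\to V_\alpha$ and $\pi_\alpha:V_\alpha\to L_\alpha$. **Theorem.** The algebra $A$ is quasi-hereditary with respect to the partial order $\le$ on $\mathcal P$, with the modules $V_\alpha$ as standard modules. That is: $A$ is finite-dimensional over $\mathbb R$; the $L_\alpha$ ($\alpha\in\mathcal P$) are pairwise non-isomorphic simple right $A$-modules and every simple right $A$-module is isomorphic to one of them; $\pi_\alpha\circ\Pi_\alpha:P_\alpha\to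 L_\alpha$ is a projective cover, and $L_\alpha$ has an injective hull that is finitely generated; $\Pi_\alpha$ and $\pi_\alpha$ are surjective; for every $\alpha\in\mathcal P$, $\ker\pi_\alpha$ has a finite filtration each of whose sub-quotients is isomorphic to $L_\beta$ for some $\beta<\alpha$, and $\ker\Pi_\alpha$ has a finite filtration each of whose sub-quotients is isomorphic to $V_\gamma$ for some $\gamma>\alpha$. This structure is compatible with the grading: the above degrees define an algebra grading of $A$, the subspaces $P_\alpha\cap A_n$ form a grading of the right module $P_\alpha$, and each $V_\alpha$ admits a grading as a right $A$-module for which $\Pi_\alpha$ preserves degrees. -/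

import Mathlib

open scoped TensorProduct

noncomputable section

universe u v w

/-! ## Generalities on modules -/

/-- `M` has a finite filtration by submodules each of whose successive quotients is isomorphic to
`X j` for some `j ∈ s`. -/
def HasFiltrationBy (R : Type v) [Ring R] (M : Type w) [AddCommGroup M] [Module R M]
    {J : Type*} (X : J → Type*) [∀ j, AddCommGroup (X j)] [∀ j, Module R (X j)]
    (s : Set J) : Prop :=
  ∃ (n : ℕ) (F : ℕ → Submodule R M), F 0 = ⊥ ∧ F n = ⊤ ∧
    ∀ k < n, F k ≤ F (k + 1) ∧
      ∃ j ∈ s, Nonempty ((F (k + 1) ⧸ (F k).submoduleOf (F (k + 1))) ≃ₗ[R] X j)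

/-- `f : P → M` is a projective cover: `P` is projective, `f` is surjective and its kernel is
superfluous. -/
def IsProjectiveCover {R : Type v} [Ring R] {P M : Type w} [AddCommGroup P] [Module R P]
    [AddCommGroup M] [Module R M] (f : P →ₗ[R] M) : Prop :=
  Module.Projective R P ∧ Function.Surjective f ∧
    ∀ N : Submodule R P, N ⊔ LinearMap.ker f = ⊤ → N = ⊤

/-- `f : M → J` is an injective hull: `J` is injective, `f` is injective and its range is
essential. -/
def IsInjectiveHull {R : Type v} [Ring R] {M J : Type w} [AddCommGroup M] [Module R M]
    [AddCommGroup J] [Module R J] (f : M →ₗ[R] J) : Prop :=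
  Module.Injective R J ∧ Function.Injective f ∧
    ∀ N : Submodule R J, N ⊓ LinearMap.range f = ⊥ → N = ⊥

/-- The finite-dimensional real algebra `E` is quasi-hereditary with respect to the partial order
on `ι`: the category of finitely generated right `E`-modules (that is, `Eᵐᵒᵖ`-modules) is highest
weight, with simple objects `L α`, projective covers `P α`, standard objects `V α` and epimorphisms
`Pr α : P α → V α` and `pr α : V α → L α`.
(Finite generation of `P α` and `V α` is automatic, because a projective cover of a simple module
is cyclic.) -/
structure IsQuasiHereditary (E : Type u) [Ring E] [Algebra ℝ E] {ι : Type u} [PartialOrder ι]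
    (L P V : ι → Type u)
    [∀ α, AddCommGroup (L α)] [∀ α, Module Eᵐᵒᵖ (L α)]
    [∀ α, AddCommGroup (P α)] [∀ α, Module Eᵐᵒᵖ (P α)]
    [∀ α, AddCommGroup (V α)] [∀ α, Module Eᵐᵒᵖ (V α)]
    (Pr : ∀ α, P α →ₗ[Eᵐᵒᵖ] V α) (pr : ∀ α, V α →ₗ[Eᵐᵒᵖ] L α) : Prop where
  /-- `E` is finite-dimensional, so that finitely generated modules have finite length. -/
  finiteDimensional : FiniteDimensional ℝ E
  /-- The `L α` are simple, ... -/
  simple : ∀ α, IsSimpleModule Eᵐᵒᵖ (L α)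
  /-- ... pairwise non-isomorphic, ... -/
  eq_of_iso : ∀ α β, Nonempty (L α ≃ₗ[Eᵐᵒᵖ] L β) → α = β
  /-- ... and exhaust the simple modules. -/
  exhaust : ∀ (S : Type u) [AddCommGroup S] [Module Eᵐᵒᵖ S], IsSimpleModule Eᵐᵒᵖ S →
    ∃ α, Nonempty (S ≃ₗ[Eᵐᵒᵖ] L α)
  /-- `P α` is a projective cover of `L α`. -/
  projectiveCover : ∀ α, IsProjectiveCover (pr α ∘ₗ Pr α)
  /-- `L α` has an injective hull among the finitely generated modules. -/
  injectiveHull : ∀ α, ∃ (J : Type u) (_ : AddCommGroup J) (_ : Module Eᵐᵒᵖ J)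
    (f : L α →ₗ[Eᵐᵒᵖ] J), Module.Finite Eᵐᵒᵖ J ∧ IsInjectiveHull f
  epi_Pr : ∀ α, Function.Surjective (Pr α)
  epi_pr : ∀ α, Function.Surjective (pr α)
  /-- `ker (V α → L α)` is filtered by simples `L β` with `β < α`. -/
  ker_pr : ∀ α, HasFiltrationBy Eᵐᵒᵖ (LinearMap.ker (pr α)) L {β | β < α}
  /-- `ker (P α → V α)` is filtered by standards `V γ` with `γ > α`. -/
  ker_Pr : ∀ α, HasFiltrationBy Eᵐᵒᵖ (LinearMap.ker (Pr α)) V {γ | γ > α}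

/-- `𝒜` is a grading of the algebra `E`. -/
def IsAlgebraGrading {E : Type u} [Ring E] [Algebra ℝ E] (𝒜 : ℕ → Submodule ℝ E) : Prop :=
  SetLike.GradedMonoid 𝒜 ∧ DirectSum.IsInternal 𝒜

/-- `ℳ` is a grading of the right module `M` over the algebra `E` graded by `𝒜`. -/
def IsRightModuleGrading {E : Type u} [Ring E] [Algebra ℝ E] (𝒜 : ℕ → Submodule ℝ E)
    {M : Type w} [AddCommGroup M] [Module ℝ M] [Module Eᵐᵒᵖ M] (ℳ : ℕ → Submodule ℝ M) : Prop :=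
  DirectSum.IsInternal ℳ ∧
    ∀ m n : ℕ, ∀ x ∈ ℳ m, ∀ a ∈ 𝒜 n, MulOpposite.op a • x ∈ ℳ (m + n)

/-! ## Path algebras -/

/-- Generators of the path algebra of the quiver with vertices `X` and exactly one arrow `x → y`
whenever `r x y`: the vertices and the arrows. -/
inductive PathAlgebraGen {X : Type u} (r : X → X → Prop) : Type u
  | vertex (x : X) : PathAlgebraGen r
  | arrow (x y : X) (h : r x y) : PathAlgebraGen r

/-- Defining relations of the path algebra (products are read from left to right: the arrow
`x → y` lies in `e x * _ * e y`). -/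
inductive PathAlgebraRel {X : Type u} [Fintype X] (r : X → X → Prop) :
    FreeAlgebra ℝ (PathAlgebraGen r) → FreeAlgebra ℝ (PathAlgebraGen r) → Prop
  | idem (x : X) : PathAlgebraRel r
      (FreeAlgebra.ι ℝ (.vertex x) * FreeAlgebra.ι ℝ (.vertex x)) (FreeAlgebra.ι ℝ (.vertex x))
  | orth (x y : X) (h : x ≠ y) : PathAlgebraRel r
      (FreeAlgebra.ι ℝ (.vertex x) * FreeAlgebra.ι ℝ (.vertex y)) 0
  | unit : PathAlgebraRel r (∑ x, FreeAlgebra.ι ℝ (.vertex x)) 1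
  | source (x y : X) (h : r x y) : PathAlgebraRel r
      (FreeAlgebra.ι ℝ (.vertex x) * FreeAlgebra.ι ℝ (.arrow x y h))
      (FreeAlgebra.ι ℝ (.arrow x y h))
  | target (x y : X) (h : r x y) : PathAlgebraRel r
      (FreeAlgebra.ι ℝ (.arrow x y h) * FreeAlgebra.ι ℝ (.vertex y))
      (FreeAlgebra.ι ℝ (.arrow x y h))

/-- The real path algebra of the quiver with vertices `X` and one arrow `x → y` whenever `r x y`. -/
abbrev PathAlgebra {X : Type u} [Fintype X] (r : X → X → Prop) : Type u :=
  RingQuot (PathAlgebraRel r)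

/-- The idempotent at a vertex. -/
def PathAlgebra.e {X : Type u} [Fintype X] {r : X → X → Prop} (x : X) : PathAlgebra r :=
  RingQuot.mkAlgHom ℝ (PathAlgebraRel r) (FreeAlgebra.ι ℝ (.vertex x))

/-- The path of length one along an arrow. -/
def PathAlgebra.p {X : Type u} [Fintype X] {r : X → X → Prop} (x y : X) (h : r x y) :
    PathAlgebra r :=
  RingQuot.mkAlgHom ℝ (PathAlgebraRel r) (FreeAlgebra.ι ℝ (.arrow x y h))

/-! ## Polarized arrangements -/

/-- A polarized arrangement `(V, η, ξ)` indexed by `I`. -/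
structure PolarizedArrangement (I : Type u) [Fintype I] where
  V : Submodule ℝ (I → ℝ)
  η : (I → ℝ) ⧸ V
  ξ : Module.Dual ℝ V
  /-- every lift of `η` has at least `|I| - dim V` non-zero entries -/
  generic_η : ∀ x : I → ℝ, V.mkQ x = η →
    Fintype.card I - Module.finrank ℝ V ≤ {i | x i ≠ 0}.ncard
  /-- every lift `∑ i, c i * x i` of `ξ` to `ℝ^I` has at least `dim V` non-zero entries -/
  generic_ξ : ∀ c : I → ℝ, (∀ v : V, ∑ i, c i * v.1 i = ξ v) →
    Module.finrank ℝ V ≤ {i | c i ≠ 0}.ncard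

/-- `α` and `β` differ in exactly one entry, the `i`-th. -/
def SignAdjAt {I : Type u} (i : I) (α β : I → ℤˣ) : Prop := ∀ j, α j ≠ β j ↔ j = i

/-- `α` and `β` differ in exactly one entry. -/
def SignAdj {I : Type u} (α β : I → ℤˣ) : Prop := ∃ i, SignAdjAt i α β

namespace PolarizedArrangement

variable {I : Type u} [Fintype I] (𝒱 : PolarizedArrangement I)

/-- The affine space `V_η`. -/
abbrev Aff : Type u := {x : I → ℝ // 𝒱.V.mkQ x = 𝒱.η}

/-- The difference `ξ(y) - ξ(x)` for two points of `V_η`. -/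
def rise (x y : 𝒱.Aff) : ℝ :=
  𝒱.ξ ⟨y.1 - x.1, (Submodule.Quotient.eq 𝒱.V).1 (y.2.trans x.2.symm)⟩

/-- The flat `H_S`. -/
def flat (S : Set I) : Set 𝒱.Aff := {x | ∀ i ∈ S, x.1 i = 0}

/-- The polyhedron `Δ_α`. -/
def chamber (α : I → ℤˣ) : Set 𝒱.Aff := {x | ∀ i, 0 ≤ ((α i : ℤ) : ℝ) * x.1 i}

/-- The cone `Σ_α`. -/
def cone (α : I → ℤˣ) : Set 𝒱.V := {x | ∀ i, 0 ≤ ((α i : ℤ) : ℝ) * x.1 i}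

/-- `α` is feasible. -/
def IsFeasible (α : I → ℤˣ) : Prop := (𝒱.chamber α).Nonempty

/-- `α` is bounded. -/
def IsBoundedSign (α : I → ℤˣ) : Prop := BddAbove (𝒱.ξ '' 𝒱.cone α)

/-- The set `ℱ` of feasible sign vectors. -/
abbrev Feas : Type u := {α : I → ℤˣ // 𝒱.IsFeasible α}

/-- The set `𝒫` of bounded feasible sign vectors. -/
@[ext]
structure BFeas : Type u where
  sign : I → ℤˣ
  feasible : 𝒱.IsFeasible sign
  bounded : 𝒱.IsBoundedSign sign

/-- The inclusion of `𝒫` in `ℱ`. -/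
abbrev BFeas.toFeas {𝒱 : PolarizedArrangement I} (α : 𝒱.BFeas) : 𝒱.Feas := ⟨α.sign, α.feasible⟩

instance instFintypeFeas : Fintype 𝒱.Feas :=
  Fintype.ofFinite _

/-- `b` is a basis. -/
def IsBasis (b : Set I) : Prop := b.ncard = Module.finrank ℝ 𝒱.V ∧ (𝒱.flat b).Nonempty

/-- `b` is a basis, `x` is the point `H_b`, and `ξ` attains its maximum on `Δ_α` at `x`. -/
def IsMaxAt (b : Set I) (x : 𝒱.Aff) (α : I → ℤˣ) : Prop :=
  𝒱.IsBasis b ∧ x ∈ 𝒱.flat b ∧ x ∈ 𝒱.chamber α ∧ ∀ y ∈ 𝒱.chamber α, 𝒱.rise x y ≤ 0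

/-- The graph `μ(b) = α` of the bijection `μ` from bases to bounded feasible sign vectors: `ξ`
attains its maximum on `Δ_α` at the point `H_b`. -/
def IsMu (b : Set I) (α : I → ℤˣ) : Prop := ∃ x, 𝒱.IsMaxAt b x α

/-- The generating relation of the partial order, transported from bases to bounded feasible sign
vectors by `μ`: `|b₁ ∩ b₂| = dim V - 1` and `ξ(H_{b₁}) < ξ(H_{b₂})`, where `μ(b₁) = α` and
`μ(b₂) = β`. -/
def Prec (α β : 𝒱.BFeas) : Prop :=
  ∃ (b₁ b₂ : Set I) (x₁ x₂ : 𝒱.Aff), 𝒱.IsMaxAt b₁ x₁ α.sign ∧ 𝒱.IsMaxAt b₂ x₂ β.sign ∧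
    (b₁ ∩ b₂).ncard + 1 = Module.finrank ℝ 𝒱.V ∧ 0 < 𝒱.rise x₁ x₂

theorem rise_add (x y z : 𝒱.Aff) : 𝒱.rise x y + 𝒱.rise y z = 𝒱.rise x z := by
  unfold rise
  rw [← map_add]
  congr 1
  ext i
  simp

theorem rise_pos_of_transGen {α β : 𝒱.BFeas} (h : Relation.TransGen 𝒱.Prec α β) :
    ∃ x ∈ 𝒱.chamber α.sign, ∃ y ∈ 𝒱.chamber β.sign,
      (∀ z ∈ 𝒱.chamber α.sign, 𝒱.rise x z ≤ 0) ∧ (∀ z ∈ 𝒱.chamber β.sign, 𝒱.rise y z ≤ 0) ∧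
      0 < 𝒱.rise x y := by
  induction h with
  | single h =>
    obtain ⟨_, _, x, y, hx, hy, _, hxy⟩ := h
    exact ⟨x, hx.2.2.1, y, hy.2.2.1, hx.2.2.2, hy.2.2.2, hxy⟩
  | tail _ h ih =>
    obtain ⟨x, hx, y, hy, hxm, hym, hxy⟩ := ih
    obtain ⟨_, _, y', z, hy', hz, _, hyz⟩ := h
    refine ⟨x, hx, z, hz.2.2.1, hxm, hz.2.2.2, ?_⟩
    have h1 := hy'.2.2.2 y hy
    have h2 := 𝒱.rise_add x y z
    have h3 := 𝒱.rise_add y' y z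
    linarith

theorem not_transGen_self (α : 𝒱.BFeas) : ¬ Relation.TransGen 𝒱.Prec α α := fun h => by
  obtain ⟨x, hx, y, hy, hxm, -, hxy⟩ := 𝒱.rise_pos_of_transGen h
  exact absurd (hxm y hy) (not_le.2 hxy)

/-- The partial order on bounded feasible sign vectors induced by `ξ`: the reflexive and transitive
closure of the generating relation. -/
instance instPartialOrderBFeas : PartialOrder 𝒱.BFeas where
  le := Relation.ReflTransGen 𝒱.Prec
  le_refl _ := Relation.ReflTransGen.refl
  le_trans _ _ _ := Relation.ReflTransGen.trans
  le_antisymm α β h₁ h₂ := by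
    rcases Relation.reflTransGen_iff_eq_or_transGen.1 h₁ with h | h
    · exact h.symm
    · exact absurd (h.trans_left h₂) (𝒱.not_transGen_self α)

/-! ## The algebra `A` -/

/-- The path algebra `P(Q)` of the quiver with vertex set `ℱ` and one arrow `α → β` for each
ordered pair of adjacent vertices. -/
abbrev PathAlg : Type u := PathAlgebra (fun α β : 𝒱.Feas => SignAdj α.1 β.1)

/-- The restriction `t_i` to `V` of the `i`-th coordinate function. -/
def t (i : I) : Module.Dual ℝ 𝒱.V := LinearMap.proj i ∘ₗ 𝒱.V.subtype

/-- `P(Q) ⊗ Sym V*` -/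
abbrev PreA : Type u := 𝒱.PathAlg ⊗[ℝ] SymmetricAlgebra ℝ (Module.Dual ℝ 𝒱.V)

/-- The defining relations of `A`: unbounded vertices vanish, squares commute, and going back and
forth across the `i`-th hyperplane is multiplication by `t_i`. -/
inductive RelA : 𝒱.PreA → 𝒱.PreA → Prop
  | a1 (α : 𝒱.Feas) (h : ¬ 𝒱.IsBoundedSign α.1) : RelA (PathAlgebra.e α ⊗ₜ 1) 0
  | a2 (α β γ δ : 𝒱.Feas) (hd : [α, β, γ, δ].Nodup) (hαβ : SignAdj α.1 β.1)
      (hβγ : SignAdj β.1 γ.1) (hγδ : SignAdj γ.1 δ.1) (hδα : SignAdj δ.1 α.1)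
      (hαδ : SignAdj α.1 δ.1) (hδγ : SignAdj δ.1 γ.1) :
      RelA ((PathAlgebra.p α β hαβ * PathAlgebra.p β γ hβγ) ⊗ₜ 1)
        ((PathAlgebra.p α δ hαδ * PathAlgebra.p δ γ hδγ) ⊗ₜ 1)
  | a3 (i : I) (α β : 𝒱.Feas) (hi : SignAdjAt i α.1 β.1) (hαβ : SignAdj α.1 β.1)
      (hβα : SignAdj β.1 α.1) :
      RelA ((PathAlgebra.p α β hαβ * PathAlgebra.p β α hβα) ⊗ₜ 1)
        (PathAlgebra.e α ⊗ₜ SymmetricAlgebra.ι ℝ (Module.Dual ℝ 𝒱.V) (𝒱.t i))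

/-- The algebra `A(𝒱)`: the quotient of `P(Q) ⊗ Sym V*` by the two-sided ideal generated by the
relations. -/
abbrev A : Type u := RingQuot 𝒱.RelA

instance instRingA : Ring 𝒱.A := Algebra.semiringToRing ℝ

/-- The quotient map `P(Q) ⊗ Sym V* → A`. -/
def mkA : 𝒱.PreA →ₐ[ℝ] 𝒱.A := RingQuot.mkAlgHom ℝ 𝒱.RelA

/-- The idempotent `e_α` of `A`. -/
def eA (α : 𝒱.Feas) : 𝒱.A := 𝒱.mkA (PathAlgebra.e α ⊗ₜ 1)

/-- The element `p(α, β)` of `A`. -/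
def pA (α β : 𝒱.Feas) (h : SignAdj α.1 β.1) : 𝒱.A := 𝒱.mkA (PathAlgebra.p α β h ⊗ₜ 1)

/-- The image in `A` of a covector. -/
def tA (w : Module.Dual ℝ 𝒱.V) : 𝒱.A :=
  𝒱.mkA (1 ⊗ₜ SymmetricAlgebra.ι ℝ (Module.Dual ℝ 𝒱.V) w)

/-- Products of generators of `A`, with their degrees: `deg e_α = 0`, `deg p(α, β) = 1`,
`deg w = 2` for covectors `w`. -/
inductive IsWord : ℕ → 𝒱.A → Prop
  | one : IsWord 0 1
  | e (α : 𝒱.Feas) : IsWord 0 (𝒱.eA α)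
  | p (α β : 𝒱.Feas) (h : SignAdj α.1 β.1) : IsWord 1 (𝒱.pA α β h)
  | t (w : Module.Dual ℝ 𝒱.V) : IsWord 2 (𝒱.tA w)
  | mul {m n : ℕ} {a b : 𝒱.A} (ha : IsWord m a) (hb : IsWord n b) : IsWord (m + n) (a * b)

/-- The degree `n` part of `A`. -/
def gradeA (n : ℕ) : Submodule ℝ 𝒱.A := Submodule.span ℝ {a | 𝒱.IsWord n a}

theorem pA_mul_eA (α β : 𝒱.Feas) (h : SignAdj α.1 β.1) : 𝒱.pA α β h * 𝒱.eA β = 𝒱.pA α β h := by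
  unfold pA eA
  rw [← map_mul, Algebra.TensorProduct.tmul_mul_tmul, one_mul]
  congr 2
  unfold PathAlgebra.p PathAlgebra.e
  rw [← map_mul]
  exact RingQuot.mkAlgHom_rel ℝ (PathAlgebraRel.target α β h)

theorem eA_mul_pA (α β : 𝒱.Feas) (h : SignAdj α.1 β.1) : 𝒱.eA α * 𝒱.pA α β h = 𝒱.pA α β h := by
  unfold pA eA
  rw [← map_mul, Algebra.TensorProduct.tmul_mul_tmul, one_mul]
  congr 2
  unfold PathAlgebra.p PathAlgebra.e
  rw [← map_mul]
  exact RingQuot.mkAlgHom_rel ℝ (PathAlgebraRel.source α β h)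

/-! ## Simple, projective and standard right modules

Right `A`-modules are `Aᵐᵒᵖ`-modules; the `Aᵐᵒᵖ`-submodules of `A` are its right ideals. -/

/-- The two-sided ideal `⟨e_β | β ≠ α⟩`, as a right ideal. -/
def idealA (α : 𝒱.BFeas) : Submodule 𝒱.Aᵐᵒᵖ 𝒱.A :=
  Submodule.span 𝒱.Aᵐᵒᵖ {x | ∃ (a : 𝒱.A) (β : 𝒱.BFeas), β ≠ α ∧ x = a * 𝒱.eA β.toFeas}

/-- The simple right module `L_α = A / ⟨e_β | β ≠ α⟩`. -/
abbrev L (α : 𝒱.BFeas) : Type u := 𝒱.A ⧸ 𝒱.idealA α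

/-- The right ideal `P_α = e_α A`. -/
def P (α : 𝒱.BFeas) : Submodule 𝒱.Aᵐᵒᵖ 𝒱.A := Submodule.span 𝒱.Aᵐᵒᵖ {𝒱.eA α.toFeas}

/-- The right ideal `K_{>α} = ∑_{i ∈ a} p(α, α^i) A`, where `a = μ⁻¹(α)`.
(The sign vector `α^i` is feasible for every `i ∈ a`.) -/
def K (α : 𝒱.BFeas) : Submodule 𝒱.Aᵐᵒᵖ 𝒱.A :=
  Submodule.span 𝒱.Aᵐᵒᵖ {x | ∃ (a : Set I) (i : I) (β : 𝒱.Feas) (h : SignAdj α.sign β.1),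
    𝒱.IsMu a α.sign ∧ i ∈ a ∧ SignAdjAt i α.sign β.1 ∧ x = 𝒱.pA α.toFeas β h}

/-- The standard right module `V_α = P_α / K_{>α}`. -/
abbrev Std (α : 𝒱.BFeas) : Type u := 𝒱.P α ⧸ (𝒱.K α).submoduleOf (𝒱.P α)

/-- The natural projection `P_α → V_α`. -/
def projStd (α : 𝒱.BFeas) : 𝒱.P α →ₗ[𝒱.Aᵐᵒᵖ] 𝒱.Std α :=
  ((𝒱.K α).submoduleOf (𝒱.P α)).mkQ

theorem eA_eq_zero (α : 𝒱.Feas) (h : ¬ 𝒱.IsBoundedSign α.1) : 𝒱.eA α = 0 := by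
  unfold eA mkA
  rw [RingQuot.mkAlgHom_rel ℝ (RelA.a1 α h), map_zero]

theorem K_le_idealA (α : 𝒱.BFeas) : 𝒱.K α ≤ 𝒱.idealA α := by
  refine Submodule.span_le.2 ?_
  rintro x ⟨a, i, β, h, -, -, hi, rfl⟩
  rw [← pA_mul_eA]
  by_cases hβ : 𝒱.IsBoundedSign β.1
  · refine Submodule.subset_span ⟨_, ⟨β.1, β.2, hβ⟩, ?_, rfl⟩
    rintro rfl
    exact (hi i).2 rfl rfl
  · rw [𝒱.eA_eq_zero β hβ, mul_zero]
    exact Submodule.zero_mem _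

/-- The natural projection `V_α → L_α`, induced by the inclusion of `P_α = e_α A` in `A`. -/
def projSimple (α : 𝒱.BFeas) : 𝒱.Std α →ₗ[𝒱.Aᵐᵒᵖ] 𝒱.L α :=
  ((𝒱.K α).submoduleOf (𝒱.P α)).liftQ ((𝒱.idealA α).mkQ ∘ₗ (𝒱.P α).subtype) (by
    intro x hx
    simpa using 𝒱.K_le_idealA α hx)

/-- The degree `n` part of `P_α = e_α A ⊆ A`. -/
def gradeP (α : 𝒱.BFeas) (n : ℕ) : Submodule ℝ (𝒱.P α) :=
  (𝒱.gradeA n).comap ((𝒱.P α).subtype.restrictScalars ℝ)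

end PolarizedArrangement

end

/-!
# Quasi-heredity of the algebra of a polarized arrangement

The arrangement is simple, and `ξ` is not constant on any edge. Hence a bounded chamber `γ` has a
unique vertex at which `ξ` is maximal, and the walls through it (the basis `μ⁻¹(γ)`,
`BFeas.basis`) bound a cone on which `ξ` has its maximum at the apex. The relation `γ.Agree β` says
that the chamber `β` lies in the cone of `γ`. Moving along edges on which `ξ` increases without
leaving the cone shows that then `β ≤ γ` (`BFeas.le_of_vertex_mem`).

*Spanning.* A path in the quiver is taut if it crosses no hyperplane twice. All taut paths from `α`
to `β` define the same element `taut α β` of `A` (`IsTaut.unique`), because the walls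
through which one can leave the chamber `α` towards `β` are linked by commuting squares. Modulo
`K_{>γ}`, the right ideal `e_γ A` is spanned by the `taut γ β` with `β` in the cone of `γ`
(`eA_mul_mem_span_sup_K`): the covectors `t_i` with `i ∈ μ⁻¹(γ)` form a basis of `V*`, and the
`t_i e_γ` lie in `K_{>γ}`. By descending induction on `γ`, the products `taut α γ * taut γ β`, where
`α` and `β` lie in the cone of `γ`, span `A` (`eA_mul_mem_tautSpan`).

*Independence.* These products are linearly independent (`linearIndependent_orbit`). For fixed `α`
and `β` let `Y` be the set of the apices of the cones that contain both chambers. The initial ideals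
of such sets, ideals of the limits of the point sets `h Y` for `h → 0`, are compatible with
multiplication by the variables of the hyperplanes crossed twice (`crossing_mul_mem`), so that
the quotients by them form a representation of `A` (`repData`). The products with given `α` and `β`
map onto a spanning set of the quotient by the initial ideal of `Y`. Its dimension is at least the
number of points of `Y` (`ncard_le_finrank_quotient_initialIdeal`), that is, the number of products.

*Filtrations.* By independence, the ideals generated by the taut paths from `α` to upper sets of
chambers whose cones contain `α` filter `K_{>α}` with the standard modules as quotients
(`ker_projStd_hasFiltrationBy`). The standard module `V_α` has a one-dimensional part at `e_α` and
vanishes at `e_β` unless `β` lies in the cone of `α`, which gives the filtration of the kernel of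
`V_α → L_α`. A simple module is a quotient of `V_γ` for `γ` maximal with `S e_γ ≠ 0`
(`exists_equiv_L`). The injective hull of `L_α` is the dual of `A e_α`, and the grading is read off
from the algebra homomorphism `A → A[X]` that multiplies each generator by the power of `X` given by
its degree.
-/

noncomputable section

namespace PolarizedArrangement

variable {I : Type u} [Fintype I] {𝒱 : PolarizedArrangement I}

/-! ### Vertices of the arrangement -/

open Classical in
/-- The set of hyperplanes through a point of `V_η`. -/
def zeros (x : 𝒱.Aff) : Finset I := Finset.univ.filter fun i => x.1 i = 0

theorem mem_zeros {x : 𝒱.Aff} {i : I} : i ∈ zeros x ↔ x.1 i = 0 := by simp [zeros]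

/-- Translation of a point of `V_η` by a vector of `V`. -/
def shift (x : 𝒱.Aff) (v : 𝒱.V) : 𝒱.Aff :=
  ⟨x.1 + v.1, by
    rw [map_add, x.2, Submodule.mkQ_apply, (Submodule.Quotient.mk_eq_zero 𝒱.V).2 v.2, add_zero]⟩

@[simp] theorem shift_apply (x : 𝒱.Aff) (v : 𝒱.V) (i : I) : (shift x v).1 i = x.1 i + v.1 i := rfl

/-- The difference of two points of `V_η`, as a vector of `V`. -/
def diff (x y : 𝒱.Aff) : 𝒱.V := ⟨y.1 - x.1, (Submodule.Quotient.eq 𝒱.V).1 (y.2.trans x.2.symm)⟩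

@[simp] theorem diff_apply (x y : 𝒱.Aff) (i : I) : (diff x y).1 i = y.1 i - x.1 i := rfl

theorem rise_eq (x y : 𝒱.Aff) : 𝒱.rise x y = 𝒱.ξ (diff x y) := rfl

theorem rise_shift (x : 𝒱.Aff) (v : 𝒱.V) : 𝒱.rise x (shift x v) = 𝒱.ξ v := by
  rw [rise_eq]; congr 1; ext i; simp

instance : Nonempty 𝒱.Aff := by
  obtain ⟨x, hx⟩ := Submodule.mkQ_surjective 𝒱.V 𝒱.η
  exact ⟨⟨x, hx⟩⟩

theorem card_zeros_le (x : 𝒱.Aff) : (zeros x).card ≤ Module.finrank ℝ 𝒱.V := by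
  classical
  have h := 𝒱.generic_η x.1 x.2
  have h1 : {i | x.1 i ≠ 0}.ncard = (Finset.univ.filter fun i => ¬ x.1 i = 0).card := by
    rw [← Set.ncard_coe_finset]; congr 1; ext; simp
  have h2 := Finset.card_filter_add_card_filter_not (s := (Finset.univ : Finset I))
    (fun i => x.1 i = 0)
  have h3 : (zeros x).card = (Finset.univ.filter fun i => x.1 i = 0).card := by
    unfold zeros; congr
  have h4 : (Finset.univ : Finset I).card = Fintype.card I := rfl
  have h5 : Module.finrank ℝ 𝒱.V ≤ Fintype.card I := by
    simpa using Submodule.finrank_le 𝒱.V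
  omega

/-- The evaluation of vectors of `V` at the coordinates in a finite set. -/
def restr (s : Finset I) : 𝒱.V →ₗ[ℝ] (s → ℝ) :=
  LinearMap.pi fun i => 𝒱.t i.1

/-- Every point of `V_η` lies on the flat of a vertex: as long as a non-zero vector of `V` vanishes
on the hyperplanes through a point, one can move along it until a further hyperplane is met. -/
theorem exists_zeros_supset (x : 𝒱.Aff) : ∃ y : 𝒱.Aff, zeros x ⊆ zeros y ∧
    ∀ v : 𝒱.V, (∀ i ∈ zeros y, v.1 i = 0) → v = 0 := by
  classical
  induction hn : Fintype.card I - (zeros x).card using Nat.strong_induction_on generalizing x with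
  | _ n ih =>
  by_cases h : ∀ v : 𝒱.V, (∀ i ∈ zeros x, v.1 i = 0) → v = 0
  · exact ⟨x, Finset.Subset.refl _, h⟩
  push Not at h
  obtain ⟨v, hv, hv0⟩ := h
  obtain ⟨j, hj⟩ : ∃ j, v.1 j ≠ 0 := by
    by_contra! hc
    exact hv0 (Subtype.ext (funext hc))
  set y := shift x (-(x.1 j / v.1 j) • v) with hy
  have hsub : zeros x ⊂ zeros y := by
    refine (Finset.ssubset_iff_of_subset ?_).2 ⟨j, ?_, fun h => hj (hv j h)⟩
    · intro i hi
      have := mem_zeros.1 hi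
      simp [mem_zeros, hy, hv i hi, this]
    · simp [mem_zeros, hy, hj]
  have h1 := Finset.card_lt_card hsub
  have h2 := Finset.card_le_univ (zeros y)
  obtain ⟨z, hz, hz'⟩ := ih _ (by omega) y rfl
  exact ⟨z, hsub.subset.trans hz, hz'⟩

theorem eq_zero_of_vertex {x : 𝒱.Aff} (hx : (zeros x).card = Module.finrank ℝ 𝒱.V)
    {v : 𝒱.V} (hv : ∀ i ∈ zeros x, v.1 i = 0) : v = 0 := by
  obtain ⟨y, hxy, hy⟩ := exists_zeros_supset x
  have : zeros x = zeros y := Finset.eq_of_subset_of_card_le hxy (hx ▸ card_zeros_le y)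
  exact hy v (this ▸ hv)

theorem exists_vertex_supset (x : 𝒱.Aff) : ∃ y : 𝒱.Aff, zeros x ⊆ zeros y ∧
    (zeros y).card = Module.finrank ℝ 𝒱.V := by
  obtain ⟨y, hxy, hy⟩ := exists_zeros_supset x
  refine ⟨y, hxy, (card_zeros_le y).antisymm ?_⟩
  have hinj : Function.Injective (restr (𝒱 := 𝒱) (zeros y)) := by
    rw [injective_iff_map_eq_zero]
    exact fun v hv => hy v fun i hi => congrFun hv ⟨i, hi⟩
  simpa using LinearMap.finrank_le_finrank_of_injective hinj

/-- The arrangement is simple: the coordinates vanishing at a point are independent on `V`. -/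
theorem exists_vector (x : 𝒱.Aff) (s : I → ℝ) : ∃ v : 𝒱.V, ∀ i ∈ zeros x, v.1 i = s i := by
  obtain ⟨y, hxy, hy⟩ := exists_vertex_supset x
  have hinj : Function.Injective (restr (𝒱 := 𝒱) (zeros y)) := by
    rw [injective_iff_map_eq_zero]
    exact fun v hv => eq_zero_of_vertex hy fun i hi => congrFun hv ⟨i, hi⟩
  have hsurj := (LinearMap.injective_iff_surjective_of_finrank_eq_finrank (by simp [hy])).1 hinj
  obtain ⟨v, hv⟩ := hsurj fun i => s i.1
  exact ⟨v, fun i hi => congrFun hv ⟨i, hxy hi⟩⟩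

theorem eq_of_vertex {x y : 𝒱.Aff} (hx : (zeros x).card = Module.finrank ℝ 𝒱.V)
    (h : ∀ i ∈ zeros x, y.1 i = 0) : x = y := by
  have := eq_zero_of_vertex hx (v := diff x y) fun i hi => by
    simp [h i hi, mem_zeros.1 hi]
  refine Subtype.ext (funext fun i => ?_)
  have := congrArg (fun v : 𝒱.V => v.1 i) this
  simp at this
  linarith

/-- At a vertex, `ξ` is a combination with non-zero coefficients of the coordinates vanishing
there. -/
theorem exists_coef {x : 𝒱.Aff} (hx : (zeros x).card = Module.finrank ℝ 𝒱.V) :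
    ∃ c : I → ℝ, (∀ i ∈ zeros x, c i ≠ 0) ∧ ∀ v : 𝒱.V, 𝒱.ξ v = ∑ i ∈ zeros x, c i * v.1 i := by
  classical
  choose e he using fun i : I => exists_vector x (fun j => if j = i then 1 else 0)
  have hξ : ∀ v : 𝒱.V, 𝒱.ξ v = ∑ i ∈ zeros x, 𝒱.ξ (e i) * v.1 i := by
    intro v
    have : v = ∑ i ∈ zeros x, v.1 i • e i := by
      rw [← sub_eq_zero]
      refine eq_zero_of_vertex hx fun j hj => ?_
      have : ∀ i ∈ zeros x, v.1 i * (e i).1 j = if j = i then v.1 i else 0 := fun i _ => by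
        rw [he i j hj]; simp
      simp [Finset.sum_apply, Finset.sum_congr rfl this, hj]
    conv_lhs => rw [this]
    simp [mul_comm]
  refine ⟨fun i => 𝒱.ξ (e i), ?_, hξ⟩
  have h := 𝒱.generic_ξ (fun i => if i ∈ zeros x then 𝒱.ξ (e i) else 0) fun v => by
    simp [hξ v, Finset.sum_ite_mem]
  intro i hi h0
  have hsub : {j | (if j ∈ zeros x then 𝒱.ξ (e j) else 0) ≠ 0} ⊆
      ((zeros x).erase i : Finset I) := by
    intro j hj
    simp only [ne_eq, ite_eq_right_iff, Set.mem_ofPred_eq, not_forall] at hj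
    obtain ⟨hj, hj'⟩ := hj
    simp only [Finset.coe_erase, Set.mem_sdiff, Finset.mem_coe, hj, Set.mem_singleton_iff, true_and]
    rintro rfl
    exact hj' h0
  have h1 := Set.ncard_le_ncard hsub (Finset.finite_toSet _)
  rw [Set.ncard_coe_finset, Finset.card_erase_of_mem hi] at h1
  have := Finset.card_pos.2 ⟨i, hi⟩
  omega

/-! ### Sign vectors and chambers -/

theorem sign_cases (a : ℤˣ) : (((a : ℤ) : ℝ) = 1) ∨ (((a : ℤ) : ℝ) = -1) := by
  rcases Int.units_eq_one_or a with rfl | rfl <;> simp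

theorem sign_ne_zero (a : ℤˣ) : ((a : ℤ) : ℝ) ≠ 0 := by
  rcases sign_cases a with h | h <;> rw [h] <;> norm_num

theorem sign_mul_self (a : ℤˣ) : ((a : ℤ) : ℝ) * ((a : ℤ) : ℝ) = 1 := by
  rcases sign_cases a with h | h <;> rw [h] <;> norm_num

theorem sign_ne {a b : ℤˣ} (h : a ≠ b) : b = -a := by
  rcases Int.units_eq_one_or a with rfl | rfl <;> rcases Int.units_eq_one_or b with rfl | rfl <;>
    simp_all

theorem sign_eq_of_pos {a b : ℤˣ} {r : ℝ} (ha : 0 < ((a : ℤ) : ℝ) * r)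
    (hb : 0 < ((b : ℤ) : ℝ) * r) : a = b := by
  by_contra h
  rw [sign_ne h] at hb
  push_cast at hb
  linarith

theorem exists_sign {r : ℝ} (hr : r ≠ 0) : ∃ a : ℤˣ, 0 < ((a : ℤ) : ℝ) * r := by
  rcases lt_or_gt_of_ne hr with h | h
  · exact ⟨-1, by simpa using h⟩
  · exact ⟨1, by simpa using h⟩

theorem pos_of_chamber {x : 𝒱.Aff} {α : I → ℤˣ} (hx : x ∈ 𝒱.chamber α) {i : I} (hi : x.1 i ≠ 0) :
    0 < ((α i : ℤ) : ℝ) * x.1 i :=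
  (hx i).lt_of_ne' (mul_ne_zero (sign_ne_zero _) hi)

theorem exists_small {ι : Type*} [Finite ι] (a b : ι → ℝ) (h : ∀ i, 0 < a i) :
    ∃ ε : ℝ, 0 < ε ∧ ∀ i, 0 < a i + ε * b i := by
  have : ∀ᶠ ε in nhdsWithin (0 : ℝ) (Set.Ioi 0), ∀ i, 0 < a i + ε * b i := by
    rw [Filter.eventually_all]
    intro i
    have hc : ContinuousAt (fun ε : ℝ => a i + ε * b i) 0 := by fun_prop
    exact (hc.eventually (lt_mem_nhds (by simpa using h i))).filter_mono nhdsWithin_le_nhds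
  obtain ⟨ε, h1, h2⟩ := (this.and self_mem_nhdsWithin).exists
  exact ⟨ε, h2, h1⟩

/-- In a simple arrangement all sign vectors compatible with a point belong to chambers with
non-empty interior around this point. -/
theorem exists_interior {x : 𝒱.Aff} {α : I → ℤˣ}
    (h : ∀ i, x.1 i ≠ 0 → 0 < ((α i : ℤ) : ℝ) * x.1 i) :
    ∃ y : 𝒱.Aff, ∀ i, 0 < ((α i : ℤ) : ℝ) * y.1 i := by
  obtain ⟨v, hv⟩ := exists_vector x (fun i => ((α i : ℤ) : ℝ))
  obtain ⟨ε, hε, hpos⟩ := exists_small (ι := {i // x.1 i ≠ 0})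
    (fun i => ((α i.1 : ℤ) : ℝ) * x.1 i.1) (fun i => ((α i.1 : ℤ) : ℝ) * v.1 i.1)
    (fun i => h i.1 i.2)
  refine ⟨shift x (ε • v), fun i => ?_⟩
  by_cases hi : x.1 i = 0
  · simp only [shift_apply, hi, SetLike.val_smul, Pi.smul_apply, smul_eq_mul, zero_add,
      hv i (mem_zeros.2 hi)]
    rw [mul_left_comm, sign_mul_self]
    linarith
  · have := hpos ⟨i, hi⟩
    simp only [shift_apply, SetLike.val_smul, Pi.smul_apply, smul_eq_mul]
    linarith

theorem feasible_of_compatible {x : 𝒱.Aff} {α : I → ℤˣ}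
    (h : ∀ i, x.1 i ≠ 0 → 0 < ((α i : ℤ) : ℝ) * x.1 i) : 𝒱.IsFeasible α := by
  obtain ⟨y, hy⟩ := exists_interior h
  exact ⟨y, fun i => (hy i).le⟩

theorem IsFeasible.exists_interior {α : I → ℤˣ} (h : 𝒱.IsFeasible α) :
    ∃ y : 𝒱.Aff, ∀ i, 0 < ((α i : ℤ) : ℝ) * y.1 i := by
  obtain ⟨x, hx⟩ := h
  exact PolarizedArrangement.exists_interior fun i hi => pos_of_chamber hx hi

/-- The first time at which a moving point satisfying finitely many inequalities reaches one of
their walls. -/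
theorem exists_first_exit {ι : Type*} (s : Finset ι) (y w : ι → ℝ) (hy : ∀ i ∈ s, 0 ≤ y i)
    (hyw : ∀ i ∈ s, w i < 0 → 0 < y i) (hw : ∃ i ∈ s, w i < 0) :
    ∃ r : ℝ, 0 < r ∧ (∃ j ∈ s, w j < 0 ∧ y j + r * w j = 0) ∧ ∀ i ∈ s, 0 ≤ y i + r * w i := by
  classical
  obtain ⟨j, hj, hmin⟩ := (s.filter fun i => w i < 0).exists_min_image (fun i => y i / -w i)
    (by obtain ⟨i, h1, h2⟩ := hw; exact ⟨i, by simp [h1, h2]⟩)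
  rw [Finset.mem_filter] at hj
  have hr : 0 < y j / -w j := div_pos (hyw j hj.1 hj.2) (by linarith [hj.2])
  refine ⟨y j / -w j, hr, ⟨j, hj.1, hj.2, ?_⟩, fun i hi => ?_⟩
  · have := hj.2.ne
    field_simp
    ring
  · by_cases h : w i < 0
    · have := hmin i (by simp [hi, h])
      rw [le_div_iff₀ (by linarith)] at this
      linarith
    · have := mul_nonneg hr.le (not_lt.1 h)
      linarith [hy i hi]

end PolarizedArrangement

/-! ### Sign vectors differing in one entry -/

section SignVectors

variable {I : Type u}

open Classical in
/-- The sign vector `α^i`. -/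
def signFlip (α : I → ℤˣ) (i : I) : I → ℤˣ := Function.update α i (-α i)

theorem signFlip_self (α : I → ℤˣ) (i : I) : signFlip α i i = -α i := by simp [signFlip]

theorem signFlip_of_ne (α : I → ℤˣ) {i j : I} (h : j ≠ i) : signFlip α i j = α j := by
  simp [signFlip, h]

theorem signAdjAt_signFlip (α : I → ℤˣ) (i : I) : SignAdjAt i α (signFlip α i) := fun j => by
  by_cases h : j = i
  · subst h; simp [signFlip_self]
  · simp [signFlip_of_ne α h, h]

theorem SignAdjAt.eq_signFlip {α β : I → ℤˣ} {i : I} (h : SignAdjAt i α β) : β = signFlip α i := by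
  funext j
  by_cases hj : j = i
  · subst hj; rw [signFlip_self]; exact PolarizedArrangement.sign_ne ((h j).2 rfl)
  · rw [signFlip_of_ne α hj]; by_contra hc; exact hj ((h j).1 (Ne.symm hc))

theorem SignAdjAt.symm {α β : I → ℤˣ} {i : I} (h : SignAdjAt i α β) : SignAdjAt i β α :=
  fun j => ne_comm.trans (h j)

theorem SignAdj.symm {α β : I → ℤˣ} (h : SignAdj α β) : SignAdj β α :=
  ⟨_, h.choose_spec.symm⟩

theorem SignAdjAt.eq_of_ne {α β : I → ℤˣ} {i j : I} (h : SignAdjAt i α β) (hj : j ≠ i) :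
    α j = β j := by
  by_contra hc
  exact hj ((h j).1 hc)

theorem SignAdjAt.ne {α β : I → ℤˣ} {i : I} (h : SignAdjAt i α β) : α i ≠ β i := (h i).2 rfl

end SignVectors

namespace PolarizedArrangement

variable {I : Type u} [Fintype I] {𝒱 : PolarizedArrangement I}

/-! ### Maxima of `ξ` and the order on bounded feasible sign vectors -/

open Classical in
/-- The coefficients of `ξ` with respect to the coordinates vanishing at a vertex (zero if the point
is not a vertex). -/
def coef (x : 𝒱.Aff) : I → ℝ :=
  if h : (zeros x).card = Module.finrank ℝ 𝒱.V then (exists_coef h).choose else 0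

theorem coef_ne_zero {x : 𝒱.Aff} (h : (zeros x).card = Module.finrank ℝ 𝒱.V) {i : I}
    (hi : i ∈ zeros x) : coef x i ≠ 0 := by
  rw [coef, dif_pos h]
  exact (exists_coef h).choose_spec.1 i hi

theorem ξ_eq_sum_coef {x : 𝒱.Aff} (h : (zeros x).card = Module.finrank ℝ 𝒱.V) (v : 𝒱.V) :
    𝒱.ξ v = ∑ i ∈ zeros x, coef x i * v.1 i := by
  rw [coef, dif_pos h]
  exact (exists_coef h).choose_spec.2 v

/-- `x` is a vertex at which `ξ` decreases along each edge on the side prescribed by `α`. -/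
structure IsLocalMax (x : 𝒱.Aff) (α : I → ℤˣ) : Prop where
  card_eq : (zeros x).card = Module.finrank ℝ 𝒱.V
  neg : ∀ i ∈ zeros x, ((α i : ℤ) : ℝ) * coef x i < 0

theorem IsLocalMax.term_nonpos {x : 𝒱.Aff} {α : I → ℤˣ} (h : IsLocalMax x α) {i : I}
    (hi : i ∈ zeros x) {r : ℝ} (hr : 0 ≤ ((α i : ℤ) : ℝ) * r) : coef x i * r ≤ 0 := by
  have h1 := h.neg i hi
  have h2 : coef x i * r = (((α i : ℤ) : ℝ) * coef x i) * (((α i : ℤ) : ℝ) * r) := by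
    linear_combination (-(coef x i * r)) * sign_mul_self (α i)
  rw [h2]
  exact mul_nonpos_of_nonpos_of_nonneg h1.le hr

theorem IsLocalMax.ξ_nonpos {x : 𝒱.Aff} {α : I → ℤˣ} (h : IsLocalMax x α) {v : 𝒱.V}
    (hv : ∀ i ∈ zeros x, 0 ≤ ((α i : ℤ) : ℝ) * v.1 i) : 𝒱.ξ v ≤ 0 := by
  rw [ξ_eq_sum_coef h.card_eq]
  exact Finset.sum_nonpos fun i hi => h.term_nonpos hi (hv i hi)

theorem IsLocalMax.rise_nonpos {x : 𝒱.Aff} {α : I → ℤˣ} (h : IsLocalMax x α) {y : 𝒱.Aff}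
    (hy : ∀ i ∈ zeros x, 0 ≤ ((α i : ℤ) : ℝ) * y.1 i) : 𝒱.rise x y ≤ 0 := by
  rw [rise_eq]
  refine h.ξ_nonpos fun i hi => ?_
  simpa [mem_zeros.1 hi] using hy i hi

theorem IsLocalMax.eq_of_rise_nonneg {x : 𝒱.Aff} {α : I → ℤˣ} (h : IsLocalMax x α) {y : 𝒱.Aff}
    (hy : ∀ i ∈ zeros x, 0 ≤ ((α i : ℤ) : ℝ) * y.1 i) (hr : 0 ≤ 𝒱.rise x y) : x = y := by
  have h0 := le_antisymm (h.rise_nonpos hy) hr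
  rw [rise_eq, ξ_eq_sum_coef h.card_eq, Finset.sum_eq_zero_iff_of_nonpos] at h0
  · refine eq_of_vertex h.card_eq fun i hi => ?_
    have := h0 i hi
    simpa [coef_ne_zero h.card_eq hi, mem_zeros.1 hi] using this
  · intro i hi
    refine h.term_nonpos hi ?_
    simpa [mem_zeros.1 hi] using hy i hi

theorem IsLocalMax.bounded {x : 𝒱.Aff} {α : I → ℤˣ} (h : IsLocalMax x α) : 𝒱.IsBoundedSign α := by
  refine ⟨0, ?_⟩
  rintro _ ⟨v, hv, rfl⟩
  exact h.ξ_nonpos fun i _ => hv i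

theorem IsLocalMax.isMaxAt {x : 𝒱.Aff} {α : I → ℤˣ} (h : IsLocalMax x α) (hx : x ∈ 𝒱.chamber α) :
    𝒱.IsMaxAt (zeros x) x α := by
  have hf : x ∈ 𝒱.flat (zeros x) := fun i hi => mem_zeros.1 hi
  exact ⟨⟨by rw [Set.ncard_coe_finset, h.card_eq], x, hf⟩, hf, hx,
    fun y hy => h.rise_nonpos fun i _ => hy i⟩

theorem isMaxAt_eq_zeros {b : Set I} {x : 𝒱.Aff} {α : I → ℤˣ} (h : 𝒱.IsMaxAt b x α) :
    b = zeros x ∧ (zeros x).card = Module.finrank ℝ 𝒱.V := by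
  obtain ⟨⟨hb, -⟩, hx, -⟩ := h
  have hsub : b ⊆ zeros x := fun i hi => mem_zeros.2 (hx i hi)
  have h1 := card_zeros_le x
  have hb' := Set.eq_of_subset_of_ncard_le hsub (by rw [Set.ncard_coe_finset, hb]; exact h1)
    (Finset.finite_toSet _)
  refine ⟨hb', ?_⟩
  rw [← hb, hb', Set.ncard_coe_finset]

/-- At a maximum `ξ` decreases along all edges: one can move a little along an edge on which it
increases. -/
theorem isLocalMax_of_isMaxAt {b : Set I} {x : 𝒱.Aff} {α : I → ℤˣ} (h : 𝒱.IsMaxAt b x α) :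
    IsLocalMax x α := by
  classical
  obtain ⟨-, hcard⟩ := isMaxAt_eq_zeros h
  refine ⟨hcard, fun i hi => ?_⟩
  obtain ⟨-, -, hx, hmax⟩ := h
  by_contra! hc
  obtain ⟨v, hv⟩ := exists_vector x (fun j => if j = i then ((α i : ℤ) : ℝ) else 0)
  have hξ : 0 < 𝒱.ξ v := by
    have : 𝒱.ξ v = coef x i * ((α i : ℤ) : ℝ) := by
      rw [ξ_eq_sum_coef hcard, Finset.sum_eq_single_of_mem i hi]
      · rw [hv i hi, if_pos rfl]
      · intro j hj hji
        rw [hv j hj, if_neg hji, mul_zero]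
    rw [this, mul_comm]
    exact hc.lt_of_ne' (mul_ne_zero (sign_ne_zero _) (coef_ne_zero hcard hi))
  obtain ⟨ε, hε, hpos⟩ := exists_small (ι := {i // x.1 i ≠ 0})
    (fun i => ((α i.1 : ℤ) : ℝ) * x.1 i.1) (fun i => ((α i.1 : ℤ) : ℝ) * v.1 i.1)
    (fun i => pos_of_chamber hx i.2)
  have := hmax (shift x (ε • v)) fun j => by
    by_cases hj : x.1 j = 0
    · simp only [shift_apply, hj, SetLike.val_smul, Pi.smul_apply, smul_eq_mul, zero_add,
        hv j (mem_zeros.2 hj)]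
      split_ifs with hji
      · subst hji
        rw [mul_left_comm, sign_mul_self]
        linarith
      · simp
    · have := hpos ⟨j, hj⟩
      simp only [shift_apply, SetLike.val_smul, Pi.smul_apply, smul_eq_mul]
      linarith
  rw [rise_shift, map_smul, smul_eq_mul] at this
  linarith [mul_pos hε hξ]

/-- Every chamber has a vertex. -/
theorem IsFeasible.exists_vertex {α : I → ℤˣ} (h : 𝒱.IsFeasible α) :
    ∃ x ∈ 𝒱.chamber α, (zeros x).card = Module.finrank ℝ 𝒱.V := by
  obtain ⟨x, hx⟩ := h
  induction hn : Module.finrank ℝ 𝒱.V - (zeros x).card using Nat.strong_induction_on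
    generalizing x with
  | _ n ih =>
  by_cases hc : (zeros x).card = Module.finrank ℝ 𝒱.V
  · exact ⟨x, hx, hc⟩
  have hlt := (card_zeros_le x).lt_of_ne hc
  obtain ⟨v, hv, j, hj⟩ : ∃ v : 𝒱.V, (∀ i ∈ zeros x, v.1 i = 0) ∧
      ∃ j, ((α j : ℤ) : ℝ) * v.1 j < 0 := by
    have : ¬ Function.Injective (restr (𝒱 := 𝒱) (zeros x)) := fun hinj => by
      have := LinearMap.finrank_le_finrank_of_injective hinj
      simp at this
      omega
    rw [injective_iff_map_eq_zero] at this
    push Not at this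
    obtain ⟨v, hv, hv0⟩ := this
    have hv' : ∀ i ∈ zeros x, v.1 i = 0 := fun i hi => congrFun hv ⟨i, hi⟩
    obtain ⟨j, hj⟩ : ∃ j, v.1 j ≠ 0 := by
      by_contra! hc
      exact hv0 (Subtype.ext (funext hc))
    rcases lt_or_gt_of_ne (mul_ne_zero (sign_ne_zero (α j)) hj) with h | h
    · exact ⟨v, hv', j, h⟩
    · exact ⟨-v, fun i hi => by simp [hv' i hi], j, by simpa using h⟩
  obtain ⟨r, -, ⟨k, -, hk, hk0⟩, hr⟩ := exists_first_exit Finset.univ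
    (fun i => ((α i : ℤ) : ℝ) * x.1 i) (fun i => ((α i : ℤ) : ℝ) * v.1 i) (fun i _ => hx i)
    (fun i _ hi => pos_of_chamber hx fun h0 => by simp [hv i (mem_zeros.2 h0)] at hi)
    ⟨j, Finset.mem_univ _, hj⟩
  have hsub : zeros x ⊂ zeros (shift x (r • v)) := by
    classical
    refine (Finset.ssubset_iff_of_subset ?_).2 ⟨k, ?_, fun h => ?_⟩
    · intro i hi
      simp [mem_zeros, hv i hi, mem_zeros.1 hi]
    · rw [mem_zeros]
      refine (mul_eq_zero.1 (?_ : ((α k : ℤ) : ℝ) * _ = 0)).resolve_left (sign_ne_zero _)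
      simp only [shift_apply, SetLike.val_smul, Pi.smul_apply, smul_eq_mul]
      linarith
    · rw [hv k h, mul_zero] at hk
      exact lt_irrefl _ hk
  have := Finset.card_lt_card hsub
  refine ih _ (by omega) (shift x (r • v)) (fun i => ?_) rfl
  have := hr i (Finset.mem_univ _)
  simp only [shift_apply, SetLike.val_smul, Pi.smul_apply, smul_eq_mul]
  linarith

theorem finite_vertices : {x : 𝒱.Aff | (zeros x).card = Module.finrank ℝ 𝒱.V}.Finite := by
  refine Set.Finite.of_finite_image (f := zeros) (Set.toFinite _) ?_
  intro x hx y _ hxy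
  refine eq_of_vertex hx fun i hi => mem_zeros.1 (?_ : i ∈ zeros y)
  rw [← hxy]
  exact hi

/-- Exchanging one hyperplane through a vertex for another one gives a vertex. -/
theorem zeros_exchange [DecidableEq I] {x y : 𝒱.Aff}
    (hx : (zeros x).card = Module.finrank ℝ 𝒱.V) {i j : I}
    (hi : i ∈ zeros x) (hj : j ∉ zeros x) (hjy : y.1 j = 0)
    (h : ∀ k ∈ zeros x, k ≠ i → y.1 k = 0) :
    zeros y = insert j ((zeros x).erase i) ∧ (zeros y).card = Module.finrank ℝ 𝒱.V := by
  have hsub : insert j ((zeros x).erase i) ⊆ zeros y := by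
    intro k hk
    rw [Finset.mem_insert, Finset.mem_erase] at hk
    rcases hk with rfl | ⟨hki, hk⟩
    · exact mem_zeros.2 hjy
    · exact mem_zeros.2 (h k hk hki)
  have hc : (insert j ((zeros x).erase i)).card = Module.finrank ℝ 𝒱.V := by
    rw [Finset.card_insert_of_notMem (fun h => hj (Finset.mem_of_mem_erase h)),
      Finset.card_erase_add_one hi, hx]
  have := Finset.eq_of_subset_of_card_le hsub (hc ▸ card_zeros_le y)
  exact ⟨this.symm, this ▸ hc⟩

/-- On a bounded chamber `ξ` attains its maximum, at a vertex: if `ξ` increased along an edge at the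
best vertex, following the edge would lead to a better one. -/
theorem BFeas.exists_isLocalMax (α : 𝒱.BFeas) :
    ∃ x ∈ 𝒱.chamber α.sign, IsLocalMax x α.sign := by
  classical
  obtain ⟨x₀, hx₀, hc₀⟩ := α.feasible.exists_vertex
  have hfin : {x : 𝒱.Aff | x ∈ 𝒱.chamber α.sign ∧ (zeros x).card = Module.finrank ℝ 𝒱.V}.Finite :=
    finite_vertices.subset fun x hx => hx.2
  obtain ⟨x, ⟨hx, hc⟩, hmax⟩ := Set.exists_max_image _ (fun x => 𝒱.rise x₀ x) hfin
    ⟨x₀, hx₀, hc₀⟩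
  refine ⟨x, hx, hc, fun i hi => ?_⟩
  by_contra! hneg
  obtain ⟨v, hv⟩ := exists_vector x (fun j => if j = i then ((α.sign i : ℤ) : ℝ) else 0)
  have hξ : 0 < 𝒱.ξ v := by
    have : 𝒱.ξ v = coef x i * ((α.sign i : ℤ) : ℝ) := by
      rw [ξ_eq_sum_coef hc, Finset.sum_eq_single_of_mem i hi]
      · rw [hv i hi, if_pos rfl]
      · intro j hj hji
        rw [hv j hj, if_neg hji, mul_zero]
    rw [this, mul_comm]
    exact hneg.lt_of_ne' (mul_ne_zero (sign_ne_zero _) (coef_ne_zero hc hi))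
  have hexit : ∃ j ∈ (Finset.univ : Finset I), ((α.sign j : ℤ) : ℝ) * v.1 j < 0 := by
    by_contra! hno
    obtain ⟨B, hB⟩ := α.bounded
    obtain ⟨n, hn⟩ := exists_nat_gt (B / 𝒱.ξ v)
    have h1 := hB ⟨(n : ℝ) • v, fun j => ?_, rfl⟩
    · rw [div_lt_iff₀ hξ] at hn
      rw [map_smul, smul_eq_mul] at h1
      linarith
    · have := hno j (Finset.mem_univ _)
      simp only [SetLike.val_smul, Pi.smul_apply, smul_eq_mul]
      rw [mul_left_comm]
      positivity
  have hnz : ∀ k, ((α.sign k : ℤ) : ℝ) * v.1 k < 0 → x.1 k ≠ 0 := fun k hk h0 => by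
    rw [hv k (mem_zeros.2 h0)] at hk
    split_ifs at hk with hki
    · subst hki
      rw [sign_mul_self] at hk
      linarith
    · simp at hk
  obtain ⟨r, hr0, ⟨k, -, hk, hk0⟩, hr⟩ := exists_first_exit Finset.univ
    (fun i => ((α.sign i : ℤ) : ℝ) * x.1 i) (fun i => ((α.sign i : ℤ) : ℝ) * v.1 i)
    (fun i _ => hx i)
    (fun i _ hi => pos_of_chamber hx (hnz i hi)) hexit
  have hy := zeros_exchange (y := shift x (r • v)) hc hi (fun h => hnz k hk (mem_zeros.1 h))
    (((mul_eq_zero (a := ((α.sign k : ℤ) : ℝ))).1 (by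
      simp only [shift_apply, SetLike.val_smul, Pi.smul_apply, smul_eq_mul]
      linarith)).resolve_left (sign_ne_zero _))
    (fun l hl hli => by simp [mem_zeros.1 hl, hv l hl, hli])
  have h1 := hmax (shift x (r • v)) ⟨fun i => by
    have := hr i (Finset.mem_univ _)
    simp only [shift_apply, SetLike.val_smul, Pi.smul_apply, smul_eq_mul]
    linarith, hy.2⟩
  have h2 := 𝒱.rise_add x₀ x (shift x (r • v))
  rw [rise_shift, map_smul, smul_eq_mul] at h2
  have := mul_pos hr0 hξ
  linarith

/-- The vertex at which `ξ` attains its maximum on a bounded chamber. -/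
def BFeas.vertex (α : 𝒱.BFeas) : 𝒱.Aff := α.exists_isLocalMax.choose

theorem BFeas.vertex_mem (α : 𝒱.BFeas) : α.vertex ∈ 𝒱.chamber α.sign :=
  α.exists_isLocalMax.choose_spec.1

theorem BFeas.isLocalMax (α : 𝒱.BFeas) : IsLocalMax α.vertex α.sign :=
  α.exists_isLocalMax.choose_spec.2

/-- The basis `μ⁻¹(α)`. -/
def BFeas.basis (α : 𝒱.BFeas) : Finset I := zeros α.vertex

theorem BFeas.isMaxAt (α : 𝒱.BFeas) : 𝒱.IsMaxAt α.basis α.vertex α.sign :=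
  α.isLocalMax.isMaxAt α.vertex_mem

theorem BFeas.eq_vertex {α : 𝒱.BFeas} {x : 𝒱.Aff} (hx : x ∈ 𝒱.chamber α.sign)
    (h : IsLocalMax x α.sign) : x = α.vertex :=
  h.eq_of_rise_nonneg (fun i _ => α.vertex_mem i) (by
    have h1 := α.isLocalMax.rise_nonpos (y := x) fun i _ => hx i
    have h2 := 𝒱.rise_add x α.vertex x
    have h3 : 𝒱.rise x x = 0 := by
      rw [rise_eq, show diff x x = 0 by ext; simp, map_zero]
    linarith)

theorem BFeas.isMu_iff (α : 𝒱.BFeas) (b : Set I) : 𝒱.IsMu b α.sign ↔ b = α.basis := by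
  refine ⟨?_, fun h => ⟨α.vertex, h ▸ α.isMaxAt⟩⟩
  rintro ⟨x, hx⟩
  rw [(isMaxAt_eq_zeros hx).1, BFeas.eq_vertex hx.2.2.1 (isLocalMax_of_isMaxAt hx)]
  rfl

theorem exists_bfeas_of_vertex {x : 𝒱.Aff} (hx : (zeros x).card = Module.finrank ℝ 𝒱.V) :
    ∃ α : 𝒱.BFeas, α.vertex = x := by
  classical
  have : ∀ i, ∃ a : ℤˣ, 0 < ((a : ℤ) : ℝ) * (if x.1 i = 0 then -coef x i else x.1 i) := fun i => by
    refine exists_sign ?_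
    split_ifs with h
    · exact neg_ne_zero.2 (coef_ne_zero hx (mem_zeros.2 h))
    · exact h
  choose a ha using this
  have hmax : IsLocalMax x a := ⟨hx, fun i hi => by
    have := ha i
    rw [if_pos (mem_zeros.1 hi)] at this
    linarith⟩
  have hcomp : ∀ i, x.1 i ≠ 0 → 0 < ((a i : ℤ) : ℝ) * x.1 i := fun i hi => by
    simpa [hi] using ha i
  have hmem : x ∈ 𝒱.chamber a := fun i => by
    by_cases h : x.1 i = 0
    · simp [h]
    · exact (hcomp i h).le
  exact ⟨⟨a, ⟨x, hmem⟩, hmax.bounded⟩, (BFeas.eq_vertex hmem hmax).symm⟩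

/-- The cone with apex `H_b` spanned by the chamber `γ = μ(b)` contains the chamber of `β`. -/
def BFeas.Agree (γ : 𝒱.BFeas) (β : I → ℤˣ) : Prop := ∀ i ∈ γ.basis, β i = γ.sign i

theorem BFeas.agree_self (γ : 𝒱.BFeas) : γ.Agree γ.sign := fun _ _ => rfl

theorem BFeas.Agree.isLocalMax {γ : 𝒱.BFeas} {β : I → ℤˣ} (h : γ.Agree β) :
    IsLocalMax γ.vertex β :=
  ⟨γ.isLocalMax.card_eq, fun i hi => by rw [h i hi]; exact γ.isLocalMax.neg i hi⟩

theorem BFeas.vertex_injective : Function.Injective (BFeas.vertex (𝒱 := 𝒱)) := by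
  intro α β h
  refine BFeas.ext (funext fun i => ?_)
  by_cases hi : α.vertex.1 i = 0
  · have h1 := α.isLocalMax.neg i (mem_zeros.2 hi)
    have h2 := β.isLocalMax.neg i (mem_zeros.2 (h ▸ hi))
    rw [← h] at h2
    exact sign_eq_of_pos (r := -coef α.vertex i) (by linarith) (by linarith)
  · have h1 := pos_of_chamber α.vertex_mem hi
    have h2 := pos_of_chamber β.vertex_mem (h ▸ hi)
    rw [← h] at h2
    exact sign_eq_of_pos h1 h2

/-- If the vertex of `α` lies in the cone of `γ`, then `α ≤ γ`. While the bases differ, one leaves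
the current vertex along an edge on which `ξ` increases and which is not contained in a wall of the
cone; as `ξ` is bounded on the cone, the edge meets a further wall, in a vertex which lies on more
walls of the cone. -/
theorem BFeas.le_of_vertex_mem (γ α : 𝒱.BFeas)
    (h : ∀ i ∈ γ.basis, 0 ≤ ((γ.sign i : ℤ) : ℝ) * α.vertex.1 i) : α ≤ γ := by
  classical
  induction hn : (γ.basis \ α.basis).card using Nat.strong_induction_on generalizing α with
  | _ n ih =>
  by_cases heq : γ.basis ⊆ α.basis
  · have : γ.vertex = α.vertex := eq_of_vertex γ.isLocalMax.card_eq fun i hi =>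
      mem_zeros.1 (heq hi)
    rw [BFeas.vertex_injective this]
  obtain ⟨i, hi, hiγ⟩ : ∃ i ∈ α.basis, i ∉ γ.basis := by
    by_contra! hc
    exact heq (Finset.eq_of_subset_of_card_le hc
      (by rw [BFeas.basis, BFeas.basis, γ.isLocalMax.card_eq, α.isLocalMax.card_eq])).symm.subset
  have hc := α.isLocalMax.card_eq
  obtain ⟨v, hv⟩ := exists_vector α.vertex (fun j => if j = i then coef α.vertex i else 0)
  have hξ : 0 < 𝒱.ξ v := by
    have : 𝒱.ξ v = coef α.vertex i * coef α.vertex i := by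
      rw [ξ_eq_sum_coef hc, Finset.sum_eq_single_of_mem i (show i ∈ zeros α.vertex from hi)]
      · rw [hv i hi, if_pos rfl]
      · intro j hj hji
        rw [hv j hj, if_neg hji, mul_zero]
    rw [this]
    exact mul_self_pos.2 (coef_ne_zero hc hi)
  have hexit : ∃ j ∈ γ.basis, ((γ.sign j : ℤ) : ℝ) * v.1 j < 0 := by
    by_contra! hno
    exact absurd (γ.isLocalMax.ξ_nonpos hno) (not_le.2 hξ)
  have hnz : ∀ k ∈ γ.basis, ((γ.sign k : ℤ) : ℝ) * v.1 k < 0 → α.vertex.1 k ≠ 0 :=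
    fun k hkγ hk h0 => by
      rw [hv k (mem_zeros.2 h0), if_neg (by rintro rfl; exact hiγ hkγ), mul_zero] at hk
      exact lt_irrefl _ hk
  obtain ⟨r, hr0, ⟨k, hkγ, hk, hk0⟩, hr⟩ := exists_first_exit γ.basis
    (fun i => ((γ.sign i : ℤ) : ℝ) * α.vertex.1 i) (fun i => ((γ.sign i : ℤ) : ℝ) * v.1 i) h
    (fun i hiγ hi => (h i hiγ).lt_of_ne' (mul_ne_zero (sign_ne_zero _) (hnz i hiγ hi))) hexit
  have hkα : k ∉ zeros α.vertex := fun h => hnz k hkγ hk (mem_zeros.1 h)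
  obtain ⟨hz, hy⟩ := zeros_exchange (y := shift α.vertex (r • v)) hc hi hkα
    (((mul_eq_zero (a := ((γ.sign k : ℤ) : ℝ))).1 (by
      simp only [shift_apply, SetLike.val_smul, Pi.smul_apply, smul_eq_mul]
      linarith)).resolve_left (sign_ne_zero _))
    (fun l hl hli => by simp [mem_zeros.1 hl, hv l hl, hli])
  obtain ⟨β, hβ⟩ := exists_bfeas_of_vertex hy
  have hbasis : β.basis = insert k (α.basis.erase i) := by rw [BFeas.basis, hβ, hz]; rfl
  have hlt : 𝒱.Prec α β := by
    refine ⟨_, _, _, _, α.isMaxAt, β.isMaxAt, ?_, ?_⟩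
    · have : (α.basis : Set I) ∩ β.basis = (α.basis.erase i : Finset I) := by
        rw [hbasis, ← Finset.coe_inter]
        congr 1
        ext l
        simp only [Finset.mem_inter, Finset.mem_insert, Finset.mem_erase]
        refine ⟨?_, fun h => ⟨h.2, Or.inr h⟩⟩
        rintro ⟨h1, rfl | h2⟩
        · exact absurd h1 hkα
        · exact h2
      rw [this, Set.ncard_coe_finset, Finset.card_erase_add_one hi]
      exact hc
    · rw [hβ, rise_shift, map_smul, smul_eq_mul]
      exact mul_pos hr0 hξ
  refine (Relation.ReflTransGen.single hlt).trans (ih _ ?_ β (fun l hl => ?_) rfl)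
  · rw [← hn]
    refine Finset.card_lt_card ((Finset.ssubset_iff_of_subset ?_).2 ⟨k, ?_, ?_⟩)
    · intro l hl
      rw [Finset.mem_sdiff, hbasis, Finset.mem_insert, Finset.mem_erase] at hl
      rw [Finset.mem_sdiff]
      exact ⟨hl.1, fun h => hl.2 (Or.inr ⟨fun h' => hiγ (h' ▸ hl.1), h⟩)⟩
    · exact Finset.mem_sdiff.2 ⟨hkγ, hkα⟩
    · simp [hbasis]
  · have := hr l hl
    rw [hβ]
    simp only [shift_apply, SetLike.val_smul, Pi.smul_apply, smul_eq_mul]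
    linarith

theorem BFeas.Agree.le {γ β : 𝒱.BFeas} (h : γ.Agree β.sign) : β ≤ γ :=
  γ.le_of_vertex_mem β fun i hi => by
    rw [← h i hi]
    exact β.vertex_mem i

theorem BFeas.Agree.bounded {γ : 𝒱.BFeas} {β : I → ℤˣ} (h : γ.Agree β) : 𝒱.IsBoundedSign β :=
  h.isLocalMax.bounded

/-- The chamber opposite to a bounded chamber across a hyperplane through its vertex. -/
theorem BFeas.flip_feasible (γ : 𝒱.BFeas) {i : I} (hi : i ∈ γ.basis) :
    𝒱.IsFeasible (signFlip γ.sign i) :=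
  feasible_of_compatible (x := γ.vertex) fun j hj => by
    rw [signFlip_of_ne _ (by rintro rfl; exact hj (mem_zeros.1 hi))]
    exact pos_of_chamber γ.vertex_mem hj

theorem BFeas.lt_flip {γ δ : 𝒱.BFeas} {i : I} (hi : i ∈ γ.basis) (h : SignAdjAt i γ.sign δ.sign) :
    γ < δ := by
  refine lt_of_le_of_ne (δ.le_of_vertex_mem γ fun j _ => ?_) ?_
  · by_cases hj : j = i
    · subst hj
      rw [mem_zeros.1 hi, mul_zero]
    · rw [← h.eq_of_ne hj]
      exact γ.vertex_mem j
  · rintro rfl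
    exact h.ne rfl

theorem BFeas.eq_of_agree {γ β : 𝒱.BFeas} (h : γ.Agree β.sign) (h' : β.Agree γ.sign) : γ = β :=
  le_antisymm h'.le h.le

instance : Finite 𝒱.BFeas := by
  refine Finite.of_injective (BFeas.toFeas (𝒱 := 𝒱)) fun α β h => BFeas.ext ?_
  exact congrArg (fun x : 𝒱.Feas => x.1) h

/-! ### Presentation of the algebra `A` -/

variable (𝒱) in
/-- The homomorphism `Sym V* → A`. -/
def symA : SymmetricAlgebra ℝ (Module.Dual ℝ 𝒱.V) →ₐ[ℝ] 𝒱.A :=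
  𝒱.mkA.comp Algebra.TensorProduct.includeRight

theorem symA_ι (w : Module.Dual ℝ 𝒱.V) :
    𝒱.symA (SymmetricAlgebra.ι ℝ (Module.Dual ℝ 𝒱.V) w) = 𝒱.tA w := rfl

theorem mkA_surjective : Function.Surjective 𝒱.mkA := RingQuot.mkAlgHom_surjective ℝ _

theorem symA_commute (s : SymmetricAlgebra ℝ (Module.Dual ℝ 𝒱.V)) (a : 𝒱.A) :
    𝒱.symA s * a = a * 𝒱.symA s := by
  obtain ⟨z, rfl⟩ := mkA_surjective a
  show 𝒱.mkA (1 ⊗ₜ s) * 𝒱.mkA z = 𝒱.mkA z * 𝒱.mkA (1 ⊗ₜ s)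
  rw [← map_mul, ← map_mul]
  congr 1
  induction z using TensorProduct.induction_on with
  | zero => simp
  | tmul x y => simp [mul_comm]
  | add x y hx hy => rw [mul_add, add_mul, hx, hy]

theorem tA_commute (w : Module.Dual ℝ 𝒱.V) (a : 𝒱.A) : 𝒱.tA w * a = a * 𝒱.tA w :=
  symA_commute _ a

variable (𝒱) in
/-- The homomorphism `P(Q) → A`. -/
def pathA : 𝒱.PathAlg →ₐ[ℝ] 𝒱.A := 𝒱.mkA.comp Algebra.TensorProduct.includeLeft

theorem eA_mul_self (α : 𝒱.Feas) : 𝒱.eA α * 𝒱.eA α = 𝒱.eA α := by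
  change 𝒱.pathA _ * 𝒱.pathA _ = 𝒱.pathA _
  rw [← map_mul]
  unfold PathAlgebra.e
  rw [← map_mul, RingQuot.mkAlgHom_rel ℝ (PathAlgebraRel.idem α)]

theorem eA_mul_eA_of_ne {α β : 𝒱.Feas} (h : α ≠ β) : 𝒱.eA α * 𝒱.eA β = 0 := by
  change 𝒱.pathA _ * 𝒱.pathA _ = 0
  rw [← map_mul]
  unfold PathAlgebra.e
  rw [← map_mul, RingQuot.mkAlgHom_rel ℝ (PathAlgebraRel.orth α β h), map_zero, map_zero]

theorem sum_eA : ∑ α : 𝒱.Feas, 𝒱.eA α = 1 := by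
  change ∑ α : 𝒱.Feas, 𝒱.pathA _ = 1
  rw [← map_sum]
  unfold PathAlgebra.e
  rw [← map_sum, RingQuot.mkAlgHom_rel ℝ (PathAlgebraRel.unit), map_one, map_one]

theorem pA_square {α β γ δ : 𝒱.Feas} (hd : [α, β, γ, δ].Nodup) (hαβ : SignAdj α.1 β.1)
    (hβγ : SignAdj β.1 γ.1) (hαδ : SignAdj α.1 δ.1) (hδγ : SignAdj δ.1 γ.1) :
    𝒱.pA α β hαβ * 𝒱.pA β γ hβγ = 𝒱.pA α δ hαδ * 𝒱.pA δ γ hδγ := by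
  have := RingQuot.mkAlgHom_rel ℝ (RelA.a2 α β γ δ hd hαβ hβγ hδγ.symm hαδ.symm hαδ hδγ)
  change 𝒱.pathA _ = 𝒱.pathA _ at this
  rw [map_mul, map_mul] at this
  exact this

theorem pA_mul_pA_back {i : I} {α β : 𝒱.Feas} (hi : SignAdjAt i α.1 β.1) (hαβ : SignAdj α.1 β.1)
    (hβα : SignAdj β.1 α.1) : 𝒱.pA α β hαβ * 𝒱.pA β α hβα = 𝒱.eA α * 𝒱.tA (𝒱.t i) := by
  have := RingQuot.mkAlgHom_rel ℝ (RelA.a3 i α β hi hαβ hβα)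
  change 𝒱.pathA _ = 𝒱.mkA _ at this
  rw [map_mul] at this
  refine Eq.trans this ?_
  unfold eA tA
  rw [← map_mul, Algebra.TensorProduct.tmul_mul_tmul, mul_one, one_mul]

/-- `A` is generated by the idempotents, the arrows and the covectors. -/
theorem adjoin_generators : Algebra.adjoin ℝ
    (Set.range 𝒱.eA ∪ {x | ∃ α β h, x = 𝒱.pA α β h} ∪ Set.range 𝒱.tA) = ⊤ := by
  rw [eq_top_iff]
  rintro a -
  obtain ⟨z, rfl⟩ := mkA_surjective a
  set S := Algebra.adjoin ℝ
    (Set.range 𝒱.eA ∪ {x | ∃ α β h, x = 𝒱.pA α β h} ∪ Set.range 𝒱.tA) with hS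
  induction z using TensorProduct.induction_on with
  | zero => rw [map_zero]; exact zero_mem _
  | add x y hx hy => rw [map_add]; exact add_mem hx hy
  | tmul x y =>
    have hx : 𝒱.pathA x ∈ S := by
      obtain ⟨x, rfl⟩ := RingQuot.mkAlgHom_surjective ℝ _ x
      induction x using FreeAlgebra.induction with
      | grade0 r => rw [AlgHom.commutes, AlgHom.commutes]; exact S.algebraMap_mem r
      | grade1 g =>
        refine Algebra.subset_adjoin (Or.inl ?_)
        cases g with
        | vertex α => exact Or.inl ⟨α, rfl⟩
        | arrow α β h => exact Or.inr ⟨α, β, h, rfl⟩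
      | mul a b ha hb => rw [map_mul, map_mul]; exact mul_mem ha hb
      | add a b ha hb => rw [map_add, map_add]; exact add_mem ha hb
    have hy : 𝒱.symA y ∈ S := by
      induction y using SymmetricAlgebra.induction with
      | algebraMap r => rw [AlgHom.commutes]; exact S.algebraMap_mem r
      | ι w => exact Algebra.subset_adjoin (Or.inr ⟨w, rfl⟩)
      | mul a b ha hb => rw [map_mul]; exact mul_mem ha hb
      | add a b ha hb => rw [map_add]; exact add_mem ha hb
    have : 𝒱.mkA (x ⊗ₜ y) = 𝒱.pathA x * 𝒱.symA y := by
      change _ = 𝒱.mkA (x ⊗ₜ 1) * 𝒱.mkA (1 ⊗ₜ y)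
      rw [← map_mul, Algebra.TensorProduct.tmul_mul_tmul, mul_one, one_mul]
    rw [this]
    exact mul_mem hx hy

/-- A subspace stable under right multiplication by generators is stable under right
multiplication. -/
theorem mul_mem_of_generators (W : Submodule ℝ 𝒱.A) (he : ∀ x ∈ W, ∀ α, x * 𝒱.eA α ∈ W)
    (hp : ∀ x ∈ W, ∀ α β h, x * 𝒱.pA α β h ∈ W) (ht : ∀ x ∈ W, ∀ w, x * 𝒱.tA w ∈ W)
    {x : 𝒱.A} (hx : x ∈ W) (a : 𝒱.A) : x * a ∈ W := by
  have ha : a ∈ Algebra.adjoin ℝ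
      (Set.range 𝒱.eA ∪ {x | ∃ α β h, x = 𝒱.pA α β h} ∪ Set.range 𝒱.tA) := by
    rw [adjoin_generators]; trivial
  induction ha using Algebra.adjoin_induction generalizing x with
  | mem a ha =>
    rcases ha with (⟨α, rfl⟩ | ⟨α, β, h, rfl⟩) | ⟨w, rfl⟩
    exacts [he x hx α, hp x hx α β h, ht x hx w]
  | algebraMap r => rw [← Algebra.commutes, ← Algebra.smul_def]; exact W.smul_mem r hx
  | add a b _ _ ha hb => rw [mul_add]; exact add_mem (ha hx) (hb hx)
  | mul a b _ _ ha hb => rw [← mul_assoc]; exact hb (ha hx)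

section Lift

variable {B C : Type*} [Ring B] [Algebra ℝ B] [CommRing C] [Algebra ℝ C]

/-- The values on the generators of `P(Q)` prescribed by images of vertices and arrows. -/
def genMap (e : 𝒱.Feas → B) (p : ∀ α β : 𝒱.Feas, SignAdj α.1 β.1 → B) :
    PathAlgebraGen (fun α β : 𝒱.Feas => SignAdj α.1 β.1) → B
  | .vertex α => e α
  | .arrow α β h => p α β h

/-- Data defining a homomorphism from `A` to `B`, where the covectors are sent to the image of a
commutative algebra `C` in the centre of `B`. -/
structure LiftData (𝒱 : PolarizedArrangement I) (B C : Type*) [Ring B] [Algebra ℝ B] [CommRing C]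
    [Algebra ℝ C] where
  /-- images of the vertices -/
  e : 𝒱.Feas → B
  /-- images of the arrows -/
  p : ∀ α β : 𝒱.Feas, SignAdj α.1 β.1 → B
  /-- images of the covectors in `C` -/
  t : Module.Dual ℝ 𝒱.V →ₗ[ℝ] C
  /-- the central homomorphism -/
  c : C →ₐ[ℝ] B
  central : ∀ x b, Commute (c x) b
  idem : ∀ α, e α * e α = e α
  orth : ∀ α β, α ≠ β → e α * e β = 0
  unit : ∑ α, e α = 1
  source : ∀ α β h, e α * p α β h = p α β h
  target : ∀ α β h, p α β h * e β = p α β h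
  unbounded : ∀ α : 𝒱.Feas, ¬ 𝒱.IsBoundedSign α.1 → e α = 0
  square : ∀ α β γ δ : 𝒱.Feas, [α, β, γ, δ].Nodup → ∀ (hαβ : SignAdj α.1 β.1)
    (hβγ : SignAdj β.1 γ.1) (hαδ : SignAdj α.1 δ.1) (hδγ : SignAdj δ.1 γ.1),
    p α β hαβ * p β γ hβγ = p α δ hαδ * p δ γ hδγ
  back : ∀ (i : I) (α β : 𝒱.Feas), SignAdjAt i α.1 β.1 → ∀ (hαβ : SignAdj α.1 β.1)
    (hβα : SignAdj β.1 α.1), p α β hαβ * p β α hβα = e α * c (t (𝒱.t i))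

namespace LiftData

variable (D : LiftData 𝒱 B C)

/-- The induced homomorphism on the path algebra. -/
def path : 𝒱.PathAlg →ₐ[ℝ] B :=
  RingQuot.liftAlgHom ℝ ⟨FreeAlgebra.lift ℝ (genMap D.e D.p), by
    intro x y h
    induction h with
    | idem x => simpa [genMap] using D.idem x
    | orth x y h => simpa [genMap] using D.orth x y h
    | unit => simpa [genMap] using D.unit
    | source x y h => simpa [genMap] using D.source x y h
    | target x y h => simpa [genMap] using D.target x y h⟩

theorem path_e (α : 𝒱.Feas) : D.path (PathAlgebra.e α) = D.e α := by
  unfold path PathAlgebra.e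
  rw [RingQuot.liftAlgHom_mkAlgHom_apply]
  simp [genMap]

theorem path_p (α β : 𝒱.Feas) (h) : D.path (PathAlgebra.p α β h) = D.p α β h := by
  unfold path PathAlgebra.p
  rw [RingQuot.liftAlgHom_mkAlgHom_apply]
  simp [genMap]

/-- The induced homomorphism on `P(Q) ⊗ Sym V*`. -/
def pre : 𝒱.PreA →ₐ[ℝ] B :=
  Algebra.TensorProduct.lift D.path (D.c.comp (SymmetricAlgebra.lift D.t))
    fun _ _ => (D.central _ _).symm

theorem pre_tmul (x : 𝒱.PathAlg) (y : SymmetricAlgebra ℝ (Module.Dual ℝ 𝒱.V)) :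
    D.pre (x ⊗ₜ y) = D.path x * D.c (SymmetricAlgebra.lift D.t y) :=
  Algebra.TensorProduct.lift_tmul _ _ _ _ _

theorem pre_path (x : 𝒱.PathAlg) : D.pre (x ⊗ₜ 1) = D.path x := by
  rw [pre_tmul, map_one, map_one, mul_one]

/-- The induced homomorphism on `A`. -/
def hom : 𝒱.A →ₐ[ℝ] B :=
  RingQuot.liftAlgHom ℝ ⟨D.pre, by
    intro x y h
    induction h with
    | a1 α h => rw [pre_path, path_e, D.unbounded α h, map_zero]
    | a2 α β γ δ hd h1 h2 h3 h4 h5 h6 =>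
      rw [pre_path, pre_path, map_mul, map_mul]
      simp only [path_p]
      exact D.square α β γ δ hd h1 h2 h5 h6
    | a3 i α β hi h1 h2 =>
      rw [pre_path, map_mul, path_p, path_p, D.back i α β hi, pre_tmul, path_e,
        SymmetricAlgebra.lift_ι_apply]⟩

theorem hom_mkA (x : 𝒱.PreA) : D.hom (𝒱.mkA x) = D.pre x :=
  RingQuot.liftAlgHom_mkAlgHom_apply ℝ D.pre _ x

theorem hom_eA (α : 𝒱.Feas) : D.hom (𝒱.eA α) = D.e α := by
  rw [eA, hom_mkA, pre_path, path_e]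

theorem hom_pA (α β : 𝒱.Feas) (h) : D.hom (𝒱.pA α β h) = D.p α β h := by
  rw [pA, hom_mkA, pre_path, path_p]

theorem hom_tA (w : Module.Dual ℝ 𝒱.V) : D.hom (𝒱.tA w) = D.c (D.t w) := by
  rw [tA, hom_mkA, pre_tmul, map_one, one_mul, SymmetricAlgebra.lift_ι_apply]

end LiftData

end Lift

/-! ### Taut paths -/

open Classical in
/-- The entries in which two sign vectors differ. -/
def differ (α β : I → ℤˣ) : Finset I := Finset.univ.filter fun i => α i ≠ β i

theorem mem_differ {α β : I → ℤˣ} {i : I} : i ∈ differ α β ↔ α i ≠ β i := by simp [differ]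

theorem card_differ_lt {α γ β : I → ℤˣ} {i : I} (h : SignAdjAt i α γ) (hi : γ i = β i) :
    (differ γ β).card < (differ α β).card := by
  refine Finset.card_lt_card ((Finset.ssubset_iff_of_subset ?_).2 ⟨i, ?_, ?_⟩)
  · intro j hj
    rw [mem_differ] at hj ⊢
    have : j ≠ i := by rintro rfl; exact hj hi
    rwa [h.eq_of_ne this]
  · rw [mem_differ, ← hi]; exact h.ne
  · simp [mem_differ, hi]

/-- `a` is the product of the arrows along a taut path from `α` to `β`, that is, a path which
crosses no hyperplane twice. -/
inductive IsTaut : 𝒱.Feas → 𝒱.Feas → 𝒱.A → Prop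
  | nil (α : 𝒱.Feas) : IsTaut α α (𝒱.eA α)
  | cons {α γ β : 𝒱.Feas} {a : 𝒱.A} (i : I) (h : SignAdj α.1 γ.1) (hi : SignAdjAt i α.1 γ.1)
      (hβ : γ.1 i = β.1 i) (ha : IsTaut γ β a) : IsTaut α β (𝒱.pA α γ h * a)

theorem IsTaut.eA_mul {α β : 𝒱.Feas} {a : 𝒱.A} (h : IsTaut α β a) : 𝒱.eA α * a = a := by
  cases h with
  | nil => exact eA_mul_self α
  | cons i h hi hβ ha => rw [← mul_assoc, eA_mul_pA]

theorem IsTaut.mul_eA {α β : 𝒱.Feas} {a : 𝒱.A} (h : IsTaut α β a) : a * 𝒱.eA β = a := by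
  induction h with
  | nil α => exact eA_mul_self α
  | cons i h hi hβ ha ih => rw [mul_assoc, ih]

/-- A taut path can be prolonged across a hyperplane it has not crossed. -/
theorem IsTaut.snoc {α β δ : 𝒱.Feas} {a : 𝒱.A} (ha : IsTaut α β a) {i : I} (h : SignAdj β.1 δ.1)
    (hi : SignAdjAt i β.1 δ.1) (hα : α.1 i = β.1 i) : IsTaut α δ (a * 𝒱.pA β δ h) := by
  induction ha with
  | nil α =>
    rw [eA_mul_pA]
    have := IsTaut.cons i h hi rfl (IsTaut.nil δ)
    rwa [pA_mul_eA] at this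
  | @cons α γ β a j h' hj hβ ha ih =>
    have hij : j ≠ i := by
      rintro rfl
      exact hj.ne (hα.trans hβ.symm)
    rw [mul_assoc]
    refine IsTaut.cons j h' hj (hβ.trans (hi.eq_of_ne hij)) (ih h hi ?_)
    rw [← hj.eq_of_ne (Ne.symm hij), hα]

/-- The point at time `s` on the segment between two points. -/
def seg (q q' : 𝒱.Aff) (s : ℝ) : 𝒱.Aff := shift q (s • diff q q')

theorem seg_apply (q q' : 𝒱.Aff) (s : ℝ) (i : I) :
    (seg q q' s).1 i = q.1 i + s * (q'.1 i - q.1 i) := rfl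

theorem feasible_of_eq_off_zeros {z : 𝒱.Aff} {α α' : I → ℤˣ} (hz : z ∈ 𝒱.chamber α)
    (h : ∀ i, z.1 i ≠ 0 → α' i = α i) : 𝒱.IsFeasible α' :=
  feasible_of_compatible (x := z) fun i hi => by rw [h i hi]; exact pos_of_chamber hz hi

/-- For a point `q` of the chamber of `α` and an interior point `y` of the chamber of `β`, the ratio
`m` which determines the point of the segment `[q, y]` on the `k`-th hyperplane, for `k` a
hyperplane separating `α` from `β`. The segment leaves the chamber of `α` where `m` is minimal. -/
def ratio (α : I → ℤˣ) (y q : 𝒱.Aff) (k : I) : ℝ :=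
  (((α k : ℤ) : ℝ) * q.1 k) / (-(((α k : ℤ) : ℝ) * y.1 k))

theorem neg_of_mem_differ {α β : I → ℤˣ} {y : 𝒱.Aff} (hy : ∀ i, 0 < ((β i : ℤ) : ℝ) * y.1 i) {k : I}
    (hk : k ∈ differ α β) : ((α k : ℤ) : ℝ) * y.1 k < 0 := by
  have h1 := hy k
  rw [sign_ne (mem_differ.1 hk)] at h1
  push_cast at h1
  linarith

theorem exists_exit_point {α β : I → ℤˣ} {y q : 𝒱.Aff} (hy : ∀ i, 0 < ((β i : ℤ) : ℝ) * y.1 i)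
    (hq : q ∈ 𝒱.chamber α) {m : ℝ} (hm : 0 ≤ m) (hmin : ∀ k ∈ differ α β, m ≤ ratio α y q k) :
    ∃ z ∈ 𝒱.chamber α, ∀ k ∈ differ α β, ratio α y q k = m → z.1 k = 0 := by
  have key : ∀ k, ((α k : ℤ) : ℝ) * (seg q y (m / (1 + m))).1 k =
      (((α k : ℤ) : ℝ) * q.1 k + m * (((α k : ℤ) : ℝ) * y.1 k)) / (1 + m) := fun k => by
    have : 1 + m ≠ 0 := by positivity
    rw [seg_apply]
    field_simp
    ring
  refine ⟨seg q y (m / (1 + m)), fun k => ?_, fun k hk hkm => ?_⟩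
  · rw [key]
    refine div_nonneg ?_ (by positivity)
    by_cases hk : k ∈ differ α β
    · have h1 := hmin k hk
      rw [ratio, le_div_iff₀ (by linarith [neg_of_mem_differ hy hk])] at h1
      linarith
    · have hk' : α k = β k := by simpa [mem_differ] using hk
      have h1 := hq k
      have h2 := mul_nonneg hm (hy k).le
      rw [← hk'] at h2
      linarith
  · have h1 := neg_of_mem_differ hy hk
    rw [ratio, div_eq_iff (by linarith)] at hkm
    have h2 := key k
    rw [show ((α k : ℤ) : ℝ) * q.1 k + m * (((α k : ℤ) : ℝ) * y.1 k) = 0 by linarith,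
      zero_div] at h2
    exact (mul_eq_zero.1 h2).resolve_left (sign_ne_zero _)

theorem ratio_nonneg {α β : I → ℤˣ} {y q : 𝒱.Aff} (hy : ∀ i, 0 < ((β i : ℤ) : ℝ) * y.1 i)
    (hq : q ∈ 𝒱.chamber α) {k : I} (hk : k ∈ differ α β) : 0 ≤ ratio α y q k :=
  div_nonneg (hq k) (by linarith [neg_of_mem_differ hy hk])

/-- From a chamber one can cross a wall towards any other chamber. -/
theorem exists_adj_towards {α β : 𝒱.Feas} (h : α ≠ β) : ∃ (i : I) (γ : 𝒱.Feas),
    SignAdjAt i α.1 γ.1 ∧ γ.1 i = β.1 i := by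
  obtain ⟨q, hq⟩ := α.2
  obtain ⟨y, hy⟩ := β.2.exists_interior
  have hne : (differ α.1 β.1).Nonempty := by
    by_contra! hc
    refine h (Subtype.ext (funext fun i => ?_))
    by_contra hi
    have : i ∈ differ α.1 β.1 := mem_differ.2 hi
    simp [hc] at this
  obtain ⟨k, hk, hmin⟩ := Finset.exists_min_image _ (ratio α.1 y q) hne
  obtain ⟨z, hz, hz0⟩ := exists_exit_point hy hq (ratio_nonneg hy hq hk) hmin
  refine ⟨k, ⟨signFlip α.1 k, feasible_of_eq_off_zeros hz fun i hi => ?_⟩,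
    signAdjAt_signFlip _ _, ?_⟩
  · exact signFlip_of_ne _ (by rintro rfl; exact hi (hz0 _ hk rfl))
  · rw [sign_ne (mem_differ.1 hk)]
    exact signFlip_self _ _

theorem exists_isTaut (α β : 𝒱.Feas) : ∃ a, IsTaut α β a := by
  induction hn : (differ α.1 β.1).card using Nat.strong_induction_on generalizing α with
  | _ n ih =>
  by_cases h : α = β
  · subst h
    exact ⟨_, IsTaut.nil α⟩
  · obtain ⟨i, γ, hi, hγ⟩ := exists_adj_towards h
    obtain ⟨a, ha⟩ := ih _ (hn ▸ card_differ_lt hi hγ) γ rfl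
    exact ⟨_, IsTaut.cons i ⟨i, hi⟩ hi hγ ha⟩

/-- If, along a path, the minimum of a finite family of functions is attained first by a function of
the class `C` and finally by one outside `C`, then both kinds attain it at some time. -/
theorem exists_common_min {ι : Type*} (D : Finset ι) (f : ι → ℝ → ℝ)
    (hf : ∀ k ∈ D, Continuous (f k)) (C : Set ι) {i j : ι} (hi : i ∈ D) (hiC : i ∈ C) (hj : j ∈ D)
    (hjC : j ∉ C) (h0 : ∀ k ∈ D, f i 0 ≤ f k 0) (h1 : ∀ k ∈ D, f j 1 ≤ f k 1) :
    ∃ s ∈ Set.Icc (0 : ℝ) 1, ∃ k ∈ D, k ∈ C ∧ ∃ l ∈ D, l ∉ C ∧ (∀ m ∈ D, f k s ≤ f m s) ∧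
      f l s = f k s := by
  have hclosed : ∀ P : ι → Prop, IsClosed {s | ∃ k ∈ D, P k ∧ ∀ m ∈ D, f k s ≤ f m s} := fun P => by
    have : {s | ∃ k ∈ D, P k ∧ ∀ m ∈ D, f k s ≤ f m s} =
        ⋃ k ∈ {k | k ∈ D ∧ P k}, ⋂ m ∈ D, {s | f k s ≤ f m s} := by
      ext s; simp [and_assoc]
    rw [this]
    refine Set.Finite.isClosed_biUnion (D.finite_toSet.subset fun k hk => hk.1) fun k hk => ?_
    exact isClosed_biInter fun m hm => isClosed_le (hf k hk.1) (hf m hm)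
  obtain ⟨s, hs, ⟨k, hk, hkC, hkm⟩, ⟨l, hl, hlC, hlm⟩⟩ := isPreconnected_closed_iff.1
    (isPreconnected_Icc (a := (0 : ℝ)) (b := 1)) _ _ (hclosed (· ∈ C)) (hclosed (· ∉ C))
    (by
      intro s _
      obtain ⟨k, hk, hmin⟩ := D.exists_min_image (fun k => f k s) ⟨i, hi⟩
      by_cases hkC : k ∈ C
      · exact Or.inl ⟨k, hk, hkC, hmin⟩
      · exact Or.inr ⟨k, hk, hkC, hmin⟩)
    ⟨0, by simp, i, hi, hiC, h0⟩ ⟨1, by simp, j, hj, hjC, h1⟩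
  exact ⟨s, hs, k, hk, hkC, l, hl, hlC, hkm, le_antisymm (hlm k hk) (hkm l hl)⟩

/-- Adjacent chambers share a point of the hyperplane between them. -/
theorem exists_facet_point {α γ : 𝒱.Feas} {i : I} (h : SignAdjAt i α.1 γ.1) :
    ∃ z ∈ 𝒱.chamber α.1, z.1 i = 0 := by
  obtain ⟨q, hq⟩ := α.2.exists_interior
  obtain ⟨q', hq'⟩ := γ.2.exists_interior
  have h1 := hq i
  have h2 := hq' i
  rw [sign_ne h.ne] at h2
  push_cast at h2
  set a := ((α.1 i : ℤ) : ℝ) * q.1 i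
  set b := -(((α.1 i : ℤ) : ℝ) * q'.1 i) with hb
  have hb0 : 0 < b := by linarith
  have key : ∀ k, ((α.1 k : ℤ) : ℝ) * (seg q q' (a / (a + b))).1 k =
      (b * (((α.1 k : ℤ) : ℝ) * q.1 k) + a * (((α.1 k : ℤ) : ℝ) * q'.1 k)) / (a + b) := fun k => by
    have : a + b ≠ 0 := by positivity
    rw [seg_apply]
    field_simp
    ring
  have hi0 : (seg q q' (a / (a + b))).1 i = 0 := by
    have := key i
    rw [show b * (((α.1 i : ℤ) : ℝ) * q.1 i) + a * (((α.1 i : ℤ) : ℝ) * q'.1 i) = 0 by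
      change b * a + _ = 0
      rw [hb]; ring, zero_div] at this
    exact (mul_eq_zero.1 this).resolve_left (sign_ne_zero _)
  refine ⟨_, fun k => ?_, hi0⟩
  by_cases hk : k = i
  · rw [hk, hi0, mul_zero]
  · have h3 := hq' k
    rw [← h.eq_of_ne hk] at h3
    rw [key]
    have := hq k
    positivity

/-- All taut paths between two chambers define the same element of `A`. By induction on the number
of hyperplanes crossed it suffices to compare the first steps. Two walls of the chamber of `α` that
meet in a common face can be exchanged by a commuting square, and the walls through which one can
leave towards `β` are linked through such common faces, as one sees by moving the starting point of
a segment towards `β` from one wall to the other. -/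
theorem IsTaut.unique {α β : 𝒱.Feas} {a b : 𝒱.A} (ha : IsTaut α β a) (hb : IsTaut α β b) :
    a = b := by
  induction hn : (differ α.1 β.1).card using Nat.strong_induction_on generalizing α a b with
  | _ n ih =>
  cases ha with
  | nil =>
    cases hb with
    | nil => rfl
    | cons i h hi hβ hb => exact absurd hβ.symm hi.ne
  | @cons _ γ _ a i h hi hβ ha =>
  cases hb with
  | nil => exact absurd hβ.symm hi.ne
  | @cons _ γ' _ b j h' hj hβ' hb =>
  subst hn
  let R : I → 𝒱.A → Prop := fun k x => ∃ (γ : 𝒱.Feas) (h : SignAdj α.1 γ.1) (c : 𝒱.A),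
    SignAdjAt k α.1 γ.1 ∧ γ.1 k = β.1 k ∧ IsTaut γ β c ∧ x = 𝒱.pA α γ h * c
  have hR : ∀ k x y, R k x → R k y → x = y := by
    rintro k x y ⟨γ, h, c, hk, hβ, hc, rfl⟩ ⟨γ', h', c', hk', hβ', hc', rfl⟩
    obtain rfl : γ = γ' := Subtype.ext (hk.eq_signFlip.trans hk'.eq_signFlip.symm)
    rw [ih _ (card_differ_lt hk hβ) hc hc' rfl]
  have hi' : R i (𝒱.pA α γ h * a) := ⟨γ, h, a, hi, hβ, ha, rfl⟩
  have hj' : R j (𝒱.pA α γ' h' * b) := ⟨γ', h', b, hj, hβ', hb, rfl⟩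
  suffices R j (𝒱.pA α γ h * a) from hR j _ _ this hj'
  by_contra hjC
  obtain ⟨y, hy⟩ := β.2.exists_interior
  obtain ⟨zi, hzi, hzi0⟩ := exists_facet_point hi
  obtain ⟨zj, hzj, hzj0⟩ := exists_facet_point hj
  have hiD : i ∈ differ α.1 β.1 := mem_differ.2 (hβ ▸ hi.ne)
  have hjD : j ∈ differ α.1 β.1 := mem_differ.2 (hβ' ▸ hj.ne)
  have hseg0 : seg zi zj 0 = zi := Subtype.ext (funext fun k => by simp [seg_apply])
  have hseg1 : seg zi zj 1 = zj := Subtype.ext (funext fun k => by simp [seg_apply])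
  obtain ⟨s, hs, k, hk, hkC, l, hl, hlC, hmin, hlk⟩ := exists_common_min (differ α.1 β.1)
    (fun k s => ratio α.1 y (seg zi zj s) k)
    (fun k _ => by simp only [ratio, seg_apply]; fun_prop)
    {k | R k (𝒱.pA α γ h * a)} hiD hi' hjD hjC
    (fun k hk => by
      simp only [hseg0]
      refine le_of_eq_of_le ?_ (ratio_nonneg hy hzi hk)
      simp [ratio, hzi0])
    (fun k hk => by
      simp only [hseg1]
      refine le_of_eq_of_le ?_ (ratio_nonneg hy hzj hk)
      simp [ratio, hzj0])
  have hmem : seg zi zj s ∈ 𝒱.chamber α.1 := fun m => by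
    rw [seg_apply]
    have h1 := mul_nonneg (sub_nonneg.2 hs.2) (hzi m)
    have h2 := mul_nonneg hs.1 (hzj m)
    linarith
  obtain ⟨z, hz, hz0⟩ := exists_exit_point hy hmem (ratio_nonneg hy hmem hk) hmin
  have hzk := hz0 k hk rfl
  have hzl := hz0 l hl hlk
  obtain ⟨δ, hδ, c, hδk, hδβ, hc, hcx⟩ := hkC
  have hkl : l ≠ k := by
    rintro rfl
    exact hlC ⟨δ, hδ, c, hδk, hδβ, hc, hcx⟩
  let ε : 𝒱.Feas := ⟨signFlip α.1 l, feasible_of_eq_off_zeros hz fun m hm =>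
    signFlip_of_ne _ (by rintro rfl; exact hm hzl)⟩
  let κ : 𝒱.Feas := ⟨signFlip δ.1 l, feasible_of_eq_off_zeros hz fun m hm => by
    rw [signFlip_of_ne _ (by rintro rfl; exact hm hzl),
      hδk.eq_of_ne (by rintro rfl; exact hm hzk)]⟩
  have hαε : SignAdjAt l α.1 ε.1 := signAdjAt_signFlip _ _
  have hδκ : SignAdjAt l δ.1 κ.1 := signAdjAt_signFlip _ _
  have hεκ : SignAdjAt k ε.1 κ.1 := fun m => by
    by_cases hm : m = l
    · subst hm
      simp [ε, κ, signFlip_self, hδk.eq_of_ne hkl, hkl]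
    · simp only [ε, κ, signFlip_of_ne _ hm]
      exact hδk m
  have hβl : -α.1 l = β.1 l := (sign_ne (mem_differ.1 hl)).symm
  have hεβ : ε.1 l = β.1 l := by rw [← hβl]; exact signFlip_self _ _
  have hκβ : κ.1 l = β.1 l := by
    rw [← hβl, hδk.eq_of_ne hkl]; exact signFlip_self _ _
  have hκk : κ.1 k = β.1 k := by
    rw [← hδβ]; exact signFlip_of_ne _ (Ne.symm hkl)
  obtain ⟨d, hd⟩ := exists_isTaut κ β
  have hcd : c = 𝒱.pA δ κ ⟨l, hδκ⟩ * d :=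
    ih _ (card_differ_lt hδk hδβ) hc (IsTaut.cons l _ hδκ hκβ hd) rfl
  refine hlC ⟨ε, ⟨l, hαε⟩, 𝒱.pA ε κ ⟨k, hεκ⟩ * d, hαε, hεβ, IsTaut.cons k _ hεκ hκk hd, ?_⟩
  rw [hcx, hcd, ← mul_assoc, ← mul_assoc]
  congr 1
  have n1 : α ≠ δ := fun h => hδk.ne (by rw [h])
  have n2 : α ≠ κ := fun h => (mem_differ.1 hk) (by rw [← hκk, ← h])
  have n3 : α ≠ ε := fun h => hαε.ne (by rw [← h])
  have n4 : δ ≠ κ := fun h => hδκ.ne (by rw [← h])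
  have n5 : δ ≠ ε := fun h => (mem_differ.1 hl) (by rw [← hεβ, ← h, hδk.eq_of_ne hkl])
  have n6 : κ ≠ ε := fun h => hεκ.ne (by rw [h])
  exact pA_square (by simp [n1, n2, n3, n4, n5, n6]) _ _ _ _

/-- The element of `A` defined by the taut paths from `α` to `β`. -/
def taut (α β : 𝒱.Feas) : 𝒱.A := (exists_isTaut α β).choose

theorem isTaut_taut (α β : 𝒱.Feas) : IsTaut α β (taut α β) := (exists_isTaut α β).choose_spec

theorem taut_self (α : 𝒱.Feas) : taut α α = 𝒱.eA α := (isTaut_taut α α).unique (IsTaut.nil α)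

theorem eA_mul_taut (α β : 𝒱.Feas) : 𝒱.eA α * taut α β = taut α β := (isTaut_taut α β).eA_mul

theorem taut_mul_eA (α β : 𝒱.Feas) : taut α β * 𝒱.eA β = taut α β := (isTaut_taut α β).mul_eA

theorem taut_mul_eA_of_ne (α : 𝒱.Feas) {β γ : 𝒱.Feas} (h : β ≠ γ) : taut α β * 𝒱.eA γ = 0 := by
  rw [← taut_mul_eA, mul_assoc, eA_mul_eA_of_ne h, mul_zero]

/-- Crossing a further hyperplane. -/
theorem taut_mul_pA {α β δ : 𝒱.Feas} {i : I} (h : SignAdj β.1 δ.1) (hi : SignAdjAt i β.1 δ.1)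
    (hα : α.1 i = β.1 i) : taut α β * 𝒱.pA β δ h = taut α δ :=
  ((isTaut_taut α β).snoc h hi hα).unique (isTaut_taut α δ)

/-- Crossing back a hyperplane. -/
theorem taut_mul_pA_back {α β δ : 𝒱.Feas} {i : I} (h : SignAdj β.1 δ.1) (hi : SignAdjAt i β.1 δ.1)
    (hα : α.1 i ≠ β.1 i) : taut α β * 𝒱.pA β δ h = taut α δ * 𝒱.tA (𝒱.t i) := by
  have hδ : α.1 i = δ.1 i := by
    rw [sign_ne hi.ne, sign_ne hα, neg_neg]
  rw [← taut_mul_pA h.symm hi.symm hδ, mul_assoc, pA_mul_pA_back hi.symm, ← mul_assoc, taut_mul_eA]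

theorem pA_mul_taut {α γ β : 𝒱.Feas} {i : I} (h : SignAdj α.1 γ.1) (hi : SignAdjAt i α.1 γ.1)
    (hβ : γ.1 i = β.1 i) : 𝒱.pA α γ h * taut γ β = taut α β :=
  (IsTaut.cons i h hi hβ (isTaut_taut γ β)).unique (isTaut_taut α β)

/-! ### Spanning sets of standard and projective modules -/

/-- Left multiplication by an element, as a homomorphism of right modules. -/
def lmul (x : 𝒱.A) : 𝒱.A →ₗ[𝒱.Aᵐᵒᵖ] 𝒱.A where
  toFun a := x * a
  map_add' := mul_add x
  map_smul' c a := by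
    rw [RingHom.id_apply, MulOpposite.smul_eq_mul_unop, MulOpposite.smul_eq_mul_unop, mul_assoc]

@[simp] theorem lmul_apply (x a : 𝒱.A) : lmul x a = x * a := rfl

theorem mul_mem_right {N : Submodule 𝒱.Aᵐᵒᵖ 𝒱.A} {x : 𝒱.A} (hx : x ∈ N) (a : 𝒱.A) : x * a ∈ N :=
  N.smul_mem (MulOpposite.op a) hx

theorem dual_eq_sum {x : 𝒱.Aff} (hx : (zeros x).card = Module.finrank ℝ 𝒱.V)
    (w : Module.Dual ℝ 𝒱.V) : ∃ c : I → ℝ, w = ∑ i ∈ zeros x, c i • 𝒱.t i := by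
  classical
  choose e he using fun i : I => exists_vector x (fun j => if j = i then 1 else 0)
  refine ⟨fun i => w (e i), LinearMap.ext fun v => ?_⟩
  have : v = ∑ i ∈ zeros x, v.1 i • e i := by
    rw [← sub_eq_zero]
    refine eq_zero_of_vertex hx fun j hj => ?_
    have : ∀ i ∈ zeros x, v.1 i * (e i).1 j = if j = i then v.1 i else 0 := fun i _ => by
      rw [he i j hj]; simp
    simp [Finset.sum_apply, Finset.sum_congr rfl this, hj]
  conv_lhs => rw [this]
  simp [t, mul_comm]

theorem pA_mem_K (γ : 𝒱.BFeas) {i : I} (hi : i ∈ γ.basis) {β : 𝒱.Feas}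
    (hβ : SignAdjAt i γ.sign β.1) (h : SignAdj γ.sign β.1) : 𝒱.pA γ.toFeas β h ∈ 𝒱.K γ :=
  Submodule.subset_span ⟨γ.basis, i, β, h, (γ.isMu_iff _).2 rfl, hi, hβ, rfl⟩

/-- The chamber opposite to `γ` across a hyperplane through its vertex. -/
def BFeas.opposite (γ : 𝒱.BFeas) {i : I} (hi : i ∈ γ.basis) : 𝒱.Feas :=
  ⟨signFlip γ.sign i, γ.flip_feasible hi⟩

theorem BFeas.adj_opposite (γ : 𝒱.BFeas) {i : I} (hi : i ∈ γ.basis) :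
    SignAdjAt i γ.sign (γ.opposite hi).1 := signAdjAt_signFlip _ _

/-- The covectors `t_i` with `i ∈ μ⁻¹(γ)` span `V*`, and `t_i e_γ` is a path that visits the chamber
opposite to `γ` across the `i`-th hyperplane. -/
theorem tA_mul_eA_mem_K (γ : 𝒱.BFeas) (w : Module.Dual ℝ 𝒱.V) : 𝒱.tA w * 𝒱.eA γ.toFeas ∈ 𝒱.K γ := by
  obtain ⟨c, rfl⟩ := dual_eq_sum γ.isLocalMax.card_eq w
  rw [← symA_ι, map_sum, map_sum, Finset.sum_mul]
  refine Submodule.sum_mem _ fun i hi => ?_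
  rw [map_smul, map_smul, symA_ι, smul_mul_assoc, tA_commute,
    ← pA_mul_pA_back (γ.adj_opposite hi) ⟨i, γ.adj_opposite hi⟩ ⟨i, (γ.adj_opposite hi).symm⟩]
  exact ((𝒱.K γ).restrictScalars ℝ).smul_mem _
    (mul_mem_right (pA_mem_K γ hi (γ.adj_opposite hi) _) _)

theorem taut_mem_K (γ : 𝒱.BFeas) {β : 𝒱.Feas} (h : ¬ γ.Agree β.1) : taut γ.toFeas β ∈ 𝒱.K γ := by
  unfold BFeas.Agree at h
  push Not at h
  obtain ⟨i, hi, hne⟩ := h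
  have h1 := γ.adj_opposite hi
  rw [← pA_mul_taut (α := γ.toFeas) (γ := γ.opposite hi) ⟨i, h1⟩ h1]
  · exact mul_mem_right (pA_mem_K γ hi h1 _) _
  · rw [sign_ne h1.ne, sign_ne (Ne.symm hne)]

/-- Modulo `K_{>γ}`, the projective module `P_γ` is spanned by the taut paths from `γ` to the
chambers in the cone with apex `H_b`, where `b = μ⁻¹(γ)`. -/
theorem eA_mul_mem_span_sup_K (γ : 𝒱.BFeas) (a : 𝒱.A) : 𝒱.eA γ.toFeas * a ∈
    Submodule.span ℝ {x | ∃ β : 𝒱.Feas, γ.Agree β.1 ∧ x = taut γ.toFeas β} ⊔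
      (𝒱.K γ).restrictScalars ℝ := by
  set W := Submodule.span ℝ {x | ∃ β : 𝒱.Feas, γ.Agree β.1 ∧ x = taut γ.toFeas β} ⊔
      (𝒱.K γ).restrictScalars ℝ with hW
  have hK : ∀ x ∈ 𝒱.K γ, x ∈ W := fun x hx => (le_sup_right : _ ≤ W) hx
  have htaut : ∀ β : 𝒱.Feas, taut γ.toFeas β ∈ W := fun β => by
    by_cases h : γ.Agree β.1
    · exact (le_sup_left : _ ≤ W) (Submodule.subset_span ⟨β, h, rfl⟩)
    · exact hK _ (taut_mem_K γ h)
  have htK : ∀ (β : 𝒱.Feas) w, taut γ.toFeas β * 𝒱.tA w ∈ 𝒱.K γ := fun β w => by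
    rw [← tA_commute, ← eA_mul_taut, ← mul_assoc]
    exact mul_mem_right (tA_mul_eA_mem_K γ w) _
  have red : ∀ y, (∀ β : 𝒱.Feas, taut γ.toFeas β * y ∈ W) → ∀ x ∈ W, x * y ∈ W := by
    intro y hy x hx
    have : W ≤ W.comap (LinearMap.mulRight ℝ y) := by
      refine sup_le (Submodule.span_le.2 ?_) fun x hx => hK _ (mul_mem_right hx y)
      rintro _ ⟨β, -, rfl⟩
      exact hy β
    exact this hx
  refine mul_mem_of_generators W (fun x hx α => red _ (fun β => ?_) x hx)
    (fun x hx α β h => red _ (fun δ => ?_) x hx) (fun x hx w => red _ (fun β => ?_) x hx)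
    (by simpa [taut_self] using htaut γ.toFeas) a
  · by_cases h : β = α
    · subst h; rw [taut_mul_eA]; exact htaut _
    · rw [taut_mul_eA_of_ne _ h]; exact W.zero_mem
  · by_cases hδ : δ = α
    · subst hδ
      have hi := h.choose_spec
      by_cases hγ : γ.toFeas.1 h.choose = δ.1 h.choose
      · rw [taut_mul_pA _ hi hγ]; exact htaut _
      · rw [taut_mul_pA_back _ hi hγ]; exact hK _ (htK _ _)
    · rw [← eA_mul_pA, ← mul_assoc, taut_mul_eA_of_ne _ hδ, zero_mul]; exact W.zero_mem
  · exact hK _ (htK _ _)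

/-- The right ideal generated by the taut paths from `α` to the chambers in `U`. -/
def tautIdeal (α : 𝒱.Feas) (U : Set 𝒱.BFeas) : Submodule 𝒱.Aᵐᵒᵖ 𝒱.A :=
  Submodule.span 𝒱.Aᵐᵒᵖ {x | ∃ γ ∈ U, x = taut α γ.toFeas}

theorem taut_mem_tautIdeal (α : 𝒱.Feas) {U : Set 𝒱.BFeas} {γ : 𝒱.BFeas} (h : γ ∈ U) :
    taut α γ.toFeas ∈ tautIdeal α U := Submodule.subset_span ⟨γ, h, rfl⟩

theorem tautIdeal_mono (α : 𝒱.Feas) {U U' : Set 𝒱.BFeas} (h : U ⊆ U') :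
    tautIdeal α U ≤ tautIdeal α U' :=
  Submodule.span_mono fun _ ⟨γ, hγ, hx⟩ => ⟨γ, h hγ, hx⟩

theorem taut_eq_zero (α : 𝒱.Feas) {β : 𝒱.Feas} (h : ¬ 𝒱.IsBoundedSign β.1) : taut α β = 0 := by
  rw [← taut_mul_eA, 𝒱.eA_eq_zero β h, mul_zero]

theorem gt_wf : WellFounded ((· > ·) : 𝒱.BFeas → 𝒱.BFeas → Prop) := wellFounded_gt

/-- A taut path from `α` to `δ` can be rewritten through chambers above `δ` whose cone contains
`α`. -/
theorem taut_mem_tautIdeal_ge (α : 𝒱.Feas) (δ : 𝒱.BFeas) :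
    taut α δ.toFeas ∈ tautIdeal α {γ | γ.Agree α.1 ∧ δ ≤ γ} := by
  induction δ using gt_wf.induction with
  | _ δ ih =>
  by_cases h : δ.Agree α.1
  · exact taut_mem_tautIdeal _ ⟨h, le_rfl⟩
  unfold BFeas.Agree at h
  push Not at h
  obtain ⟨i, hi, hne⟩ := h
  have h1 := δ.adj_opposite hi
  rw [← taut_mul_pA (β := δ.opposite hi) ⟨i, h1.symm⟩ h1.symm
    (by rw [sign_ne h1.ne, sign_ne (Ne.symm hne)])]
  refine mul_mem_right ?_ _
  by_cases hb : 𝒱.IsBoundedSign (δ.opposite hi).1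
  · have hlt : δ < ⟨_, (δ.opposite hi).2, hb⟩ := BFeas.lt_flip hi h1
    refine SetLike.le_def.1 (tautIdeal_mono α ?_) (ih _ hlt)
    exact fun γ hγ => ⟨hγ.1, hlt.le.trans hγ.2⟩
  · rw [taut_eq_zero _ hb]
    exact Submodule.zero_mem _

theorem taut_mul_mem_tautIdeal_gt {α : 𝒱.Feas} {γ : 𝒱.BFeas} (h : γ.Agree α.1) {k : 𝒱.A}
    (hk : k ∈ 𝒱.K γ) : taut α γ.toFeas * k ∈ tautIdeal α {γ' | γ'.Agree α.1 ∧ γ < γ'} := by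
  have : 𝒱.K γ ≤ (tautIdeal α {γ' | γ'.Agree α.1 ∧ γ < γ'}).comap (lmul (taut α γ.toFeas)) := by
    refine Submodule.span_le.2 ?_
    rintro _ ⟨b, i, β, hadj, hb, hi, hβ, rfl⟩
    rw [γ.isMu_iff] at hb
    subst hb
    show taut α γ.toFeas * 𝒱.pA γ.toFeas β hadj ∈ tautIdeal α {γ' | γ'.Agree α.1 ∧ γ < γ'}
    rw [taut_mul_pA _ hβ (h i hi)]
    by_cases hbd : 𝒱.IsBoundedSign β.1
    · have hlt : γ < ⟨β.1, β.2, hbd⟩ := BFeas.lt_flip hi hβ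
      refine SetLike.le_def.1 (tautIdeal_mono α ?_) (taut_mem_tautIdeal_ge α ⟨β.1, β.2, hbd⟩)
      exact fun γ' hγ' => ⟨hγ'.1, hlt.trans_le hγ'.2⟩
    · rw [taut_eq_zero _ hbd]
      exact Submodule.zero_mem _
  exact this hk

/-- The span over `ℝ` of the products of taut paths `α → γ → β` with `γ ∈ U` such that `β` lies in
the cone of `γ`. -/
def tautSpan (α : 𝒱.Feas) (U : Set 𝒱.BFeas) : Submodule ℝ 𝒱.A :=
  Submodule.span ℝ {x | ∃ γ ∈ U, ∃ β : 𝒱.Feas, γ.Agree β.1 ∧ x = taut α γ.toFeas * taut γ.toFeas β}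

theorem tautIdeal_eq_tautSpan {α : 𝒱.Feas} {U : Set 𝒱.BFeas} (hU : ∀ γ ∈ U, γ.Agree α.1)
    (hup : ∀ γ ∈ U, ∀ γ', γ < γ' → γ'.Agree α.1 → γ' ∈ U) :
    (tautIdeal α U).restrictScalars ℝ = tautSpan α U := by
  refine le_antisymm ?_ (Submodule.span_le.2 ?_)
  · have key : ∀ γ ∈ U, ∀ a, taut α γ.toFeas * a ∈ tautSpan α U := by
      intro γ
      induction γ using gt_wf.induction with
      | _ γ ih =>
      intro hγ a
      rw [← taut_mul_eA, mul_assoc]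
      have hle : Submodule.span ℝ {x | ∃ β : 𝒱.Feas, γ.Agree β.1 ∧ x = taut γ.toFeas β} ⊔
          (𝒱.K γ).restrictScalars ℝ ≤
          (tautSpan α U).comap (LinearMap.mulLeft ℝ (taut α γ.toFeas)) := by
        refine sup_le (Submodule.span_le.2 ?_) fun k hk => ?_
        · rintro _ ⟨β, hβ, rfl⟩
          exact Submodule.subset_span ⟨γ, hγ, β, hβ, rfl⟩
        · have hk' := taut_mul_mem_tautIdeal_gt (hU γ hγ) hk
          show taut α γ.toFeas * k ∈ tautSpan α U
          rw [tautIdeal] at hk'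
          generalize taut α γ.toFeas * k = y at hk' ⊢
          have : ∀ a, y * a ∈ tautSpan α U := by
            induction hk' using Submodule.span_induction with
            | mem x hx =>
              obtain ⟨γ', ⟨h1, h2⟩, rfl⟩ := hx
              exact ih γ' h2 (hup γ hγ γ' h2 h1)
            | zero => intro a; rw [zero_mul]; exact Submodule.zero_mem _
            | add x y _ _ hx hy => intro a; rw [add_mul]; exact add_mem (hx a) (hy a)
            | smul c x _ hx =>
              intro a
              rw [MulOpposite.smul_eq_mul_unop, mul_assoc]
              exact hx _
          simpa using this 1
      exact hle (eA_mul_mem_span_sup_K γ a)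
    intro x hx
    have : ∀ a, x * a ∈ tautSpan α U := by
      replace hx : x ∈ Submodule.span 𝒱.Aᵐᵒᵖ {x | ∃ γ ∈ U, x = taut α γ.toFeas} := hx
      induction hx using Submodule.span_induction with
      | mem x hx =>
        obtain ⟨γ, hγ, rfl⟩ := hx
        exact key γ hγ
      | zero => intro a; rw [zero_mul]; exact Submodule.zero_mem _
      | add x y _ _ hx hy => intro a; rw [add_mul]; exact add_mem (hx a) (hy a)
      | smul c x _ hx =>
        intro a
        rw [MulOpposite.smul_eq_mul_unop, mul_assoc]
        exact hx _
    simpa using this 1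
  · rintro _ ⟨γ, hγ, β, -, rfl⟩
    exact mul_mem_right (taut_mem_tautIdeal α hγ) _

theorem eA_mul_mem_tautSpan (α : 𝒱.BFeas) (a : 𝒱.A) :
    𝒱.eA α.toFeas * a ∈ tautSpan α.toFeas {γ | γ.Agree α.sign} := by
  rw [← tautIdeal_eq_tautSpan (α := α.toFeas) (U := {γ | γ.Agree α.sign}) (fun _ h => h)
    (fun _ _ _ _ h => h), ← taut_self]
  exact mul_mem_right (taut_mem_tautIdeal α.toFeas α.agree_self) a

theorem K_eq_tautIdeal (α : 𝒱.BFeas) :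
    𝒱.K α = tautIdeal α.toFeas {γ | γ.Agree α.sign ∧ γ ≠ α} := by
  refine le_antisymm (fun k hk => ?_) (Submodule.span_le.2 ?_)
  · have hk' := taut_mul_mem_tautIdeal_gt (α := α.toFeas) α.agree_self hk
    have : 𝒱.eA α.toFeas * k = k := by
      have hle : 𝒱.K α ≤ LinearMap.eqLocus (lmul (𝒱.eA α.toFeas)) LinearMap.id := by
        refine Submodule.span_le.2 ?_
        rintro _ ⟨b, i, β, hadj, -, -, -, rfl⟩
        exact 𝒱.eA_mul_pA _ _ _
      exact hle hk
    rw [taut_self, this] at hk'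
    refine SetLike.le_def.1 (tautIdeal_mono _ ?_) hk'
    exact fun γ hγ => ⟨hγ.1, hγ.2.ne'⟩
  · rintro _ ⟨γ, ⟨hγ, hne⟩, rfl⟩
    refine taut_mem_K α fun h => hne ?_
    exact BFeas.eq_of_agree hγ h

end PolarizedArrangement

/-! ### Degenerating a finite set of points to the origin -/

section InitialIdeal

variable {σ : Type*}

/-- Evaluation at the point `h • x`, where `h` is the variable of the ring of power series. -/
def evalScaled (x : σ → ℝ) : MvPolynomial σ (PowerSeries ℝ) →ₐ[PowerSeries ℝ] PowerSeries ℝ :=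
  MvPolynomial.aeval fun i => PowerSeries.X * PowerSeries.C (x i)

theorem evalScaled_X (x : σ → ℝ) (i : σ) :
    evalScaled x (MvPolynomial.X i) = PowerSeries.X * PowerSeries.C (x i) := by
  simp [evalScaled]

/-- Reduction of the coefficients modulo `h`. -/
def redCoeff : MvPolynomial σ (PowerSeries ℝ) →+* MvPolynomial σ ℝ :=
  MvPolynomial.map PowerSeries.constantCoeff

/-- Polynomials as polynomials with constant power series as coefficients. -/
def inclCoeff : MvPolynomial σ ℝ →+* MvPolynomial σ (PowerSeries ℝ) :=
  MvPolynomial.map PowerSeries.C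

theorem redCoeff_inclCoeff (f : MvPolynomial σ ℝ) : redCoeff (inclCoeff f) = f := by
  rw [redCoeff, inclCoeff, MvPolynomial.map_map]
  have : (PowerSeries.constantCoeff (R := ℝ)).comp PowerSeries.C = RingHom.id ℝ := by
    ext; simp
  rw [this, MvPolynomial.map_id]

/-- The ideal of the limit for `h → 0` of the sets of points `h • Y`: the reductions modulo `h` of
the polynomials over `ℝ⟦h⟧` which vanish at the points `h • x`, `x ∈ Y`. For finite `Y` it is the
ideal of leading forms of the polynomials vanishing on `Y`. -/
def initialIdeal (Y : Set (σ → ℝ)) : Ideal (MvPolynomial σ ℝ) where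
  carrier := {f | ∃ G, redCoeff G = f ∧ ∀ x ∈ Y, evalScaled x G = 0}
  add_mem' := by
    rintro _ _ ⟨G, rfl, hG⟩ ⟨H, rfl, hH⟩
    exact ⟨G + H, map_add _ _ _, fun x hx => by rw [map_add, hG x hx, hH x hx, add_zero]⟩
  zero_mem' := ⟨0, map_zero _, fun _ _ => map_zero _⟩
  smul_mem' := by
    rintro c _ ⟨G, rfl, hG⟩
    refine ⟨inclCoeff c * G, ?_, fun x hx => by rw [map_mul, hG x hx, mul_zero]⟩
    rw [map_mul, redCoeff_inclCoeff, smul_eq_mul]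

theorem exists_eq_smul_of_redCoeff_eq_zero {G : MvPolynomial σ (PowerSeries ℝ)}
    (h : redCoeff G = 0) : ∃ H, G = (PowerSeries.X : PowerSeries ℝ) • H := by
  have : MvPolynomial.C PowerSeries.X ∣ G := by
    rw [MvPolynomial.C_dvd_iff_dvd_coeff]
    intro m
    rw [PowerSeries.X_dvd_iff, ← MvPolynomial.coeff_map]
    change MvPolynomial.coeff m (redCoeff G) = 0
    rw [h, MvPolynomial.coeff_zero]
  obtain ⟨H, rfl⟩ := this
  exact ⟨H, (MvPolynomial.smul_eq_C_mul _ _).symm⟩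

/-- Passing to the limit does not lose points. By Nakayama's lemma, polynomials that span the
quotient by the initial ideal span, over `ℝ⟦h⟧`, the restrictions of all polynomials to the points
`h • x`, and the latter module contains a multiple of each indicator function. -/
theorem ncard_le_finrank_quotient_initialIdeal (Y : Set (σ → ℝ)) (hY : Y.Finite)
    [Module.Finite ℝ (MvPolynomial σ ℝ ⧸ initialIdeal Y)] :
    Y.ncard ≤ Module.finrank ℝ (MvPolynomial σ ℝ ⧸ initialIdeal Y) := by
  classical
  have := hY.fintype
  let Ψ : MvPolynomial σ (PowerSeries ℝ) →ₐ[PowerSeries ℝ] (Y → PowerSeries ℝ) :=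
    AlgHom.pi fun x => evalScaled x.1
  have hΨ : ∀ G x, Ψ G x = evalScaled x.1 G := fun _ _ => rfl
  let b := Module.finBasis ℝ (MvPolynomial σ ℝ ⧸ initialIdeal Y)
  choose s hs using fun j => Ideal.Quotient.mk_surjective (b j)
  let R := LinearMap.range Ψ.toLinearMap
  let E := Submodule.span (PowerSeries ℝ) (Set.range fun j => Ψ (inclCoeff (s j)))
  have hRE : R ≤ E := by
    refine Submodule.le_of_le_smul_of_le_jacobson_bot
      (I := Ideal.span {(PowerSeries.X : PowerSeries ℝ)}) (IsNoetherian.noetherian R) ?_ ?_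
    · rw [IsLocalRing.jacobson_eq_maximalIdeal _ bot_ne_top, Ideal.span_singleton_le_iff_mem]
      refine (IsLocalRing.mem_maximalIdeal _).2 fun h => ?_
      have := (PowerSeries.isUnit_iff_constantCoeff.1 h)
      simp at this
    · rintro _ ⟨G, rfl⟩
      have hmem : redCoeff G - ∑ j, b.repr (Ideal.Quotient.mk _ (redCoeff G)) j • s j ∈
          initialIdeal Y := by
        rw [← Ideal.Quotient.eq_zero_iff_mem, map_sub, sub_eq_zero, map_sum]
        conv_lhs => rw [← b.sum_repr (Ideal.Quotient.mk _ (redCoeff G))]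
        refine Finset.sum_congr rfl fun j _ => ?_
        rw [← hs j]
        rfl
      obtain ⟨G', hG', hG'0⟩ := hmem
      obtain ⟨H, hH⟩ := exists_eq_smul_of_redCoeff_eq_zero (G := G - G' -
        inclCoeff (∑ j, b.repr (Ideal.Quotient.mk _ (redCoeff G)) j • s j)) (by
          rw [map_sub, map_sub, hG', redCoeff_inclCoeff]; ring)
      have hG : Ψ G = Ψ (inclCoeff (∑ j, b.repr (Ideal.Quotient.mk _ (redCoeff G)) j • s j)) +
          (PowerSeries.X : PowerSeries ℝ) • Ψ H := by
        have h1 : Ψ G' = 0 := funext fun x => hG'0 x.1 x.2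
        rw [← map_smul, ← hH, map_sub, map_sub, h1]
        ring
      show Ψ G ∈ _
      rw [hG]
      refine Submodule.add_mem_sup ?_ (Submodule.smul_mem_smul (Ideal.mem_span_singleton_self _)
        ⟨H, rfl⟩)
      rw [map_sum, map_sum]
      refine Submodule.sum_mem _ fun j _ => ?_
      have : inclCoeff (b.repr (Ideal.Quotient.mk _ (redCoeff G)) j • s j) =
          PowerSeries.C (b.repr (Ideal.Quotient.mk _ (redCoeff G)) j) • inclCoeff (s j) := by
        rw [MvPolynomial.smul_eq_C_mul, MvPolynomial.smul_eq_C_mul, map_mul]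
        congr 1
        simp [inclCoeff]
      rw [this, map_smul]
      exact Submodule.smul_mem _ _ (Submodule.subset_span ⟨j, rfl⟩)
  have hsep : ∀ x y : Y, x ≠ y → ∃ i, x.1 i ≠ y.1 i := fun x y h => by
    by_contra! hc
    exact h (Subtype.ext (funext hc))
  choose i hi using hsep
  -- Lagrange interpolation polynomials for the points `h • x`
  let r : Y → MvPolynomial σ (PowerSeries ℝ) := fun x => ∏ y : Y, if h : x = y then 1 else
    MvPolynomial.X (i x y h) - MvPolynomial.C (PowerSeries.X * PowerSeries.C (y.1 (i x y h)))
  have hr0 : ∀ x y : Y, x ≠ y → Ψ (r x) y = 0 := fun x y h => by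
    rw [hΨ, map_prod]
    refine Finset.prod_eq_zero (Finset.mem_univ y) ?_
    rw [dif_neg h, map_sub, evalScaled_X]
    simp [evalScaled]
  have hr1 : ∀ x : Y, Ψ (r x) x ≠ 0 := fun x => by
    rw [hΨ, map_prod]
    refine Finset.prod_ne_zero_iff.2 fun y _ => ?_
    split_ifs with h
    · simp
    · have h1 : evalScaled x.1 (MvPolynomial.X (i x y h) -
          MvPolynomial.C (PowerSeries.X * PowerSeries.C (y.1 (i x y h)))) =
          PowerSeries.X * PowerSeries.C (x.1 (i x y h) - y.1 (i x y h)) := by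
        rw [map_sub, evalScaled_X, map_sub, mul_sub]
        simp [evalScaled]
      rw [h1]
      refine mul_ne_zero PowerSeries.X_ne_zero ?_
      rw [Ne, map_eq_zero_iff _ PowerSeries.C_injective]
      exact sub_ne_zero.2 (hi x y h)
  have hli : LinearIndependent (PowerSeries ℝ) fun x => Ψ (r x) := by
    rw [Fintype.linearIndependent_iff]
    intro c hc y
    have := congrFun hc y
    rw [Finset.sum_apply, Finset.sum_eq_single y] at this
    · exact (mul_eq_zero.1 this).resolve_right (hr1 y)
    · intro x _ hxy
      rw [Pi.smul_apply, hr0 x y hxy, smul_zero]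
    · simp
  have hcard := linearIndependent_le_span_aux' _ hli
    (Set.range fun j => Ψ (inclCoeff (s j))) (by
      rintro _ ⟨x, rfl⟩
      exact hRE ⟨r x, rfl⟩)
  rw [← Nat.card_coe_set_eq, Nat.card_eq_fintype_card]
  refine hcard.trans ?_
  refine (Fintype.card_range_le _).trans ?_
  rw [Fintype.card_fin]

end InitialIdeal

/-! ### A representation on leading forms -/

section MatrixUnits

variable {S ι : Type*} [CommRing S] [DecidableEq ι] {N : ι → Type*} [∀ i, AddCommGroup (N i)]
  [∀ i, Module S (N i)]

/-- The endomorphism of a product which maps the factor `i` to the factor `j` by `f`. -/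
def matrixUnit {i j : ι} (f : N i →ₗ[S] N j) : Module.End S (∀ i, N i) :=
  LinearMap.single S N j ∘ₗ f ∘ₗ LinearMap.proj i

theorem matrixUnit_apply {i j : ι} (f : N i →ₗ[S] N j) (m : ∀ i, N i) :
    matrixUnit f m = Pi.single j (f (m i)) := rfl

theorem matrixUnit_mul {i j k : ι} (g : N j →ₗ[S] N k) (f : N i →ₗ[S] N j) :
    matrixUnit g * matrixUnit f = matrixUnit (g ∘ₗ f) := by
  ext m : 1
  simp [matrixUnit_apply]

theorem matrixUnit_mul_of_ne {i j k l : ι} (g : N k →ₗ[S] N l) (f : N i →ₗ[S] N j) (h : j ≠ k) :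
    matrixUnit g * matrixUnit f = 0 := by
  ext m : 1
  simp [matrixUnit_apply, Pi.single_eq_of_ne h.symm]

theorem matrixUnit_zero {i j : ι} : matrixUnit (0 : N i →ₗ[S] N j) = 0 := by
  ext m : 1
  simp [matrixUnit_apply]

theorem sum_matrixUnit_id [Fintype ι] :
    ∑ i, matrixUnit (LinearMap.id : N i →ₗ[S] N i) = 1 := by
  refine LinearMap.ext fun m => ?_
  rw [LinearMap.sum_apply]
  exact Finset.univ_sum_single m

end MatrixUnits

namespace PolarizedArrangement

variable {I : Type u} [Fintype I] {𝒱 : PolarizedArrangement I}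

/-- The vertices whose cones contain the chambers of `α` and `β`. -/
def commonVertices (α β : I → ℤˣ) : Set (I → ℝ) :=
  {x | ∃ γ : 𝒱.BFeas, γ.Agree α ∧ γ.Agree β ∧ x = γ.vertex.1}

variable (𝒱) in
/-- The ring of leading forms of functions on the common vertices of `α` and `β`. It will turn out
to be isomorphic to `e_α A e_β`. -/
abbrev LeadingForms (α β : 𝒱.Feas) : Type u :=
  MvPolynomial I ℝ ⧸ initialIdeal (commonVertices (𝒱 := 𝒱) α.1 β.1)

open Classical in
/-- The product of the variables of the hyperplanes crossed twice by a path composed of taut paths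
from `α` to `β` and from `β` to `β'`. -/
def crossing (α β β' : 𝒱.Feas) : MvPolynomial I ℝ :=
  ∏ i, if α.1 i = β'.1 i ∧ β.1 i ≠ α.1 i then MvPolynomial.X i else 1

theorem crossing_self (α β : 𝒱.Feas) : crossing α β β = 1 :=
  Finset.prod_eq_one fun _ _ => if_neg fun h => h.2 h.1.symm

theorem crossing_base (α β : 𝒱.Feas) : crossing α α β = 1 :=
  Finset.prod_eq_one fun _ _ => if_neg fun h => h.2 rfl

theorem crossing_mul (α : 𝒱.Feas) {β γ δ : 𝒱.Feas}
    (h : ∀ k, β.1 k = γ.1 k ∨ γ.1 k = δ.1 k) :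
    crossing α β γ * crossing α γ δ = crossing α β δ := by
  unfold crossing
  rw [← Finset.prod_mul_distrib]
  refine Finset.prod_congr rfl fun i _ => ?_
  rcases h i with h | h
  · by_cases h1 : α.1 i = γ.1 i <;> by_cases h2 : α.1 i = δ.1 i <;> simp [h, h1, h2, eq_comm]
  · by_cases h1 : α.1 i = γ.1 i <;> by_cases h2 : α.1 i = δ.1 i <;> simp_all [eq_comm]

theorem crossing_back (α : 𝒱.Feas) {β γ : 𝒱.Feas} {i : I} (h : SignAdjAt i β.1 γ.1) :
    crossing α β γ * crossing α γ β = MvPolynomial.X i := by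
  unfold crossing
  rw [← Finset.prod_mul_distrib, Finset.prod_eq_single i]
  · have := h.ne
    by_cases h1 : α.1 i = β.1 i
    · have h2 : α.1 i ≠ γ.1 i := h1 ▸ this
      simp [h1, this, Ne.symm this]
    · have h2 : α.1 i = γ.1 i := by rw [sign_ne this, sign_ne (Ne.symm h1)]
      simp [h2, Ne.symm this, this]
  · intro j _ hj
    have := h.eq_of_ne hj
    rw [if_neg, if_neg, one_mul]
    · rintro ⟨h1, h2⟩; exact h2 (by rw [← this, h1])
    · rintro ⟨h1, h2⟩; exact h2 (by rw [this, h1])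
  · simp

/-- A cone that contains the chambers of `α` and `β'` but not that of `β` has a wall which separates
`β` from `α` and `β'`; this wall contributes a factor to `crossing` which vanishes at the apex. -/
theorem crossing_mul_mem (α β β' : 𝒱.Feas) {f : MvPolynomial I ℝ}
    (hf : f ∈ initialIdeal (commonVertices (𝒱 := 𝒱) α.1 β.1)) :
    crossing α β β' * f ∈ initialIdeal (commonVertices (𝒱 := 𝒱) α.1 β'.1) := by
  obtain ⟨G, rfl, hG⟩ := hf
  refine ⟨inclCoeff (crossing α β β') * G, by rw [map_mul, redCoeff_inclCoeff], ?_⟩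
  rintro x ⟨γ, hα, hβ', rfl⟩
  rw [map_mul]
  by_cases hβ : γ.Agree β.1
  · rw [hG _ ⟨γ, hα, hβ, rfl⟩, mul_zero]
  · unfold BFeas.Agree at hβ
    push Not at hβ
    obtain ⟨i, hi, hne⟩ := hβ
    have h0 : evalScaled γ.vertex.1 (inclCoeff (crossing α β β')) = 0 := by
      rw [crossing, map_prod, map_prod]
      refine Finset.prod_eq_zero (Finset.mem_univ i) ?_
      rw [if_pos ⟨by rw [hα i hi, hβ' i hi], by rwa [hα i hi]⟩, inclCoeff, MvPolynomial.map_X,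
        evalScaled_X, mem_zeros.1 hi, map_zero, mul_zero]
    rw [h0, zero_mul]

/-- Multiplication by `crossing`. -/
def crossingMap (α β β' : 𝒱.Feas) :
    𝒱.LeadingForms α β →ₗ[MvPolynomial I ℝ] 𝒱.LeadingForms α β' :=
  Submodule.mapQ _ _ (LinearMap.mulLeft _ (crossing α β β')) fun _ hf => crossing_mul_mem α β β' hf

theorem crossingMap_mk (α β β' : 𝒱.Feas) (f : MvPolynomial I ℝ) :
    crossingMap α β β' (Ideal.Quotient.mk _ f) = Ideal.Quotient.mk _ (crossing α β β' * f) := rfl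

theorem crossingMap_self (α β : 𝒱.Feas) : crossingMap α β β = LinearMap.id := by
  refine LinearMap.ext fun x => ?_
  obtain ⟨f, rfl⟩ := Ideal.Quotient.mk_surjective x
  rw [crossingMap_mk, crossing_self, one_mul, LinearMap.id_apply]

theorem crossingMap_comp (α : 𝒱.Feas) {β γ δ : 𝒱.Feas}
    (h : ∀ k, β.1 k = γ.1 k ∨ γ.1 k = δ.1 k) :
    crossingMap α γ δ ∘ₗ crossingMap α β γ = crossingMap α β δ := by
  refine LinearMap.ext fun x => ?_
  obtain ⟨f, rfl⟩ := Ideal.Quotient.mk_surjective x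
  rw [LinearMap.comp_apply, crossingMap_mk, crossingMap_mk, crossingMap_mk, ← crossing_mul α h]
  congr 1
  ring

variable (𝒱) in
theorem exists_lift_covector : ∃ s : Module.Dual ℝ 𝒱.V →ₗ[ℝ] (I → ℝ),
    ∀ w (v : 𝒱.V), ∑ i, s w i * v.1 i = w v := by
  classical
  let Φ : (I → ℝ) →ₗ[ℝ] Module.Dual ℝ 𝒱.V := Fintype.linearCombination ℝ 𝒱.t
  have hΦ : LinearMap.range Φ = ⊤ := by
    rw [LinearMap.range_eq_top]
    intro w
    obtain ⟨x, -, hx⟩ := exists_vertex_supset (Classical.arbitrary 𝒱.Aff)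
    obtain ⟨c, rfl⟩ := dual_eq_sum hx w
    refine ⟨fun i => if i ∈ zeros x then c i else 0, ?_⟩
    simp [Φ, Fintype.linearCombination_apply, Finset.sum_ite_mem]
  obtain ⟨s, hs⟩ := Φ.exists_rightInverse_of_surjective hΦ
  refine ⟨s, fun w v => ?_⟩
  have := LinearMap.congr_fun (LinearMap.congr_fun hs w) v
  simpa [Φ, Fintype.linearCombination_apply, t] using this

/-- A linear choice of lifts of covectors to linear forms on `ℝ^I`. -/
def liftCovector : Module.Dual ℝ 𝒱.V →ₗ[ℝ] MvPolynomial I ℝ :=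
  Fintype.linearCombination ℝ (MvPolynomial.X : I → MvPolynomial I ℝ) ∘ₗ
    (exists_lift_covector 𝒱).choose

/-- Different lifts of a covector agree in the ring of leading forms, because linear forms that
vanish on `V` are constant on `V_η`. -/
theorem X_sub_liftCovector_mem (i : I) (α β : I → ℤˣ) : MvPolynomial.X i - liftCovector (𝒱.t i) ∈
    initialIdeal (commonVertices (𝒱 := 𝒱) α β) := by
  classical
  set s := (exists_lift_covector 𝒱).choose (𝒱.t i) with hs
  have hspec : ∀ v : 𝒱.V, ∑ j, s j * v.1 j = v.1 i :=
    fun v => (exists_lift_covector 𝒱).choose_spec (𝒱.t i) v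
  have hlift : liftCovector (𝒱.t i) = ∑ j, s j • MvPolynomial.X (R := ℝ) j := by
    simp [liftCovector, Fintype.linearCombination_apply, hs]
  let x₀ : 𝒱.Aff := Classical.arbitrary _
  let k : ℝ := x₀.1 i - ∑ j, s j * x₀.1 j
  refine ⟨inclCoeff (MvPolynomial.X i - liftCovector (𝒱.t i)) -
    MvPolynomial.C (PowerSeries.X * PowerSeries.C k), ?_, ?_⟩
  · rw [map_sub, redCoeff_inclCoeff]
    simp [redCoeff]
  · rintro _ ⟨γ, -, -, rfl⟩
    have h1 : γ.vertex.1 i - ∑ j, s j * γ.vertex.1 j = k := by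
      have := hspec (diff x₀ γ.vertex)
      simp only [diff_apply, mul_sub, Finset.sum_sub_distrib] at this
      simp only [k]
      linarith
    rw [hlift, ← h1]
    simp only [inclCoeff, map_sub, map_sum, MvPolynomial.smul_eq_C_mul, map_mul, MvPolynomial.map_X,
      MvPolynomial.map_C, evalScaled, MvPolynomial.aeval_X, MvPolynomial.algHom_C,
      Algebra.algebraMap_self, RingHom.id_apply]
    rw [mul_sub, Finset.mul_sum, sub_eq_zero]
    congr 1
    exact Finset.sum_congr rfl fun j _ => by ring

/-- An unbounded chamber lies in no cone, so that the set of common vertices is empty. -/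
theorem subsingleton_leadingForms (α : 𝒱.Feas) {β : 𝒱.Feas} (h : ¬ 𝒱.IsBoundedSign β.1) :
    Subsingleton (𝒱.LeadingForms α β) := by
  refine Ideal.Quotient.subsingleton_iff.2 (eq_top_iff.2 fun f _ => ?_)
  refine ⟨inclCoeff f, redCoeff_inclCoeff f, ?_⟩
  rintro _ ⟨γ, -, hβ, rfl⟩
  exact absurd hβ.bounded h

/-- The product over `β` of the rings of leading forms, as a representation of `A`: the arrows act
by multiplication by the variable of a hyperplane when crossing it back towards `α`, and by
restriction when crossing it away from `α`. -/
def repData (α : 𝒱.Feas) : LiftData 𝒱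
    (Module.End (MvPolynomial I ℝ) (∀ β, 𝒱.LeadingForms α β))ᵐᵒᵖ (MvPolynomial I ℝ) where
  e β := MulOpposite.op (matrixUnit (crossingMap α β β))
  p β β' _ := MulOpposite.op (matrixUnit (crossingMap α β β'))
  t := liftCovector
  c := IsScalarTower.toAlgHom ℝ _ _
  central x b := Algebra.commutes x b
  idem β := by rw [← MulOpposite.op_mul, matrixUnit_mul, crossingMap_comp α fun _ => Or.inl rfl]
  orth β β' h := by
    rw [← MulOpposite.op_mul, matrixUnit_mul_of_ne _ _ h, MulOpposite.op_zero]
  unit := by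
    simp only [crossingMap_self]
    rw [← Finset.op_sum, sum_matrixUnit_id, MulOpposite.op_one]
  source β β' h := by
    rw [← MulOpposite.op_mul, matrixUnit_mul, crossingMap_comp α fun _ => Or.inl rfl]
  target β β' h := by
    rw [← MulOpposite.op_mul, matrixUnit_mul, crossingMap_comp α fun _ => Or.inr rfl]
  unbounded β h := by
    have := subsingleton_leadingForms α h
    rw [Subsingleton.elim (crossingMap α β β) 0, matrixUnit_zero, MulOpposite.op_zero]
  square β γ δ κ hd h1 h2 h3 h4 := by
    have key : ∀ γ : 𝒱.Feas, SignAdj β.1 γ.1 → SignAdj γ.1 δ.1 →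
        ∀ k, β.1 k = γ.1 k ∨ γ.1 k = δ.1 k := by
      rintro γ ⟨i, hi⟩ ⟨j, hj⟩ k
      by_contra! hc
      obtain rfl : k = i := (hi k).1 hc.1
      obtain rfl : k = j := (hj k).1 hc.2
      have : β = δ := Subtype.ext (hi.symm.eq_signFlip.trans hj.eq_signFlip.symm)
      simp [this] at hd
    rw [← MulOpposite.op_mul, ← MulOpposite.op_mul, matrixUnit_mul, matrixUnit_mul,
      crossingMap_comp α (key γ h1 h2), crossingMap_comp α (key κ h3 h4)]
  back i β γ h h1 h2 := by
    rw [← MulOpposite.op_mul, matrixUnit_mul]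
    refine congrArg MulOpposite.op (LinearMap.ext fun m => ?_)
    change _ = liftCovector (𝒱.t i) • matrixUnit (crossingMap α β β) m
    rw [matrixUnit_apply, matrixUnit_apply, ← Pi.single_smul, crossingMap_self, LinearMap.id_apply,
      LinearMap.comp_apply]
    congr 1
    obtain ⟨f, hf⟩ := Ideal.Quotient.mk_surjective (m β)
    rw [← hf, crossingMap_mk, crossingMap_mk, ← mul_assoc, mul_comm (crossing α γ β),
      crossing_back α h]
    refine Ideal.Quotient.eq.2 ?_
    change _ * f - _ * f ∈ _
    rw [← sub_mul]
    exact Ideal.mul_mem_right _ _ (X_sub_liftCovector_mem i _ _)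

/-- The action of elements of `A` on the generator of the representation on leading forms. -/
def orbit (α β : 𝒱.Feas) : 𝒱.A →ₗ[ℝ] 𝒱.LeadingForms α β where
  toFun a := ((repData α).hom a).unop (Pi.single α 1) β
  map_add' a b := by rw [map_add]; rfl
  map_smul' r a := by rw [map_smul]; rfl

theorem orbit_mul_eA_of_ne (α : 𝒱.Feas) {β γ : 𝒱.Feas} (h : γ ≠ β) (a : 𝒱.A) :
    orbit α β (a * 𝒱.eA γ) = 0 := by
  show ((repData α).hom (a * 𝒱.eA γ)).unop (Pi.single α 1) β = 0
  rw [map_mul, LiftData.hom_eA, MulOpposite.unop_mul]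
  change matrixUnit (crossingMap α γ γ) _ β = 0
  rw [matrixUnit_apply, Pi.single_eq_of_ne h.symm]

theorem orbit_eA_mul (α β : 𝒱.Feas) (a : 𝒱.A) : orbit α β (𝒱.eA α * a) = orbit α β a := by
  show ((repData α).hom (𝒱.eA α * a)).unop (Pi.single α 1) β =
    ((repData α).hom a).unop (Pi.single α 1) β
  rw [map_mul, LiftData.hom_eA, MulOpposite.unop_mul]
  change (((repData α).hom a).unop (matrixUnit (crossingMap α α α) (Pi.single α 1))) β = _
  rw [matrixUnit_apply, crossingMap_self, Pi.single_eq_same, LinearMap.id_apply]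

theorem orbit_mul_tA (α β : 𝒱.Feas) (a : 𝒱.A) (w : Module.Dual ℝ 𝒱.V) :
    orbit α β (a * 𝒱.tA w) = liftCovector w • orbit α β a := by
  show ((repData α).hom (a * 𝒱.tA w)).unop (Pi.single α 1) β = _
  rw [map_mul, LiftData.hom_tA, MulOpposite.unop_mul]
  rfl

theorem repData_hom_of_isTaut (α : 𝒱.Feas) {β γ : 𝒱.Feas} {a : 𝒱.A} (h : IsTaut β γ a) :
    (repData α).hom a = MulOpposite.op (matrixUnit (crossingMap α β γ)) := by
  induction h with
  | nil β => rw [LiftData.hom_eA]; rfl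
  | @cons β γ δ a i h hi hδ ha ih =>
    rw [map_mul, ih, LiftData.hom_pA]
    have : ∀ k, β.1 k = γ.1 k ∨ γ.1 k = δ.1 k := fun k => by
      by_cases hk : k = i
      · subst hk; exact Or.inr hδ
      · exact Or.inl (hi.eq_of_ne hk)
    rw [← crossingMap_comp α this, ← matrixUnit_mul, MulOpposite.op_mul]
    rfl

theorem orbit_taut (α β : 𝒱.Feas) : orbit α β (taut α β) = 1 := by
  show ((repData α).hom (taut α β)).unop (Pi.single α 1) β = 1
  rw [repData_hom_of_isTaut α (isTaut_taut α β), MulOpposite.unop_op, matrixUnit_apply]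
  have h1 : (Pi.single α 1 : ∀ β, 𝒱.LeadingForms α β) α = Ideal.Quotient.mk _ 1 := by
    rw [Pi.single_eq_same, map_one]
  have : crossingMap α α β ((Pi.single α 1 : ∀ β, 𝒱.LeadingForms α β) α) = 1 := by
    rw [h1, crossingMap_mk, crossing_base, mul_one, map_one]
  rw [this, Pi.single_eq_same]

theorem orbit_surjective (α β : 𝒱.Feas) : Function.Surjective (orbit α β) := by
  rw [← LinearMap.range_eq_top, eq_top_iff]
  rintro x -
  obtain ⟨f, rfl⟩ := Ideal.Quotient.mk_surjective x
  induction f using MvPolynomial.induction_on with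
  | C r =>
    refine ⟨r • taut α β, ?_⟩
    rw [map_smul, orbit_taut, ← map_one (Ideal.Quotient.mk _)]
    refine congrArg (Ideal.Quotient.mk _) (?_ : r • (1 : MvPolynomial I ℝ) = _)
    rw [MvPolynomial.smul_eq_C_mul, mul_one]
  | add f g hf hg => rw [map_add]; exact add_mem hf hg
  | mul_X f i hf =>
    obtain ⟨a, ha⟩ := hf
    refine ⟨a * 𝒱.tA (𝒱.t i), ?_⟩
    rw [orbit_mul_tA, ha]
    refine Ideal.Quotient.eq.2 ?_
    change _ * f - _ ∈ _
    rw [mul_comm f, ← sub_mul, ← neg_sub, neg_mul]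
    exact neg_mem (Ideal.mul_mem_right _ _ (X_sub_liftCovector_mem i _ _))

/-- The vectors `taut α γ * taut γ β` are independent for fixed `α` and `β`: their images span the
ring of leading forms, whose dimension is at least their number. -/
theorem linearIndependent_orbit (α : 𝒱.BFeas) (β : 𝒱.Feas) :
    LinearIndependent ℝ fun γ : {γ : 𝒱.BFeas // γ.Agree α.sign ∧ γ.Agree β.1} =>
      orbit α.toFeas β (taut α.toFeas γ.1.toFeas * taut γ.1.toFeas β) := by
  classical
  have : Fintype {γ : 𝒱.BFeas // γ.Agree α.sign ∧ γ.Agree β.1} := Fintype.ofFinite _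
  have hspan : ⊤ ≤ Submodule.span ℝ (Set.range
      fun γ : {γ : 𝒱.BFeas // γ.Agree α.sign ∧ γ.Agree β.1} =>
        orbit α.toFeas β (taut α.toFeas γ.1.toFeas * taut γ.1.toFeas β)) := by
    rintro x -
    obtain ⟨a, rfl⟩ := orbit_surjective α.toFeas β x
    rw [← orbit_eA_mul]
    have hle : tautSpan α.toFeas {γ | γ.Agree α.sign} ≤ (Submodule.span ℝ (Set.range
      fun γ : {γ : 𝒱.BFeas // γ.Agree α.sign ∧ γ.Agree β.1} =>
        orbit α.toFeas β (taut α.toFeas γ.1.toFeas * taut γ.1.toFeas β))).comap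
        (orbit α.toFeas β) := by
      refine Submodule.span_le.2 ?_
      rintro _ ⟨γ, hγ, β', hβ', rfl⟩
      by_cases h : β' = β
      · subst h
        exact Submodule.subset_span ⟨⟨γ, hγ, hβ'⟩, rfl⟩
      · rw [← taut_mul_eA γ.toFeas β', ← mul_assoc]
        simp only [SetLike.mem_coe, Submodule.mem_comap]
        rw [orbit_mul_eA_of_ne _ h]
        exact Submodule.zero_mem _
    exact hle (eA_mul_mem_tautSpan α a)
  have hfin : Module.Finite ℝ (𝒱.LeadingForms α.toFeas β) :=
    ⟨⟨(Set.finite_range _).toFinset, by rw [Set.Finite.coe_toFinset]; exact top_le_iff.1 hspan⟩⟩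
  refine linearIndependent_of_top_le_span_of_card_le_finrank hspan ?_
  have hY : commonVertices (𝒱 := 𝒱) α.sign β.1 =
      Set.range fun γ : {γ : 𝒱.BFeas // γ.Agree α.sign ∧ γ.Agree β.1} => γ.1.vertex.1 := by
    ext x
    simp only [commonVertices, Set.mem_range, Subtype.exists]
    refine ⟨?_, ?_⟩
    · rintro ⟨γ, h1, h2, rfl⟩; exact ⟨γ, ⟨h1, h2⟩, rfl⟩
    · rintro ⟨γ, ⟨h1, h2⟩, rfl⟩; exact ⟨γ, h1, h2, rfl⟩
  have hcard : Fintype.card {γ : 𝒱.BFeas // γ.Agree α.sign ∧ γ.Agree β.1} =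
      (commonVertices (𝒱 := 𝒱) α.sign β.1).ncard := by
    rw [hY, ← Set.image_univ, Set.ncard_image_of_injective _ fun γ γ' h => Subtype.ext
      (BFeas.vertex_injective (Subtype.ext h)), Set.ncard_univ, Nat.card_eq_fintype_card]
  rw [hcard]
  exact ncard_le_finrank_quotient_initialIdeal _ (by rw [hY]; exact Set.finite_range _)

theorem taut_mul_taut_notMem {α : 𝒱.BFeas} {γ : 𝒱.BFeas} {β : 𝒱.Feas} (hα : γ.Agree α.sign)
    (hβ : γ.Agree β.1) {U : Set 𝒱.BFeas} (hU : ∀ γ ∈ U, γ.Agree α.sign) (hγ : γ ∉ U) :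
    taut α.toFeas γ.toFeas * taut γ.toFeas β ∉ tautSpan α.toFeas U := by
  intro hmem
  have hli := linearIndependent_orbit α β
  refine hli.notMem_span_image (s := {x | x.1 ∈ U}) (x := ⟨γ, hα, hβ⟩) hγ ?_
  have hle : tautSpan α.toFeas U ≤ (Submodule.span ℝ
      ((fun γ : {γ : 𝒱.BFeas // γ.Agree α.sign ∧ γ.Agree β.1} =>
        orbit α.toFeas β (taut α.toFeas γ.1.toFeas * taut γ.1.toFeas β)) '' {x | x.1 ∈ U})).comap
        (orbit α.toFeas β) := by
    refine Submodule.span_le.2 ?_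
    rintro _ ⟨γ', hγ', β', hβ', rfl⟩
    by_cases h : β' = β
    · subst h
      exact Submodule.subset_span ⟨⟨γ', hU γ' hγ', hβ'⟩, hγ', rfl⟩
    · rw [← taut_mul_eA γ'.toFeas β', ← mul_assoc]
      simp only [SetLike.mem_coe, Submodule.mem_comap]
      rw [orbit_mul_eA_of_ne _ h]
      exact Submodule.zero_mem _
  exact hle hmem

end PolarizedArrangement

/-! ### Filtrations of modules -/

section Filtration

variable {R : Type v} [Ring R] {M : Type w} [AddCommGroup M] [Module R M] {J : Type*}
  {X : J → Type*} [∀ j, AddCommGroup (X j)] [∀ j, Module R (X j)] {s : Set J}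

/-- An injective homomorphism preserves subquotients. -/
theorem nonempty_quotient_map_equiv {M' : Type*} [AddCommGroup M'] [Module R M'] (g : M →ₗ[R] M')
    (hg : Function.Injective g) (A B : Submodule R M) :
    Nonempty ((B.map g ⧸ (A.map g).submoduleOf (B.map g)) ≃ₗ[R] B ⧸ A.submoduleOf B) := by
  refine ⟨(Submodule.Quotient.equiv _ _ (Submodule.equivMapOfInjective g hg B) ?_).symm⟩
  ext ⟨x, hx⟩
  simp only [Submodule.mem_map, Submodule.submoduleOf, Submodule.mem_comap, Submodule.subtype_apply]
  constructor
  · rintro ⟨y, hy, h⟩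
    exact ⟨y.1, hy, congrArg Subtype.val h⟩
  · rintro ⟨y, hy, rfl⟩
    obtain ⟨z, hz, hzy⟩ := hx
    obtain rfl := hg hzy
    exact ⟨⟨z, hz⟩, hy, rfl⟩

theorem HasFiltrationBy.of_subsingleton [Subsingleton M] : HasFiltrationBy R M X s :=
  ⟨0, fun _ => ⊥, rfl, Subsingleton.elim _ _, fun k hk => absurd hk (Nat.not_lt_zero k)⟩

theorem HasFiltrationBy.mono {s' : Set J} (h : HasFiltrationBy R M X s) (hs : s ⊆ s') :
    HasFiltrationBy R M X s' := by
  obtain ⟨n, F, h0, hn, hF⟩ := h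
  refine ⟨n, F, h0, hn, fun k hk => ⟨(hF k hk).1, ?_⟩⟩
  obtain ⟨j, hj, e⟩ := (hF k hk).2
  exact ⟨j, hs hj, e⟩

theorem HasFiltrationBy.congr {M' : Type*} [AddCommGroup M'] [Module R M']
    (h : HasFiltrationBy R M X s) (e : M ≃ₗ[R] M') : HasFiltrationBy R M' X s := by
  obtain ⟨n, F, h0, hn, hF⟩ := h
  refine ⟨n, fun k => (F k).map e.toLinearMap, ?_, ?_, fun k hk =>
    ⟨Submodule.map_mono (hF k hk).1, ?_⟩⟩
  · simp only [h0, Submodule.map_bot]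
  · simp only [hn, Submodule.map_top, LinearEquiv.range]
  · obtain ⟨j, hj, ⟨f⟩⟩ := (hF k hk).2
    obtain ⟨g⟩ := nonempty_quotient_map_equiv e.toLinearMap e.injective (F k) (F (k + 1))
    exact ⟨j, hj, ⟨g.trans f⟩⟩

theorem HasFiltrationBy.extend {N : Submodule R M} (h : HasFiltrationBy R N X s) {j : J}
    (hj : j ∈ s) (e : (M ⧸ N) ≃ₗ[R] X j) : HasFiltrationBy R M X s := by
  obtain ⟨n, F, h0, hn, hF⟩ := h
  have hNn : (F n).map N.subtype = N := by rw [hn, Submodule.map_top, Submodule.range_subtype]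
  obtain ⟨F', hF'⟩ : ∃ F' : ℕ → Submodule R M,
      ∀ k, F' k = if k ≤ n then (F k).map N.subtype else ⊤ := ⟨_, fun _ => rfl⟩
  refine ⟨n + 1, F', by simp [hF', h0], by simp [hF'], fun k hk => ?_⟩
  rw [hF' k, hF' (k + 1)]
  · rcases Nat.lt_or_ge k n with hk' | hk'
    · rw [if_pos hk'.le, if_pos (show k + 1 ≤ n from hk')]
      refine ⟨Submodule.map_mono (hF k hk').1, ?_⟩
      obtain ⟨j, hj, ⟨f⟩⟩ := (hF k hk').2
      obtain ⟨g⟩ := nonempty_quotient_map_equiv N.subtype N.injective_subtype (F k) (F (k + 1))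
      exact ⟨j, hj, ⟨g.trans f⟩⟩
    · obtain rfl : k = n := by omega
      rw [if_pos le_rfl, if_neg (by omega), hNn]
      refine ⟨le_top, j, hj, ⟨(Submodule.Quotient.equiv _ _ Submodule.topEquiv ?_).trans e⟩⟩
      ext x
      simp [Submodule.submoduleOf]

end Filtration

namespace PolarizedArrangement

variable {I : Type u} [Fintype I] {𝒱 : PolarizedArrangement I}

/-! ### Simple modules -/

instance : FiniteDimensional ℝ 𝒱.A := by
  let f : 𝒱.Feas × 𝒱.BFeas × 𝒱.Feas → 𝒱.A := fun x =>
    taut x.1 x.2.1.toFeas * taut x.2.1.toFeas x.2.2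
  have hf : (⊤ : Submodule ℝ 𝒱.A) = Submodule.span ℝ (Set.range f) := by
    refine le_antisymm (fun a _ => ?_) le_top
    rw [← one_mul a, ← sum_eA, Finset.sum_mul]
    refine Submodule.sum_mem _ fun α _ => ?_
    by_cases h : 𝒱.IsBoundedSign α.1
    · refine Submodule.span_mono ?_ (eA_mul_mem_tautSpan ⟨α.1, α.2, h⟩ a)
      rintro _ ⟨γ, -, β, -, rfl⟩
      exact ⟨⟨α, γ, β⟩, rfl⟩
    · rw [𝒱.eA_eq_zero α h, zero_mul]
      exact Submodule.zero_mem _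
  exact ⟨⟨(Set.finite_range f).toFinset, by rw [Set.Finite.coe_toFinset, hf]⟩⟩

theorem BFeas.toFeas_injective : Function.Injective (BFeas.toFeas (𝒱 := 𝒱)) := fun _ _ h =>
  BFeas.ext (congrArg (fun x : 𝒱.Feas => x.1) h)

/-- Data of the character `charA`. -/
def charData (α : 𝒱.BFeas) : LiftData 𝒱 ℝ ℝ where
  e β := if β = α.toFeas then 1 else 0
  p _ _ _ := 0
  t := 0
  c := AlgHom.id ℝ ℝ
  central _ _ := Commute.all _ _
  idem β := by split_ifs <;> simp
  orth β γ h := by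
    split_ifs with h1 h2
    · exact absurd (h1.trans h2.symm) h
    all_goals simp
  unit := by simp
  source _ _ _ := by simp
  target _ _ _ := by simp
  unbounded β h := if_neg (by rintro rfl; exact h α.bounded)
  square _ _ _ _ _ _ _ _ _ := by simp
  back _ _ _ _ _ _ := by simp

/-- The character of `A` with value `1` at `e_α` which kills the other idempotents, the arrows and
the covectors. -/
def charA (α : 𝒱.BFeas) : 𝒱.A →ₐ[ℝ] ℝ := (charData α).hom

theorem charA_eA_self (α : 𝒱.BFeas) : charA α (𝒱.eA α.toFeas) = 1 := by
  rw [charA, LiftData.hom_eA]; exact if_pos rfl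

theorem charA_eA_of_ne {α : 𝒱.BFeas} {β : 𝒱.Feas} (h : β ≠ α.toFeas) : charA α (𝒱.eA β) = 0 := by
  rw [charA, LiftData.hom_eA]; exact if_neg h

theorem eq_of_charA_ne_zero {α β : 𝒱.BFeas} (h : charA α (𝒱.eA β.toFeas) ≠ 0) : α = β := by
  by_contra hc
  exact h (charA_eA_of_ne fun h' => hc (BFeas.toFeas_injective h').symm)

theorem eA_mem_idealA {α : 𝒱.BFeas} {β : 𝒱.Feas} (h : β ≠ α.toFeas) : 𝒱.eA β ∈ 𝒱.idealA α := by
  by_cases hb : 𝒱.IsBoundedSign β.1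
  · exact Submodule.subset_span ⟨1, ⟨β.1, β.2, hb⟩, fun h' => h (h' ▸ rfl), (one_mul _).symm⟩
  · rw [𝒱.eA_eq_zero β hb]; exact Submodule.zero_mem _

theorem mul_eA_mem_idealA {α : 𝒱.BFeas} {β : 𝒱.Feas} (h : β ≠ α.toFeas) (a : 𝒱.A) :
    a * 𝒱.eA β ∈ 𝒱.idealA α := by
  by_cases hb : 𝒱.IsBoundedSign β.1
  · exact Submodule.subset_span ⟨a, ⟨β.1, β.2, hb⟩, fun h' => h (h' ▸ rfl), rfl⟩
  · rw [𝒱.eA_eq_zero β hb, mul_zero]; exact Submodule.zero_mem _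

theorem charA_of_mem_idealA {α : 𝒱.BFeas} {x : 𝒱.A} (hx : x ∈ 𝒱.idealA α) : charA α x = 0 := by
  unfold idealA at hx
  induction hx using Submodule.span_induction with
  | mem x hx =>
    obtain ⟨a, β, hβ, rfl⟩ := hx
    rw [map_mul, charA_eA_of_ne fun h => hβ (BFeas.toFeas_injective h), mul_zero]
  | zero => exact map_zero _
  | add x y _ _ hx hy => rw [map_add, hx, hy, add_zero]
  | smul c x _ hx => rw [MulOpposite.smul_eq_mul_unop, map_mul, hx, zero_mul]

theorem sub_charA_mem_idealA (α : 𝒱.BFeas) (a : 𝒱.A) :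
    a - charA α a • (1 : 𝒱.A) ∈ 𝒱.idealA α := by
  set W : Submodule ℝ 𝒱.A := Submodule.span ℝ {1} ⊔ (𝒱.idealA α).restrictScalars ℝ with hW
  have hI : ∀ x ∈ 𝒱.idealA α, x ∈ W := fun x hx => (le_sup_right : _ ≤ W) hx
  have h1 : (1 : 𝒱.A) ∈ W := (le_sup_left : _ ≤ W) (Submodule.mem_span_singleton_self _)
  have heα : 𝒱.eA α.toFeas - 1 ∈ 𝒱.idealA α := by
    rw [← sum_eA, ← Finset.add_sum_erase _ _ (Finset.mem_univ α.toFeas), sub_add_cancel_left]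
    exact neg_mem (Submodule.sum_mem _ fun β hβ => eA_mem_idealA (Finset.ne_of_mem_erase hβ))
  have red : ∀ y ∈ W, ∀ x ∈ W, x * y ∈ W := by
    intro y hy x hx
    have : W ≤ W.comap (LinearMap.mulRight ℝ y) := by
      refine sup_le ((Submodule.span_singleton_le_iff_mem _ _).2 ?_)
        fun x hx => hI _ (mul_mem_right hx y)
      simpa using hy
    exact this hx
  have ha : a ∈ W := by
    rw [← one_mul a]
    refine mul_mem_of_generators W (fun x hx β => red _ ?_ x hx)
      (fun x hx β γ h => red _ (hI _ ?_) x hx) (fun x hx w => red _ (hI _ ?_) x hx) h1 a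
    · by_cases h : β = α.toFeas
      · rw [h, ← sub_add_cancel (𝒱.eA α.toFeas) 1]
        exact add_mem (hI _ heα) h1
      · exact hI _ (eA_mem_idealA h)
    · by_cases hγ : γ = α.toFeas
      · have hβ : β ≠ α.toFeas := by
          rintro rfl
          obtain ⟨i, hi⟩ := h
          exact hi.ne (by rw [hγ])
        rw [← eA_mul_pA]
        exact mul_mem_right (eA_mem_idealA hβ) _
      · rw [← pA_mul_eA]
        exact mul_eA_mem_idealA hγ _
    · have h2 := 𝒱.K_le_idealA α (tA_mul_eA_mem_K α w)
      have h3 : 𝒱.tA w = 𝒱.tA w * 𝒱.eA α.toFeas - (𝒱.eA α.toFeas - 1) * 𝒱.tA w := by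
        rw [tA_commute, sub_mul, one_mul, sub_sub_cancel]
      rw [h3]
      exact sub_mem h2 (mul_mem_right heα _)
  obtain ⟨x, hx, y, hy, rfl⟩ := Submodule.mem_sup.1 ha
  obtain ⟨r, rfl⟩ := Submodule.mem_span_singleton.1 hx
  have : charA α (r • 1 + y) = r := by
    rw [map_add, charA_of_mem_idealA hy, map_smul, map_one, smul_eq_mul, mul_one, add_zero]
  rw [this, add_sub_cancel_left]
  exact hy

theorem mem_idealA_iff {α : 𝒱.BFeas} {x : 𝒱.A} : x ∈ 𝒱.idealA α ↔ charA α x = 0 :=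
  ⟨charA_of_mem_idealA, fun h => by simpa [h] using sub_charA_mem_idealA α x⟩

theorem isCoatom_idealA (α : 𝒱.BFeas) : IsCoatom (𝒱.idealA α) := by
  refine ⟨fun h => ?_, fun N hN => ?_⟩
  · have : (1 : 𝒱.A) ∈ 𝒱.idealA α := h ▸ Submodule.mem_top
    rw [mem_idealA_iff, map_one] at this
    exact one_ne_zero this
  · obtain ⟨hle, x, hx, hx'⟩ := SetLike.lt_iff_le_and_exists.1 hN
    rw [mem_idealA_iff] at hx'
    have h1 : charA α x • (1 : 𝒱.A) ∈ N := by
      have := N.sub_mem hx (hle (sub_charA_mem_idealA α x))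
      rwa [sub_sub_cancel] at this
    have h2 : (1 : 𝒱.A) ∈ N := by
      have := (N.restrictScalars ℝ).smul_mem (charA α x)⁻¹ h1
      rwa [smul_smul, inv_mul_cancel₀ hx', one_smul] at this
    rw [eq_top_iff]
    intro a _
    simpa using mul_mem_right h2 a

instance isSimpleModule_L (α : 𝒱.BFeas) : IsSimpleModule 𝒱.Aᵐᵒᵖ (𝒱.L α) :=
  isSimpleModule_iff_isCoatom.2 (isCoatom_idealA α)

theorem smul_L (α : 𝒱.BFeas) (a : 𝒱.A) (y : 𝒱.L α) :
    MulOpposite.op a • y = charA α a • y := by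
  obtain ⟨x, rfl⟩ := Submodule.mkQ_surjective _ y
  rw [← map_smul]
  change Submodule.Quotient.mk _ = Submodule.Quotient.mk (charA α a • x)
  rw [Submodule.Quotient.eq, mem_idealA_iff, op_smul_eq_mul, map_sub, map_mul, map_smul,
    smul_eq_mul, mul_comm, sub_self]

theorem mk_one_ne_zero (α : 𝒱.BFeas) : (𝒱.idealA α).mkQ 1 ≠ 0 := by
  rw [Submodule.mkQ_apply, Ne, Submodule.Quotient.mk_eq_zero, mem_idealA_iff, map_one]
  exact one_ne_zero

theorem eq_of_equiv_L {α β : 𝒱.BFeas} (f : 𝒱.L α ≃ₗ[𝒱.Aᵐᵒᵖ] 𝒱.L β) : α = β := by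
  have h1 : MulOpposite.op (𝒱.eA α.toFeas) • f ((𝒱.idealA α).mkQ 1) = f ((𝒱.idealA α).mkQ 1) := by
    rw [← map_smul, smul_L, charA_eA_self, one_smul]
  refine (eq_of_charA_ne_zero (α := β) (β := α) fun h => ?_).symm
  rw [smul_L, h, zero_smul] at h1
  exact mk_one_ne_zero α (f.map_eq_zero_iff.1 h1.symm)

theorem mem_P_iff {α : 𝒱.BFeas} {x : 𝒱.A} : x ∈ 𝒱.P α ↔ 𝒱.eA α.toFeas * x = x := by
  refine ⟨fun hx => ?_, fun hx => ?_⟩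
  · have : 𝒱.P α ≤ LinearMap.eqLocus (lmul (𝒱.eA α.toFeas)) LinearMap.id :=
      (Submodule.span_singleton_le_iff_mem _ _).2 (eA_mul_self _)
    exact this hx
  · rw [← hx]
    exact mul_mem_right (Submodule.mem_span_singleton_self _) x

theorem eA_mul_mem_P (α : 𝒱.BFeas) (a : 𝒱.A) : 𝒱.eA α.toFeas * a ∈ 𝒱.P α := by
  rw [mem_P_iff, ← mul_assoc, eA_mul_self]

theorem K_le_P (α : 𝒱.BFeas) : 𝒱.K α ≤ 𝒱.P α := by
  refine Submodule.span_le.2 ?_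
  rintro _ ⟨b, i, β, h, -, -, -, rfl⟩
  exact mem_P_iff.2 (𝒱.eA_mul_pA _ _ _)

/-- The standard module `V_γ` vanishes at `e_β` unless `β` lies in the cone of `γ`. -/
theorem mul_eA_mem_K {γ : 𝒱.BFeas} {β : 𝒱.Feas} (h : ¬ γ.Agree β.1) (a : 𝒱.A) :
    𝒱.eA γ.toFeas * a * 𝒱.eA β ∈ 𝒱.K γ := by
  have hle : Submodule.span ℝ {x | ∃ β : 𝒱.Feas, γ.Agree β.1 ∧ x = taut γ.toFeas β} ⊔
      (𝒱.K γ).restrictScalars ℝ ≤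
      ((𝒱.K γ).restrictScalars ℝ).comap (LinearMap.mulRight ℝ (𝒱.eA β)) := by
    refine sup_le (Submodule.span_le.2 ?_) fun x hx => mul_mem_right hx _
    rintro _ ⟨δ, hδ, rfl⟩
    show taut γ.toFeas δ * 𝒱.eA β ∈ 𝒱.K γ
    rw [taut_mul_eA_of_ne _ (by rintro rfl; exact h hδ)]
    exact Submodule.zero_mem _
  exact hle (eA_mul_mem_span_sup_K γ a)

/-- The standard module `V_γ` is one-dimensional at `e_γ`. -/
theorem eA_mul_mul_eA_sub_mem_K (γ : 𝒱.BFeas) (a : 𝒱.A) :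
    𝒱.eA γ.toFeas * a * 𝒱.eA γ.toFeas - charA γ a • 𝒱.eA γ.toFeas ∈ 𝒱.K γ := by
  have hle : Submodule.span ℝ {x | ∃ β : 𝒱.Feas, γ.Agree β.1 ∧ x = taut γ.toFeas β} ⊔
      (𝒱.K γ).restrictScalars ℝ ≤
      (Submodule.span ℝ {𝒱.eA γ.toFeas} ⊔ (𝒱.K γ).restrictScalars ℝ).comap
        (LinearMap.mulRight ℝ (𝒱.eA γ.toFeas)) := by
    refine sup_le (Submodule.span_le.2 ?_) fun x hx => Submodule.mem_sup_right (mul_mem_right hx _)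
    rintro _ ⟨δ, hδ, rfl⟩
    show taut γ.toFeas δ * 𝒱.eA γ.toFeas ∈ Submodule.span ℝ {𝒱.eA γ.toFeas} ⊔
      (𝒱.K γ).restrictScalars ℝ
    by_cases h : δ = γ.toFeas
    · rw [h, taut_self, eA_mul_self]
      exact Submodule.mem_sup_left (Submodule.mem_span_singleton_self _)
    · rw [taut_mul_eA_of_ne _ h]
      exact Submodule.zero_mem _
  obtain ⟨x, hx, k, hk, h⟩ := Submodule.mem_sup.1 (hle (eA_mul_mem_span_sup_K γ a))
  obtain ⟨r, rfl⟩ := Submodule.mem_span_singleton.1 hx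
  rw [LinearMap.mulRight_apply] at h
  have hr : charA γ a = r := by
    have := congrArg (charA γ) h
    rw [map_add, map_smul, charA_eA_self, charA_of_mem_idealA (𝒱.K_le_idealA γ hk), map_mul,
      map_mul,
      charA_eA_self] at this
    simpa using this.symm
  rw [hr, ← h, add_sub_cancel_left]
  exact hk

section SimpleModules

variable {S : Type*} [AddCommGroup S] [Module 𝒱.Aᵐᵒᵖ S]

/-- The homomorphism from `A` to a right module determined by an element. -/
def fromA (x : S) : 𝒱.A →ₗ[𝒱.Aᵐᵒᵖ] S where
  toFun a := MulOpposite.op a • x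
  map_add' a b := by rw [MulOpposite.op_add, add_smul]
  map_smul' c a := by
    rw [RingHom.id_apply, smul_smul, MulOpposite.smul_eq_mul_unop, MulOpposite.op_mul,
      MulOpposite.op_unop]

theorem fromA_apply (x : S) (a : 𝒱.A) : fromA x a = MulOpposite.op a • x := rfl

theorem op_mul_smul (a b : 𝒱.A) (x : S) :
    MulOpposite.op (a * b) • x = MulOpposite.op b • MulOpposite.op a • x := by
  rw [MulOpposite.op_mul, mul_smul]

theorem exists_eA_smul_ne_zero {x : S} (hx : x ≠ 0) :
    ∃ α : 𝒱.BFeas, MulOpposite.op (𝒱.eA α.toFeas) • x ≠ 0 := by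
  by_contra! hc
  refine hx ?_
  rw [← one_smul 𝒱.Aᵐᵒᵖ x, ← MulOpposite.op_one, ← sum_eA, Finset.op_sum, Finset.sum_smul]
  refine Finset.sum_eq_zero fun β _ => ?_
  by_cases h : 𝒱.IsBoundedSign β.1
  · exact hc ⟨β.1, β.2, h⟩
  · rw [𝒱.eA_eq_zero β h, MulOpposite.op_zero, zero_smul]

/-- Every simple module is one of the `L_γ`: for `γ` maximal with `S e_γ ≠ 0`, the module `S` is a
quotient of `V_γ`, and `V_γ` has a unique maximal submodule, as it is generated by its
one-dimensional part at `e_γ`. -/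
theorem exists_equiv_L [IsSimpleModule 𝒱.Aᵐᵒᵖ S] :
    ∃ γ : 𝒱.BFeas, Nonempty (S ≃ₗ[𝒱.Aᵐᵒᵖ] 𝒱.L γ) := by
  obtain ⟨s, hs⟩ := (have := IsSimpleModule.nontrivial 𝒱.Aᵐᵒᵖ S; exists_ne (0 : S))
  obtain ⟨γ₀, hγ₀⟩ := exists_eA_smul_ne_zero (𝒱 := 𝒱) hs
  obtain ⟨γ, -, ⟨⟨x₀, hx₀⟩, hmax⟩⟩ := Set.Finite.exists_le_maximal
    (s := {γ : 𝒱.BFeas | ∃ x : S, MulOpposite.op (𝒱.eA γ.toFeas) • x ≠ 0}) (Set.toFinite _)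
    (a := γ₀) ⟨s, hγ₀⟩
  set x := MulOpposite.op (𝒱.eA γ.toFeas) • x₀ with hx
  have hxe : MulOpposite.op (𝒱.eA γ.toFeas) • x = x := by rw [hx, ← op_mul_smul, eA_mul_self]
  have hK : 𝒱.K γ ≤ LinearMap.ker (fromA (𝒱 := 𝒱) x) := by
    refine Submodule.span_le.2 ?_
    rintro _ ⟨b, i, β, h, hb, hi, hβ, rfl⟩
    rw [γ.isMu_iff] at hb
    subst hb
    show MulOpposite.op (𝒱.pA γ.toFeas β h) • x = 0
    by_contra hne
    rw [← pA_mul_eA, op_mul_smul] at hne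
    have hbd : 𝒱.IsBoundedSign β.1 := by
      by_contra hbd
      rw [𝒱.eA_eq_zero β hbd, MulOpposite.op_zero, zero_smul] at hne
      exact hne rfl
    have hlt : γ < ⟨β.1, β.2, hbd⟩ := BFeas.lt_flip hi hβ
    exact absurd (hmax (y := ⟨β.1, β.2, hbd⟩) ⟨_, hne⟩ hlt.le) (not_le_of_gt hlt)
  have hbot : (𝒱.idealA γ).map (fromA x) = ⊥ := by
    refine (eq_bot_or_eq_top _).resolve_right fun htop => hx₀ ?_
    obtain ⟨k, hk, hkx⟩ : x ∈ (𝒱.idealA γ).map (fromA x) := htop ▸ Submodule.mem_top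
    have h1 : fromA x (𝒱.eA γ.toFeas * k * 𝒱.eA γ.toFeas) = x := by
      rw [fromA_apply] at hkx ⊢
      rw [op_mul_smul, op_mul_smul, hxe, hkx, hxe]
    have h2 := hK (eA_mul_mul_eA_sub_mem_K γ k)
    rw [mem_idealA_iff.1 hk, zero_smul, sub_zero, LinearMap.mem_ker, h1] at h2
    exact h2
  have hle : 𝒱.idealA γ ≤ LinearMap.ker (fromA x) := LinearMap.le_ker_iff_map.2 hbot
  have hker : LinearMap.ker (fromA x) = 𝒱.idealA γ := by
    refine ((isCoatom_idealA γ).le_iff.1 hle).resolve_left fun h => hx₀ ?_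
    have : (1 : 𝒱.A) ∈ LinearMap.ker (fromA x) := h ▸ Submodule.mem_top
    rwa [LinearMap.mem_ker, fromA_apply, MulOpposite.op_one, one_smul] at this
  have hsurj : LinearMap.range (fromA (𝒱 := 𝒱) x) = ⊤ := by
    refine (eq_bot_or_eq_top _).resolve_left fun h => hx₀ ?_
    have : fromA x (1 : 𝒱.A) ∈ LinearMap.range (fromA (𝒱 := 𝒱) x) := ⟨1, rfl⟩
    rw [h, Submodule.mem_bot, fromA_apply, MulOpposite.op_one, one_smul] at this
    exact this
  exact ⟨γ, ⟨((Submodule.quotEquivOfEq _ _ hker.symm).trans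
    ((fromA x).quotKerEquivOfSurjective (LinearMap.range_eq_top.1 hsurj))).symm⟩⟩

end SimpleModules

/-! ### Filtrations of standard and projective modules -/

/-- A module of finite length is filtered by the simple modules `L_β` for the `β` at which it does
not vanish. -/
theorem hasFiltrationBy_L {M : Type u} [AddCommGroup M] [Module 𝒱.Aᵐᵒᵖ M]
    (hM : IsFiniteLength 𝒱.Aᵐᵒᵖ M) (s : Set 𝒱.BFeas)
    (h : ∀ β ∉ s, ∀ m : M, MulOpposite.op (𝒱.eA β.toFeas) • m = 0) :
    HasFiltrationBy 𝒱.Aᵐᵒᵖ M 𝒱.L s := by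
  induction hM with
  | of_subsingleton => exact .of_subsingleton
  | @of_simple_quotient M _ _ N _ _ ih =>
    obtain ⟨β, ⟨e⟩⟩ := exists_equiv_L (𝒱 := 𝒱) (S := M ⧸ N)
    refine HasFiltrationBy.extend (ih fun β hβ m => Subtype.ext (h β hβ m.1)) (j := β) ?_ e
    by_contra hβ
    obtain ⟨m, hm⟩ := N.mkQ_surjective (e.symm ((𝒱.idealA β).mkQ 1))
    have h2 : MulOpposite.op (𝒱.eA β.toFeas) • e (N.mkQ m) = 0 := by
      rw [← map_smul, ← map_smul, h β hβ m, map_zero, map_zero]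
    rw [hm, e.apply_symm_apply, smul_L, charA_eA_self, one_smul] at h2
    exact mk_one_ne_zero β h2

theorem isFiniteLength_of_finiteDimensional (M : Type*) [AddCommGroup M] [Module 𝒱.Aᵐᵒᵖ M]
    [Module ℝ M] [IsScalarTower ℝ 𝒱.Aᵐᵒᵖ M] [FiniteDimensional ℝ M] : IsFiniteLength 𝒱.Aᵐᵒᵖ M :=
  isFiniteLength_iff_isNoetherian_isArtinian.2
    ⟨isNoetherian_of_tower ℝ inferInstance, isArtinian_of_tower ℝ inferInstance⟩

theorem projSimple_mk (α : 𝒱.BFeas) (x : 𝒱.P α) :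
    𝒱.projSimple α (𝒱.projStd α x) = (𝒱.idealA α).mkQ x.1 := rfl

theorem projStd_surjective (α : 𝒱.BFeas) : Function.Surjective (𝒱.projStd α) :=
  Submodule.mkQ_surjective _

theorem projStd_eq_zero {α : 𝒱.BFeas} {x : 𝒱.P α} : 𝒱.projStd α x = 0 ↔ x.1 ∈ 𝒱.K α := by
  rw [projStd, Submodule.mkQ_apply, Submodule.Quotient.mk_eq_zero]
  rfl

theorem ker_projSimple_hasFiltrationBy (α : 𝒱.BFeas) :
    HasFiltrationBy 𝒱.Aᵐᵒᵖ (LinearMap.ker (𝒱.projSimple α)) 𝒱.L {β | β < α} := by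
  refine hasFiltrationBy_L ?_ _ ?_
  · have : IsFiniteLength 𝒱.Aᵐᵒᵖ 𝒱.A := isFiniteLength_of_finiteDimensional _
    rw [isFiniteLength_iff_isNoetherian_isArtinian] at this ⊢
    obtain ⟨_, _⟩ := this
    exact ⟨inferInstance, inferInstance⟩
  · rintro β hβ ⟨m, hm⟩
    refine Subtype.ext ?_
    obtain ⟨x, rfl⟩ := projStd_surjective α m
    show MulOpposite.op (𝒱.eA β.toFeas) • 𝒱.projStd α x = 0
    rw [← map_smul, projStd_eq_zero]
    show x.1 * 𝒱.eA β.toFeas ∈ 𝒱.K α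
    rw [← mem_P_iff.1 x.2]
    by_cases hA : α.Agree β.sign
    · have hβα : β = α := by
        by_contra hne
        exact hβ (lt_of_le_of_ne hA.le hne)
      subst hβα
      have h0 : charA β x.1 = 0 := by
        rw [LinearMap.mem_ker, projSimple_mk, Submodule.mkQ_apply,
          Submodule.Quotient.mk_eq_zero, mem_idealA_iff] at hm
        exact hm
      have := eA_mul_mul_eA_sub_mem_K β x.1
      rwa [h0, zero_smul, sub_zero] at this
    · exact mul_eA_mem_K hA _

theorem tautSpan_mul_eA_mem {α : 𝒱.Feas} {U : Set 𝒱.BFeas} {x : 𝒱.A} (hx : x ∈ tautSpan α U)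
    (β : 𝒱.Feas) : x * 𝒱.eA β ∈ tautSpan α U := by
  have : tautSpan α U ≤ (tautSpan α U).comap (LinearMap.mulRight ℝ (𝒱.eA β)) := by
    refine Submodule.span_le.2 ?_
    rintro _ ⟨γ, hγ, δ, hδ, rfl⟩
    show taut α γ.toFeas * taut γ.toFeas δ * 𝒱.eA β ∈ tautSpan α U
    by_cases h : δ = β
    · subst h
      rw [mul_assoc, taut_mul_eA]
      exact Submodule.subset_span ⟨γ, hγ, δ, hδ, rfl⟩
    · rw [mul_assoc, taut_mul_eA_of_ne _ h, mul_zero]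
      exact Submodule.zero_mem _
  exact this hx

/-- The homomorphism `V_γ → P_α` modulo higher terms given by a taut path `α → γ` is injective. -/
theorem mem_K_of_taut_mul_mem {α γ : 𝒱.BFeas} (hα : γ.Agree α.sign) {U : Set 𝒱.BFeas}
    (hU : ∀ γ ∈ U, γ.Agree α.sign) (hup : ∀ γ' ∈ U, ∀ δ, γ' < δ → δ.Agree α.sign → δ ∈ U)
    (hgt : ∀ δ, γ < δ → δ.Agree α.sign → δ ∈ U) (hγ : γ ∉ U) {x : 𝒱.A}
    (hx : x ∈ 𝒱.P γ) (hm : taut α.toFeas γ.toFeas * x ∈ tautIdeal α.toFeas U) : x ∈ 𝒱.K γ := by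
  have h1 := eA_mul_mem_span_sup_K γ x
  rw [mem_P_iff.1 hx] at h1
  obtain ⟨y, hy, k, hk, rfl⟩ := Submodule.mem_sup.1 h1
  have hk' : taut α.toFeas γ.toFeas * k ∈ tautIdeal α.toFeas U := by
    refine SetLike.le_def.1 (tautIdeal_mono _ ?_) (taut_mul_mem_tautIdeal_gt (α := α.toFeas) hα hk)
    exact fun δ hδ => hgt δ hδ.2 hδ.1
  have hy' : taut α.toFeas γ.toFeas * y ∈ tautSpan α.toFeas U := by
    rw [← tautIdeal_eq_tautSpan (α := α.toFeas) hU hup]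
    have := Submodule.sub_mem _ hm hk'
    rwa [mul_add, add_sub_cancel_right] at this
  have hcomp : ∀ β : 𝒱.Feas, ∃ c : ℝ, y * 𝒱.eA β = c • taut γ.toFeas β ∧
      (¬ γ.Agree β.1 → c = 0) := by
    intro β
    clear hy' hm h1 hx
    induction hy using Submodule.span_induction with
    | mem y hy =>
      obtain ⟨δ, hδ, rfl⟩ := hy
      by_cases h : δ = β
      · subst h
        exact ⟨1, by rw [taut_mul_eA, one_smul], fun h => absurd hδ h⟩
      · exact ⟨0, by rw [taut_mul_eA_of_ne _ h, zero_smul], fun _ => rfl⟩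
    | zero => exact ⟨0, by rw [zero_mul, zero_smul], fun _ => rfl⟩
    | add y z _ _ hy hz =>
      obtain ⟨c, hc, hc'⟩ := hy
      obtain ⟨d, hd, hd'⟩ := hz
      exact ⟨c + d, by rw [add_mul, hc, hd, add_smul], fun h => by rw [hc' h, hd' h, add_zero]⟩
    | smul r y _ hy =>
      obtain ⟨c, hc, hc'⟩ := hy
      exact ⟨r * c, by rw [smul_mul_assoc, hc, smul_smul], fun h => by rw [hc' h, mul_zero]⟩
  have hy0 : y = 0 := by
    rw [← mul_one y, ← sum_eA, Finset.mul_sum]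
    refine Finset.sum_eq_zero fun β _ => ?_
    obtain ⟨c, hc, hc'⟩ := hcomp β
    suffices c = 0 by rw [hc, this, zero_smul]
    by_contra hc0
    have hβ : γ.Agree β.1 := not_not.1 fun h => hc0 (hc' h)
    refine taut_mul_taut_notMem hα hβ hU hγ ?_
    have := (tautSpan α.toFeas U).smul_mem c⁻¹ (tautSpan_mul_eA_mem hy' β)
    rwa [mul_assoc, hc, mul_smul_comm, smul_smul, inv_mul_cancel₀ hc0, one_smul] at this
  rw [hy0, zero_add]
  exact hk

/-- The quotient of consecutive ideals generated by taut paths from `α` is a standard module. -/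
theorem nonempty_tautIdeal_quotient_equiv {α γ : 𝒱.BFeas} {U : Set 𝒱.BFeas}
    (hU : ∀ γ ∈ U, γ.Agree α.sign) (hup : ∀ γ' ∈ U, ∀ δ, γ' < δ → δ.Agree α.sign → δ ∈ U)
    (hγ : γ ∈ U) (hup' : ∀ γ' ∈ U \ {γ}, ∀ δ, γ' < δ → δ.Agree α.sign → δ ∈ U \ {γ}) :
    Nonempty ((tautIdeal α.toFeas U ⧸
      (tautIdeal α.toFeas (U \ {γ})).submoduleOf (tautIdeal α.toFeas U)) ≃ₗ[𝒱.Aᵐᵒᵖ] 𝒱.Std γ) := by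
  have hmem : ∀ x, taut α.toFeas γ.toFeas * x ∈ tautIdeal α.toFeas U := fun x =>
    mul_mem_right (taut_mem_tautIdeal _ hγ) x
  let f : 𝒱.P γ →ₗ[𝒱.Aᵐᵒᵖ] tautIdeal α.toFeas U ⧸
      (tautIdeal α.toFeas (U \ {γ})).submoduleOf (tautIdeal α.toFeas U) :=
    Submodule.mkQ _ ∘ₗ ((lmul (taut α.toFeas γ.toFeas)).codRestrict _ hmem) ∘ₗ (𝒱.P γ).subtype
  have hf0 : ∀ x, f x = 0 ↔ taut α.toFeas γ.toFeas * x.1 ∈ tautIdeal α.toFeas (U \ {γ}) := fun x =>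
    Submodule.Quotient.mk_eq_zero _
  have hker : LinearMap.ker f = (𝒱.K γ).submoduleOf (𝒱.P γ) := by
    ext x
    rw [LinearMap.mem_ker, hf0]
    refine ⟨fun h => ?_, fun h => ?_⟩
    · refine mem_K_of_taut_mul_mem (hU γ hγ) (fun δ hδ => hU δ hδ.1) hup' (fun δ hδ hδ' => ?_)
        (by simp) x.2 h
      exact ⟨hup γ hγ δ hδ hδ', hδ.ne'⟩
    · refine SetLike.le_def.1 (tautIdeal_mono _ ?_)
        (taut_mul_mem_tautIdeal_gt (α := α.toFeas) (hU γ hγ) h)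
      exact fun δ hδ => ⟨hup γ hγ δ hδ.2 hδ.1, hδ.2.ne'⟩
  have hsurj : Function.Surjective f := by
    intro z
    obtain ⟨⟨m, hm⟩, rfl⟩ := Submodule.mkQ_surjective _ z
    have hle : tautIdeal α.toFeas U ≤ LinearMap.range (lmul (taut α.toFeas γ.toFeas)) ⊔
        tautIdeal α.toFeas (U \ {γ}) := by
      refine Submodule.span_le.2 ?_
      rintro _ ⟨δ, hδ, rfl⟩
      by_cases h : δ = γ
      · subst h
        exact Submodule.mem_sup_left ⟨1, mul_one _⟩
      · exact Submodule.mem_sup_right (taut_mem_tautIdeal _ ⟨hδ, h⟩)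
    obtain ⟨_, ⟨a, rfl⟩, n, hn, hmn⟩ := Submodule.mem_sup.1 (hle hm)
    refine ⟨⟨𝒱.eA γ.toFeas * a, eA_mul_mem_P γ a⟩, ?_⟩
    refine (Submodule.Quotient.eq _).2 ?_
    show taut α.toFeas γ.toFeas * (𝒱.eA γ.toFeas * a) - m ∈ tautIdeal α.toFeas (U \ {γ})
    rw [← mul_assoc, taut_mul_eA, ← hmn, lmul_apply, sub_add_cancel_left]
    exact neg_mem hn
  exact ⟨((Submodule.quotEquivOfEq _ _ hker.symm).trans
    (f.quotKerEquivOfSurjective hsurj)).symm⟩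

/-- The filtration is obtained by removing minimal elements from `U` one by one. -/
theorem tautIdeal_hasFiltrationBy {α : 𝒱.BFeas} {U : Set 𝒱.BFeas}
    (hU : ∀ γ ∈ U, γ.Agree α.sign) (hup : ∀ γ' ∈ U, ∀ δ, γ' < δ → δ.Agree α.sign → δ ∈ U) :
    HasFiltrationBy 𝒱.Aᵐᵒᵖ (tautIdeal α.toFeas U) 𝒱.Std U := by
  induction hn : U.ncard using Nat.strong_induction_on generalizing U with
  | _ n ih =>
  rcases U.eq_empty_or_nonempty with rfl | hne
  · have : tautIdeal α.toFeas ∅ = ⊥ := by simp [tautIdeal]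
    rw [this]
    exact .of_subsingleton
  obtain ⟨γ, hγ, hmin⟩ := (Set.toFinite U).exists_minimal hne
  have hup' : ∀ γ' ∈ U \ {γ}, ∀ δ, γ' < δ → δ.Agree α.sign → δ ∈ U \ {γ} := by
    rintro γ' ⟨hγ', -⟩ δ hδ hδα
    refine ⟨hup γ' hγ' δ hδ hδα, ?_⟩
    rintro rfl
    exact absurd (hmin hγ' hδ.le) (not_le_of_gt hδ)
  have h1 := ih _ (hn ▸ Set.ncard_sdiff_singleton_lt_of_mem hγ) (fun δ hδ => hU δ hδ.1) hup' rfl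
  obtain ⟨e⟩ := nonempty_tautIdeal_quotient_equiv hU hup hγ hup'
  exact HasFiltrationBy.extend ((h1.mono Set.sdiff_subset).congr
    (Submodule.submoduleOfEquivOfLe (tautIdeal_mono _ Set.sdiff_subset)).symm) hγ e

theorem ker_projStd_hasFiltrationBy (α : 𝒱.BFeas) :
    HasFiltrationBy 𝒱.Aᵐᵒᵖ (LinearMap.ker (𝒱.projStd α)) 𝒱.Std {γ | γ > α} := by
  have h1 : HasFiltrationBy 𝒱.Aᵐᵒᵖ (𝒱.K α) 𝒱.Std {γ | γ.Agree α.sign ∧ γ ≠ α} := by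
    rw [K_eq_tautIdeal]
    exact tautIdeal_hasFiltrationBy (fun γ h => h.1) fun γ hγ δ hδ hδα =>
      ⟨hδα, (lt_of_le_of_lt hγ.1.le hδ).ne'⟩
  have h2 : LinearMap.ker (𝒱.projStd α) = (𝒱.K α).submoduleOf (𝒱.P α) := Submodule.ker_mkQ _
  rw [h2]
  refine (h1.congr (Submodule.submoduleOfEquivOfLe (K_le_P α)).symm).mono ?_
  exact fun γ hγ => lt_of_le_of_ne hγ.1.le hγ.2.symm

/-! ### Projective covers -/

/-- The generator `e_α` of `P_α`. -/
def genP (α : 𝒱.BFeas) : 𝒱.P α := ⟨𝒱.eA α.toFeas, mem_P_iff.2 (eA_mul_self _)⟩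

theorem op_smul_genP {α : 𝒱.BFeas} (x : 𝒱.P α) : MulOpposite.op x.1 • genP α = x :=
  Subtype.ext (mem_P_iff.1 x.2)

instance projective_P (α : 𝒱.BFeas) : Module.Projective 𝒱.Aᵐᵒᵖ (𝒱.P α) := by
  let i : 𝒱.P α →ₗ[𝒱.Aᵐᵒᵖ] 𝒱.Aᵐᵒᵖ :=
    { toFun := fun x => MulOpposite.op x.1
      map_add' := fun x y => rfl
      map_smul' := fun c x => by
        change MulOpposite.op (x.1 * c.unop) = c * MulOpposite.op x.1
        rw [MulOpposite.op_mul, MulOpposite.op_unop] }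
  exact Module.Projective.of_split i (LinearMap.toSpanSingleton 𝒱.Aᵐᵒᵖ _ (genP α))
    (LinearMap.ext fun x => op_smul_genP x)

instance finite_P (α : 𝒱.BFeas) : Module.Finite 𝒱.Aᵐᵒᵖ (𝒱.P α) :=
  Module.Finite.iff_fg.2 (Submodule.fg_span_singleton _)

theorem projSimple_surjective (α : 𝒱.BFeas) : Function.Surjective (𝒱.projSimple α) := by
  intro y
  obtain ⟨x, rfl⟩ := Submodule.mkQ_surjective _ y
  refine ⟨𝒱.projStd α ⟨𝒱.eA α.toFeas * x, eA_mul_mem_P α x⟩, ?_⟩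
  rw [projSimple_mk]
  refine (Submodule.Quotient.eq _).2 (mem_idealA_iff.2 ?_)
  rw [map_sub, map_mul, charA_eA_self, one_mul, sub_self]

theorem charA_eq_zero_of_mem_ker {α : 𝒱.BFeas} {x : 𝒱.P α}
    (hx : 𝒱.projSimple α (𝒱.projStd α x) = 0) : charA α x.1 = 0 := by
  rw [projSimple_mk] at hx
  exact mem_idealA_iff.1 ((Submodule.Quotient.mk_eq_zero _).1 hx)

/-- The kernel of `P_α → L_α` lies in every maximal submodule of `P_α`. -/
theorem mem_of_isCoatom_of_charA_eq_zero {α : 𝒱.BFeas} {N : Submodule 𝒱.Aᵐᵒᵖ (𝒱.P α)}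
    (hN : IsCoatom N) {x : 𝒱.P α} (hx : charA α x.1 = 0) : x ∈ N := by
  have : IsSimpleModule 𝒱.Aᵐᵒᵖ (𝒱.P α ⧸ N) := isSimpleModule_iff_isCoatom.2 hN
  obtain ⟨β, ⟨φ⟩⟩ := exists_equiv_L (𝒱 := 𝒱) (S := 𝒱.P α ⧸ N)
  let ψ : 𝒱.P α →ₗ[𝒱.Aᵐᵒᵖ] 𝒱.L β := φ.toLinearMap ∘ₗ N.mkQ
  have hψ0 : ∀ y, ψ y = 0 → y ∈ N := fun y hy =>
    (Submodule.Quotient.mk_eq_zero N).1 (φ.map_eq_zero_iff.1 hy)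
  have hψ : ∀ y : 𝒱.P α, ψ y = charA β y.1 • ψ (genP α) := fun y => by
    rw [← smul_L, ← map_smul, op_smul_genP]
  have hβ : β = α := by
    refine eq_of_charA_ne_zero fun h0 => hN.1 (eq_top_iff.2 fun y _ => hψ0 y ?_)
    have h1 : ψ (genP α) = 0 := by
      rw [hψ, show (genP α).1 = 𝒱.eA α.toFeas from rfl, h0, zero_smul]
    rw [hψ, h1, smul_zero]
  subst hβ
  exact hψ0 x (by rw [hψ, hx, zero_smul])

theorem isProjectiveCover (α : 𝒱.BFeas) :
    IsProjectiveCover (𝒱.projSimple α ∘ₗ 𝒱.projStd α) := by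
  refine ⟨inferInstance, (projSimple_surjective α).comp (projStd_surjective α), fun N hN => ?_⟩
  by_contra hne
  obtain ⟨N', hN', hNN'⟩ := (eq_top_or_exists_le_coatom N).resolve_left hne
  exact hN'.1 (top_le_iff.1 (hN ▸ sup_le hNN' fun x hx =>
    mem_of_isCoatom_of_charA_eq_zero hN' (charA_eq_zero_of_mem_ker hx)))

/-! ### Injective hulls -/

variable (𝒱) in
/-- The functionals on `A` that factor through right multiplication by `e_α`. -/
def dualSubmodule (α : 𝒱.BFeas) : Submodule ℝ (Module.Dual ℝ 𝒱.A) where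
  carrier := {φ | ∀ x, φ (x * 𝒱.eA α.toFeas) = φ x}
  add_mem' hφ hψ x := by rw [LinearMap.add_apply, hφ x, hψ x, LinearMap.add_apply]
  zero_mem' _ := rfl
  smul_mem' r φ hφ x := by rw [LinearMap.smul_apply, hφ x, LinearMap.smul_apply]

variable (𝒱) in
/-- The injective hull of `L_α`: the dual of the left module `A e_α`, realized by functionals on
`A`. -/
def DualLeft (α : 𝒱.BFeas) : Type u := 𝒱.dualSubmodule α

namespace DualLeft

variable {α : 𝒱.BFeas}

instance : AddCommGroup (𝒱.DualLeft α) := inferInstanceAs (AddCommGroup (𝒱.dualSubmodule α))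

instance : Module ℝ (𝒱.DualLeft α) := inferInstanceAs (Module ℝ (𝒱.dualSubmodule α))

instance : FiniteDimensional ℝ (𝒱.DualLeft α) :=
  inferInstanceAs (FiniteDimensional ℝ (𝒱.dualSubmodule α))

/-- The functional underlying an element. -/
def eval (φ : 𝒱.DualLeft α) : Module.Dual ℝ 𝒱.A := φ.1

theorem eval_mul_eA (φ : 𝒱.DualLeft α) (x : 𝒱.A) : φ.eval (x * 𝒱.eA α.toFeas) = φ.eval x := φ.2 x

theorem ext {φ ψ : 𝒱.DualLeft α} (h : ∀ x, φ.eval x = ψ.eval x) : φ = ψ :=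
  Subtype.ext (LinearMap.ext h)

theorem eval_add (φ ψ : 𝒱.DualLeft α) (x : 𝒱.A) : (φ + ψ).eval x = φ.eval x + ψ.eval x := rfl

theorem eval_smul_real (r : ℝ) (φ : 𝒱.DualLeft α) (x : 𝒱.A) : (r • φ).eval x = r * φ.eval x := rfl

instance : SMul 𝒱.Aᵐᵒᵖ (𝒱.DualLeft α) where
  smul c φ := ⟨φ.eval ∘ₗ LinearMap.mulLeft ℝ c.unop, fun x => by
    simp only [LinearMap.comp_apply, LinearMap.mulLeft_apply]
    rw [← mul_assoc, eval_mul_eA]⟩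

theorem eval_smul (c : 𝒱.Aᵐᵒᵖ) (φ : 𝒱.DualLeft α) (x : 𝒱.A) :
    (c • φ).eval x = φ.eval (c.unop * x) := rfl

instance : Module 𝒱.Aᵐᵒᵖ (𝒱.DualLeft α) where
  one_smul φ := ext fun x => by rw [eval_smul, MulOpposite.unop_one, one_mul]
  mul_smul c d φ := ext fun x => by
    rw [eval_smul, eval_smul, eval_smul, MulOpposite.unop_mul, mul_assoc]
  smul_zero c := rfl
  smul_add c φ ψ := rfl
  add_smul c d φ := ext fun x => by
    rw [eval_smul, eval_add, eval_smul, eval_smul, MulOpposite.unop_add, add_mul, map_add]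
  zero_smul φ := ext fun x => by
    rw [eval_smul, MulOpposite.unop_zero, zero_mul, map_zero]; rfl

instance : IsScalarTower ℝ 𝒱.Aᵐᵒᵖ (𝒱.DualLeft α) where
  smul_assoc r c φ := ext fun x => by
    rw [eval_smul, eval_smul_real, eval_smul, MulOpposite.unop_smul, smul_mul_assoc, map_smul,
      smul_eq_mul]

instance : Module.Finite 𝒱.Aᵐᵒᵖ (𝒱.DualLeft α) :=
  Module.Finite.of_restrictScalars_finite ℝ _ _

/-- Homomorphisms `N → DualLeft α` correspond to functionals on `N e_α`, and functionals extend. -/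
theorem injective : Module.Injective 𝒱.Aᵐᵒᵖ (𝒱.DualLeft α) := by
  refine ⟨fun X Y _ _ _ _ f hf g => ?_⟩
  let _ : Module ℝ X := Module.compHom X (algebraMap ℝ 𝒱.Aᵐᵒᵖ)
  let _ : Module ℝ Y := Module.compHom Y (algebraMap ℝ 𝒱.Aᵐᵒᵖ)
  have hX : ∀ (r : ℝ) (x : X), r • x = algebraMap ℝ 𝒱.Aᵐᵒᵖ r • x := fun _ _ => rfl
  have hY : ∀ (r : ℝ) (y : Y), r • y = algebraMap ℝ 𝒱.Aᵐᵒᵖ r • y := fun _ _ => rfl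
  have hY' : ∀ (r : ℝ) (c : 𝒱.Aᵐᵒᵖ) (x : Y), (r • c) • x = r • c • x := fun r c x => by
    rw [hY, smul_smul, Algebra.smul_def]
  let fR : X →ₗ[ℝ] Y :=
    { toFun := f
      map_add' := map_add f
      map_smul' := fun r x => by rw [hX, map_smul, RingHom.id_apply, hY] }
  obtain ⟨r, hr⟩ := fR.exists_leftInverse_of_injective (LinearMap.ker_eq_bot.2 hf)
  let G : X →ₗ[ℝ] ℝ :=
    { toFun := fun x => (g x).eval 1
      map_add' := fun x y => by rw [map_add, eval_add]
      map_smul' := fun r x => by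
        rw [hX, map_smul, eval_smul, RingHom.id_apply, mul_one, MulOpposite.algebraMap_apply,
          MulOpposite.unop_op, Algebra.algebraMap_eq_smul_one, map_smul] }
  have hrf : ∀ x, r (f x) = x := fun x => LinearMap.congr_fun hr x
  let H : Y → 𝒱.DualLeft α := fun m => ⟨
    { toFun := fun x => G (r (MulOpposite.op (x * 𝒱.eA α.toFeas) • m))
      map_add' := fun x y => by
        rw [add_mul, MulOpposite.op_add, add_smul, map_add, map_add]
      map_smul' := fun s x => by
        rw [smul_mul_assoc, MulOpposite.op_smul, hY', map_smul, map_smul, RingHom.id_apply] },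
    fun x => by
      change G (r (MulOpposite.op (x * 𝒱.eA α.toFeas * 𝒱.eA α.toFeas) • m)) =
        G (r (MulOpposite.op (x * 𝒱.eA α.toFeas) • m))
      rw [mul_assoc, eA_mul_self]⟩
  have hH : ∀ m x, (H m).eval x = G (r (MulOpposite.op (x * 𝒱.eA α.toFeas) • m)) := fun _ _ => rfl
  refine ⟨
    { toFun := H
      map_add' := fun m m' => ext fun x => ?_
      map_smul' := fun c m => ext fun x => ?_ }, fun n => ext fun x => ?_⟩
  · rw [eval_add, hH, hH, hH, smul_add, map_add, map_add]
  · rw [RingHom.id_apply, eval_smul, hH, hH, smul_smul, mul_assoc, MulOpposite.op_mul c.unop,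
      MulOpposite.op_unop]
  · change (H (f n)).eval x = _
    rw [hH, ← map_smul, hrf]
    change (g _).eval 1 = _
    rw [map_smul, eval_smul, MulOpposite.unop_op, mul_one, eval_mul_eA]

/-- The embedding of `L_α`, whose image is spanned by the character of `L_α`. -/
def ofL (α : 𝒱.BFeas) : 𝒱.L α →ₗ[𝒱.Aᵐᵒᵖ] 𝒱.DualLeft α :=
  (𝒱.idealA α).liftQ
    { toFun := fun a => ⟨(charA α).toLinearMap ∘ₗ LinearMap.mulLeft ℝ a, fun x => by
        simp [charA_eA_self]⟩
      map_add' := fun a b => ext fun x => by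
        change charA α ((a + b) * x) = charA α (a * x) + charA α (b * x)
        rw [add_mul, map_add]
      map_smul' := fun c a => ext fun x => by
        change charA α (a * c.unop * x) = charA α (a * (c.unop * x))
        rw [mul_assoc] }
    fun a ha => ext fun x => by
      change charA α (a * x) = 0
      rw [map_mul, mem_idealA_iff.1 ha, zero_mul]

theorem eval_ofL_mk (a x : 𝒱.A) :
    (ofL α ((𝒱.idealA α).mkQ a)).eval x = charA α (a * x) := rfl

theorem isInjectiveHull_ofL (α : 𝒱.BFeas) : IsInjectiveHull (ofL α) := by
  refine ⟨injective, ?_, fun N hN => ?_⟩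
  · rw [injective_iff_map_eq_zero]
    intro y hy
    obtain ⟨a, rfl⟩ := Submodule.mkQ_surjective _ y
    have h := eval_ofL_mk (α := α) a 1
    rw [hy, mul_one] at h
    rw [Submodule.mkQ_apply, Submodule.Quotient.mk_eq_zero, mem_idealA_iff, ← h]
    rfl
  · -- otherwise `N` contains a simple submodule, and the only one is the image of `L_α`
    by_contra hne
    have : IsArtinian 𝒱.Aᵐᵒᵖ (𝒱.DualLeft α) := isArtinian_of_tower ℝ inferInstance
    obtain ⟨S, hS, hSN⟩ := (eq_bot_or_exists_atom_le N).resolve_left hne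
    have : IsSimpleModule 𝒱.Aᵐᵒᵖ S := isSimpleModule_iff_isAtom.2 hS
    obtain ⟨β, ⟨e⟩⟩ := exists_equiv_L (𝒱 := 𝒱) (S := S)
    set φ := e.symm ((𝒱.idealA β).mkQ 1) with hφ
    have hφ0 : φ ≠ 0 := fun h => mk_one_ne_zero β (e.symm.map_eq_zero_iff.1 h)
    have hφe : ∀ a, φ.1.eval a = charA β a * φ.1.eval 1 := fun a => by
      have h1 : MulOpposite.op a • φ = e.symm (charA β a • (𝒱.idealA β).mkQ 1) := by
        rw [hφ, ← map_smul, smul_L]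
      have h2 : charA β a • (𝒱.idealA β).mkQ 1 =
          MulOpposite.op (algebraMap ℝ 𝒱.A (charA β a)) • (𝒱.idealA β).mkQ 1 := by
        rw [smul_L, AlgHom.commutes, Algebra.algebraMap_self, RingHom.id_apply]
      rw [h2, map_smul, ← hφ] at h1
      have h3 := congrArg (fun ψ : S => ψ.1.eval 1) h1
      change (MulOpposite.op a • φ.1).eval 1 = (MulOpposite.op _ • φ.1).eval 1 at h3
      rw [eval_smul, eval_smul, mul_one, mul_one, MulOpposite.unop_op, MulOpposite.unop_op,
        Algebra.algebraMap_eq_smul_one, map_smul, smul_eq_mul] at h3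
      exact h3
    have h1 : φ.1.eval 1 ≠ 0 := fun h => hφ0 (Subtype.ext (ext fun x => by
      rw [hφe, h, mul_zero]; rfl))
    have hβ : β = α := by
      refine eq_of_charA_ne_zero fun h => h1 ?_
      rw [← eval_mul_eA, one_mul, hφe, h, zero_mul]
    subst hβ
    have hmem : φ.1 ∈ N ⊓ LinearMap.range (ofL β) := by
      refine ⟨hSN φ.2, (𝒱.idealA β).mkQ (φ.1.eval 1 • 1), ext fun x => ?_⟩
      rw [eval_ofL_mk, hφe x, smul_mul_assoc, one_mul, map_smul, smul_eq_mul, mul_comm]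
    rw [hN, Submodule.mem_bot] at hmem
    exact hφ0 (Subtype.ext hmem)

end DualLeft

variable (𝒱) in
theorem isQuasiHereditary :
    IsQuasiHereditary 𝒱.A 𝒱.L (fun α => 𝒱.P α) 𝒱.Std 𝒱.projStd 𝒱.projSimple where
  finiteDimensional := inferInstance
  simple := isSimpleModule_L
  eq_of_iso _ _ := fun ⟨f⟩ => eq_of_equiv_L f
  exhaust _ _ _ _ := exists_equiv_L
  projectiveCover := isProjectiveCover
  injectiveHull α := ⟨𝒱.DualLeft α, inferInstance, inferInstance, DualLeft.ofL α, inferInstance,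
    DualLeft.isInjectiveHull_ofL α⟩
  epi_Pr := projStd_surjective
  epi_pr := projSimple_surjective
  ker_pr := ker_projSimple_hasFiltrationBy
  ker_Pr := ker_projStd_hasFiltrationBy

/-! ### Gradings -/

open Polynomial

theorem mapAlgHom_symA_commute (f : (SymmetricAlgebra ℝ (Module.Dual ℝ 𝒱.V))[X]) (g : 𝒱.A[X]) :
    Commute (Polynomial.mapAlgHom 𝒱.symA f) g := by
  induction f using Polynomial.induction_on' with
  | add f f' hf hf' => rw [map_add]; exact hf.add_left hf'
  | monomial m s =>
    induction g using Polynomial.induction_on' with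
    | add g g' hg hg' => exact hg.add_right hg'
    | monomial n a =>
      rw [Commute, SemiconjBy, Polynomial.coe_mapAlgHom, Polynomial.map_monomial,
        Polynomial.monomial_mul_monomial, Polynomial.monomial_mul_monomial, add_comm]
      exact congrArg _ (symA_commute s a)

variable (𝒱) in
/-- The generators of `A`, each multiplied by `X ^ n` where `n` is its degree. -/
def gradingData : LiftData 𝒱 𝒱.A[X] (SymmetricAlgebra ℝ (Module.Dual ℝ 𝒱.V))[X] where
  e α := monomial 0 (𝒱.eA α)
  p α β h := monomial 1 (𝒱.pA α β h)
  t := (monomial 2).restrictScalars ℝ ∘ₗ SymmetricAlgebra.ι ℝ (Module.Dual ℝ 𝒱.V)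
  c := Polynomial.mapAlgHom 𝒱.symA
  central := mapAlgHom_symA_commute
  idem α := by rw [monomial_mul_monomial, eA_mul_self]
  orth α β h := by rw [monomial_mul_monomial, eA_mul_eA_of_ne h, map_zero]
  unit := by rw [← map_sum, sum_eA, monomial_zero_one]
  source α β h := by rw [monomial_mul_monomial, eA_mul_pA]
  target α β h := by rw [monomial_mul_monomial, pA_mul_eA]
  unbounded α h := by rw [𝒱.eA_eq_zero α h, map_zero]
  square α β γ δ hd h1 h2 h3 h4 := by
    rw [monomial_mul_monomial, monomial_mul_monomial, pA_square hd h1 h2 h3 h4]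
  back i α β hi h1 h2 := by
    rw [monomial_mul_monomial, pA_mul_pA_back hi, LinearMap.comp_apply,
      LinearMap.restrictScalars_apply, Polynomial.coe_mapAlgHom, Polynomial.map_monomial,
      monomial_mul_monomial]
    rfl

variable (𝒱) in
/-- The coaction `A → A[X]` sending a homogeneous element `a` of degree `n` to `a X ^ n`. -/
def coaction : 𝒱.A →ₐ[ℝ] 𝒱.A[X] := 𝒱.gradingData.hom

theorem coaction_of_isWord {n : ℕ} {a : 𝒱.A} (h : 𝒱.IsWord n a) : 𝒱.coaction a = monomial n a := by
  induction h with
  | one => rw [map_one, monomial_zero_one]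
  | e α => exact LiftData.hom_eA _ α
  | p α β h => exact LiftData.hom_pA _ α β h
  | t w =>
    refine (LiftData.hom_tA _ w).trans ?_
    change Polynomial.mapAlgHom 𝒱.symA (monomial 2 (SymmetricAlgebra.ι ℝ _ w)) = _
    rw [Polynomial.coe_mapAlgHom, Polynomial.map_monomial]
    rfl
  | mul _ _ ha hb => rw [map_mul, ha, hb, monomial_mul_monomial]

theorem coaction_of_mem_gradeA {n : ℕ} {a : 𝒱.A} (h : a ∈ 𝒱.gradeA n) :
    𝒱.coaction a = monomial n a := by
  induction h using Submodule.span_induction with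
  | mem a h => exact coaction_of_isWord h
  | zero => rw [map_zero, map_zero]
  | add a b _ _ ha hb => rw [map_add, ha, hb, map_add]
  | smul r a _ ha => rw [map_smul, ha, smul_monomial]

variable (𝒱) in
/-- The degree `n` component. -/
def component (n : ℕ) : 𝒱.A →ₗ[ℝ] 𝒱.A :=
  (Polynomial.lcoeff 𝒱.A n).restrictScalars ℝ ∘ₗ 𝒱.coaction.toLinearMap

theorem component_apply (n : ℕ) (a : 𝒱.A) : 𝒱.component n a = (𝒱.coaction a).coeff n := rfl

theorem component_of_mem_gradeA {m n : ℕ} {a : 𝒱.A} (h : a ∈ 𝒱.gradeA m) :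
    𝒱.component n a = if m = n then a else 0 := by
  rw [component_apply, coaction_of_mem_gradeA h, coeff_monomial]

theorem gradedMonoid_gradeA : SetLike.GradedMonoid 𝒱.gradeA where
  one_mem := Submodule.subset_span IsWord.one
  mul_mem m n a b ha hb := by
    induction ha using Submodule.span_induction with
    | zero => rw [zero_mul]; exact zero_mem _
    | add a a' _ _ ha ha' => rw [add_mul]; exact add_mem ha ha'
    | smul r a _ ha => rw [smul_mul_assoc]; exact Submodule.smul_mem _ r ha
    | mem a ha =>
      induction hb using Submodule.span_induction with
      | zero => rw [mul_zero]; exact zero_mem _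
      | add b b' _ _ hb hb' => rw [mul_add]; exact add_mem hb hb'
      | smul r b _ hb => rw [mul_smul_comm]; exact Submodule.smul_mem _ r hb
      | mem b hb => exact Submodule.subset_span (ha.mul hb)

theorem iSup_gradeA : ⨆ n, 𝒱.gradeA n = ⊤ := by
  have hmul : ∀ {k : ℕ} {g : 𝒱.A}, 𝒱.IsWord k g → ∀ x ∈ ⨆ n, 𝒱.gradeA n,
      x * g ∈ ⨆ n, 𝒱.gradeA n := fun {k g} hg x hx => by
    induction hx using Submodule.iSup_induction' with
    | mem n x hx =>
      exact Submodule.mem_iSup_of_mem (n + k)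
        (gradedMonoid_gradeA.mul_mem hx (Submodule.subset_span hg))
    | zero => rw [zero_mul]; exact zero_mem _
    | add x y _ _ hx hy => rw [add_mul]; exact add_mem hx hy
  refine eq_top_iff.2 fun a _ => ?_
  rw [← one_mul a]
  exact mul_mem_of_generators _ (fun x hx α => hmul (.e α) x hx)
    (fun x hx α β h => hmul (.p α β h) x hx) (fun x hx w => hmul (.t w) x hx)
    (Submodule.mem_iSup_of_mem 0 gradedMonoid_gradeA.one_mem) a

/-- A spanning family of subspaces is a grading if it is separated by a family of linear maps, the
`n`-th of which is injective on the `n`-th subspace and zero on the others. -/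
theorem isInternal_of_separating {M M' : Type*} [AddCommGroup M] [Module ℝ M] [AddCommGroup M']
    [Module ℝ M'] {ℳ : ℕ → Submodule ℝ M} (hℳ : ⨆ n, ℳ n = ⊤) (f : ℕ → M →ₗ[ℝ] M')
    (h_inj : ∀ n, ∀ x ∈ ℳ n, f n x = 0 → x = 0)
    (h_zero : ∀ m n, m ≠ n → ∀ x ∈ ℳ m, f n x = 0) : DirectSum.IsInternal ℳ := by
  refine DirectSum.isInternal_submodule_of_iSupIndep_of_iSup_eq_top ?_ hℳ
  refine fun n => Submodule.disjoint_def.2 fun x hx hx' => h_inj n x hx ?_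
  exact (iSup₂_le (a := LinearMap.ker (f n)) fun m hm y hy => h_zero m n hm y hy) hx'

variable (𝒱) in
theorem isAlgebraGrading_gradeA : IsAlgebraGrading 𝒱.gradeA :=
  ⟨gradedMonoid_gradeA, isInternal_of_separating iSup_gradeA 𝒱.component
    (fun n x hx h => by rwa [component_of_mem_gradeA hx, if_pos rfl] at h)
    (fun m n hmn x hx => by rw [component_of_mem_gradeA hx, if_neg hmn])⟩

theorem mem_gradeP {α : 𝒱.BFeas} {n : ℕ} {x : 𝒱.P α} : x ∈ 𝒱.gradeP α n ↔ x.1 ∈ 𝒱.gradeA n :=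
  Iff.rfl

theorem iSup_gradeP (α : 𝒱.BFeas) : ⨆ n, 𝒱.gradeP α n = ⊤ := by
  let g : 𝒱.A →ₗ[ℝ] 𝒱.P α :=
    { toFun := fun a => ⟨𝒱.eA α.toFeas * a, eA_mul_mem_P α a⟩
      map_add' := fun a b => Subtype.ext (mul_add _ a b)
      map_smul' := fun r a => Subtype.ext (mul_smul_comm r _ a) }
  have hg : ∀ n, (𝒱.gradeA n).map g ≤ 𝒱.gradeP α n := fun n => by
    rintro _ ⟨a, ha, rfl⟩
    have h := gradedMonoid_gradeA.mul_mem (Submodule.subset_span (IsWord.e α.toFeas)) ha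
    rw [zero_add] at h
    exact h
  refine eq_top_iff.2 fun x _ => ?_
  have hx : g x.1 = x := Subtype.ext (mem_P_iff.1 x.2)
  have h : g x.1 ∈ (⨆ n, 𝒱.gradeA n).map g :=
    Submodule.mem_map_of_mem (by rw [iSup_gradeA]; trivial)
  rw [hx, Submodule.map_iSup] at h
  exact iSup_mono hg h

variable (𝒱) in
theorem isRightModuleGrading_gradeP (α : 𝒱.BFeas) :
    IsRightModuleGrading 𝒱.gradeA (𝒱.gradeP α) :=
  ⟨isInternal_of_separating (iSup_gradeP α)
    (fun n => 𝒱.component n ∘ₗ (𝒱.P α).subtype.restrictScalars ℝ)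
    (fun n x hx h => by
      change 𝒱.component n x.1 = 0 at h
      rw [component_of_mem_gradeA (mem_gradeP.1 hx), if_pos rfl] at h
      exact Subtype.ext h)
    (fun m n hmn x hx => (component_of_mem_gradeA hx).trans (if_neg hmn)),
    fun _ _ _ hx _ ha => gradedMonoid_gradeA.mul_mem hx ha⟩

/-- The right ideal `K_{>α}` is homogeneous. -/
theorem component_mem_K {α : 𝒱.BFeas} {x : 𝒱.A} (hx : x ∈ 𝒱.K α) (n : ℕ) :
    𝒱.component n x ∈ 𝒱.K α := by
  induction hx using Submodule.span_induction generalizing n with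
  | mem x hx =>
    have hx' := Submodule.subset_span (R := 𝒱.Aᵐᵒᵖ) hx
    obtain ⟨a, i, β, h, -, -, -, rfl⟩ := hx
    rw [component_of_mem_gradeA (Submodule.subset_span (IsWord.p _ β h))]
    split_ifs
    exacts [hx', zero_mem _]
  | zero => rw [map_zero]; exact zero_mem _
  | add x y _ _ hx hy => rw [map_add]; exact add_mem (hx n) (hy n)
  | smul c x _ hx =>
    change (𝒱.coaction (x * c.unop)).coeff n ∈ _
    rw [map_mul, coeff_mul]
    exact sum_mem fun ij _ => (𝒱.K α).smul_mem (MulOpposite.op _) (hx ij.1)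

/-- The grading of `V_α` induced by the grading of `P_α`. -/
def gradeStd (α : 𝒱.BFeas) (n : ℕ) : Submodule ℝ (𝒱.Std α) :=
  (𝒱.gradeP α n).map ((𝒱.projStd α).restrictScalars ℝ)

/-- The `n`-th component as a map `V_α → A / K_{>α}`. -/
def componentStd (α : 𝒱.BFeas) (n : ℕ) : 𝒱.Std α →ₗ[ℝ] 𝒱.A ⧸ (𝒱.K α).restrictScalars ℝ :=
  (((𝒱.K α).submoduleOf (𝒱.P α)).restrictScalars ℝ).liftQ
    (((𝒱.K α).restrictScalars ℝ).mkQ ∘ₗ 𝒱.component n ∘ₗ (𝒱.P α).subtype.restrictScalars ℝ)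
    fun _ hx => (Submodule.Quotient.mk_eq_zero _).2 (component_mem_K hx n)

theorem componentStd_eq_zero {α : 𝒱.BFeas} {n : ℕ} {x : 𝒱.P α} :
    componentStd α n (𝒱.projStd α x) = 0 ↔ 𝒱.component n x.1 ∈ 𝒱.K α :=
  Submodule.Quotient.mk_eq_zero _

theorem isRightModuleGrading_gradeStd (α : 𝒱.BFeas) :
    IsRightModuleGrading 𝒱.gradeA (gradeStd α) := by
  refine ⟨isInternal_of_separating ?_ (componentStd α) ?_ ?_, ?_⟩
  · unfold gradeStd
    rw [← Submodule.map_iSup, iSup_gradeP, Submodule.map_top]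
    exact LinearMap.range_eq_top.2 (projStd_surjective α)
  · rintro n _ ⟨x, hx, rfl⟩ h
    have h' := componentStd_eq_zero.1 h
    rw [component_of_mem_gradeA (mem_gradeP.1 hx), if_pos rfl] at h'
    exact projStd_eq_zero.2 h'
  · rintro m n hmn _ ⟨x, hx, rfl⟩
    refine componentStd_eq_zero.2 ?_
    rw [component_of_mem_gradeA (mem_gradeP.1 hx), if_neg hmn]
    exact zero_mem _
  · rintro m n _ ⟨x, hx, rfl⟩ a ha
    exact ⟨MulOpposite.op a • x, (isRightModuleGrading_gradeP 𝒱 α).2 m n x hx a ha,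
      map_smul (𝒱.projStd α) _ x⟩

end PolarizedArrangement

end

theorem theorem5 {I : Type*} [Fintype I] (𝒱 : PolarizedArrangement I) :
    -- `A` is quasi-hereditary for the order on `𝒫`, with standard modules `V_α = P_α / K_{>α}`,
    IsQuasiHereditary 𝒱.A 𝒱.L (fun α => 𝒱.P α) 𝒱.Std 𝒱.projStd 𝒱.projSimple ∧
    -- `A` is graded, and so are the projectives `P_α = e_α A`,
    IsAlgebraGrading 𝒱.gradeA ∧
    (∀ α, IsRightModuleGrading 𝒱.gradeA (𝒱.gradeP α)) ∧
    -- and each `V_α` has a grading for which the projection `P_α → V_α` preserves degrees.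
    (∀ α, ∃ 𝒢 : ℕ → Submodule ℝ (𝒱.Std α), IsRightModuleGrading 𝒱.gradeA 𝒢 ∧
      ∀ n, ∀ x ∈ 𝒱.gradeP α n, 𝒱.projStd α x ∈ 𝒢 n) :=
  ⟨𝒱.isQuasiHereditary, 𝒱.isAlgebraGrading_gradeA, 𝒱.isRightModuleGrading_gradeP, fun α =>
    ⟨PolarizedArrangement.gradeStd α, PolarizedArrangement.isRightModuleGrading_gradeStd α,
      fun _ _ hx => Submodule.mem_map_of_mem hx⟩⟩
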